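/- Let $k$ be a field; all tensor products are over $k$ unless indicated, and Sweedler notation is used. A coquasi-bialgebra is a coalgebra $(H,\Delta,\varepsilon)$ with coalgebra morphisms $H\otimes H\to H$, $h\otimes g\mapsto hg$, and $k\to H$, $1\mapsto 1_H$, and a convolution invertible $\omega\in(H\otimes H\otimes H)^*$ such that for all $h,g,l,p\in H$: $1_Hh=h1_H=h$, $h_1(g_1l_1)\,\omega(h_2,g_2,l_2)=\omega(h_1,g_1,l_1)\,(h_2g_2)l_2$, $\omega(h_1,g_1,l_1p_1)\,\omega(h_2g_2,l_2,p_2)=\omega(g_1,l_1,p_1)\,\omega(h_1,g_2l_2,p_2)\,\omega(h_2,g_3,l_3)$, $\omega(h,1_H,g)=\varepsilon(h)\varepsilon(g)$. A coquasi-Hopf algebra is a coquasi-bialgebra with a coalgebra antihomomorphism $S:H\to H$ (the antipode) and $\alpha,\beta\in H^*$ such that $S(h_1)\alpha(h_2)h_3=\alpha(h)1_H$, $h_1\beta(h_2)S(h_3)=\beta(h)1_H$, and $\omega(h_1\beta(h_2),S(h_3),\alpha(h_4)h_5)=\omega^{-1}(S(h_1),\alpha(h_2)h_3\beta(h_4),S(h_5))=\varepsilon(h)$.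 Let $H$ be a coquasi-Hopf algebra with bijective antipode, and let $A$ be a right $H$-comodule algebra: a right $H$-comodule with coaction $\rho(a)=a_0\otimes a_1$, and with a colinear multiplication and a colinear unit $1_A$ (that is, $\rho(ab)=a_0b_0\otimes a_1b_1$ and $\rho(1_A)=1_A\otimes 1_H$) such that $1_Aa=a1_A=a$ and $(ab)c=a_0(b_0c_0)\,\omega(a_1,b_1,c_1)$. Let $B=A^{coH}=\{a\in A:\rho(a)=a\otimes 1_H\}$, an associative unital subalgebra. Let $\mathcal M_B$ be the category of right $B$-modules, and $\mathcal M_A^H$ the category of relative Hopf modules: right $H$-comodules $M$ with an $A$-action such that $(ma)b=m_0(a_0b_0)\,\omega(m_1,a_1,b_1)$, $m1_A=m$ and $\rho(ma)=m_0a_0\otimes m_1a_1$; morphisms are the colinear maps that respect the action. The induction functor $(-)\otimes_BA:\mathcal M_B\to\mathcal M_A^H$, with structure $\rho(n\otimes_Ba)=n\otimes_Ba_0\otimes a_1$, $(n\otimes_Ba)c=n\otimes_Bac$, is left adjoint to the functor of coinvariants $M\mapsto M^{coH}=\{m:\rho(m)=m\otimes 1_H\}$, with counit $\varepsilon_M:M^{coH}\otimes_BA\to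 M$, $m\otimes_Ba\mapsto ma$, and unit $u_N:N\to(N\otimes_BA)^{coH}$, $n\mapsto n\otimes_B1_A$. Then the following are equivalent: (1) $B\subseteq A$ is $H$-cleft: there are linear maps $\gamma,\delta:H\to A$ with $\rho(\gamma(h))=\gamma(h_1)\otimes h_2$, $\rho(\delta(h))=\delta(h_2)\otimes S(h_1)$, $\delta(h_1)\gamma(h_2)=\alpha(h)1_A$ and $\gamma(h_1)\beta(h_2)\delta(h_3)=\varepsilon(h)1_A$ for all $h\in H$; (2) the Weak Structure Theorem holds, i.e. $\varepsilon_M$ is bijective for every $M\in\mathcal M_A^H$, and the extension has the normal basis property, i.e. there is an isomorphism $B\otimes H\cong A$ of left $B$-modules and right $H$-comodules (with $B$ acting on the first factor and $H$ coacting on the second); (3) $B\subseteq A$ is $H$-Galois, i.e. the map $can:A\otimes_BA\to A\otimes H$, $a\otimes_Bb\mapsto a_0b_0\otimes b_4\,\omega^{-1}(a_1,b_1\beta(b_2),S(b_3))$, is bijective, and the extension has the normal basis property. In this case the categories $\mathcal M_B$ and $\mathcal M_A^H$ are equivalent; more precisely the Strong Structure Theorem holds: the unit $u$ and the counit $\varepsilon$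 of the above adjunction are isomorphisms, so that $(-)\otimes_BA$ and $(-)^{coH}$ are inverse equivalences. -/

import Mathlib

universe w u

noncomputable section

open TensorProduct CategoryTheory

namespace CoquasiHopf

/-! ### Coquasi-bialgebras and coquasi-Hopf algebras

The underlying (nonassociative, unital) `k`-algebra of a coquasi-bialgebra is a `NonAssocRing` with
a compatible `k`-module structure.  Trilinear forms on `H` are linear forms on
`H ⊗ (H ⊗ H)`; this space and `H ⊗ (H ⊗ (H ⊗ H))` carry the tensor product coalgebra structure. -/

section Coquasi

variable (k : Type w) (H : Type u) [Field k] [NonAssocRing H] [Module k H]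
  [IsScalarTower k H H] [SMulCommClass k H H]

/-- `h ⊗ g ⊗ l ↦ h (g l)`. -/
def mulRight₃ : H ⊗[k] (H ⊗[k] H) →ₗ[k] H :=
  LinearMap.mul' k H ∘ₗ LinearMap.lTensor H (LinearMap.mul' k H)

/-- `h ⊗ g ⊗ l ↦ (h g) l`. -/
def mulLeft₃ : H ⊗[k] (H ⊗[k] H) →ₗ[k] H :=
  LinearMap.mul' k H ∘ₗ LinearMap.rTensor H (LinearMap.mul' k H) ∘ₗ
    (TensorProduct.assoc k H H H).symm.toLinearMap

/-- `h ⊗ g ⊗ l ⊗ p ↦ h ⊗ g ⊗ l p`. -/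
def mulLast : H ⊗[k] (H ⊗[k] (H ⊗[k] H)) →ₗ[k] H ⊗[k] (H ⊗[k] H) :=
  LinearMap.lTensor H (LinearMap.lTensor H (LinearMap.mul' k H))

/-- `h ⊗ g ⊗ l ⊗ p ↦ h ⊗ g l ⊗ p`. -/
def mulMiddle : H ⊗[k] (H ⊗[k] (H ⊗[k] H)) →ₗ[k] H ⊗[k] (H ⊗[k] H) :=
  LinearMap.lTensor H (LinearMap.rTensor H (LinearMap.mul' k H) ∘ₗ
    (TensorProduct.assoc k H H H).symm.toLinearMap)

/-- `h ⊗ g ⊗ l ⊗ p ↦ h g ⊗ l ⊗ p`. -/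
def mulFirst : H ⊗[k] (H ⊗[k] (H ⊗[k] H)) →ₗ[k] H ⊗[k] (H ⊗[k] H) :=
  LinearMap.rTensor (H ⊗[k] H) (LinearMap.mul' k H) ∘ₗ
    (TensorProduct.assoc k H H (H ⊗[k] H)).symm.toLinearMap

variable {k H}

/-- `h ⊗ g ⊗ l ⊗ p ↦ ε(h) f(g, l, p)`. -/
def counitTimes [Coalgebra k H] (f : H ⊗[k] (H ⊗[k] H) →ₗ[k] k) :
    H ⊗[k] (H ⊗[k] (H ⊗[k] H)) →ₗ[k] k :=
  LinearMap.mul' k k ∘ₗ TensorProduct.map Coalgebra.counit f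

/-- `h ⊗ g ⊗ l ⊗ p ↦ f(h, g, l) ε(p)`. -/
def timesCounit [Coalgebra k H] (f : H ⊗[k] (H ⊗[k] H) →ₗ[k] k) :
    H ⊗[k] (H ⊗[k] (H ⊗[k] H)) →ₗ[k] k :=
  LinearMap.mul' k k ∘ₗ TensorProduct.map f Coalgebra.counit ∘ₗ
    (TensorProduct.assoc k H (H ⊗[k] H) H).symm.toLinearMap ∘ₗ
    LinearMap.lTensor H (TensorProduct.assoc k H H H).symm.toLinearMap

variable (k H)

/-- A coquasi-bialgebra over the field `k`. The products in `omega_mul_omegaInv`,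
`omegaInv_mul_omega` and `cocycle` are convolution products of linear forms. -/
class CoquasiBialgebra extends Coalgebra k H where
  counit_one : counit (1 : H) = 1
  comul_one : comul (1 : H) = (1 : H) ⊗ₜ[k] (1 : H)
  counit_mul : ∀ h g : H, counit (h * g) = counit h * counit g
  /-- `Δ(hg) = h₁g₁ ⊗ h₂g₂`: the product on the right is the factorwise product of `H ⊗ H`. -/
  comul_mul : ∀ h g : H, comul (h * g) = comul h * comul g
  /-- The reassociator. -/
  omega : H ⊗[k] (H ⊗[k] H) →ₗ[k] k
  /-- The convolution inverse of the reassociator. -/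
  omegaInv : H ⊗[k] (H ⊗[k] H) →ₗ[k] k
  omega_mul_omegaInv : WithConv.toConv omega * WithConv.toConv omegaInv = 1
  omegaInv_mul_omega : WithConv.toConv omegaInv * WithConv.toConv omega = 1
  /-- `h₁(g₁l₁) ω(h₂,g₂,l₂) = ω(h₁,g₁,l₁) (h₂g₂)l₂`. -/
  quasi_assoc : (TensorProduct.rid k H).toLinearMap ∘ₗ
      TensorProduct.map (mulRight₃ k H) omega ∘ₗ Coalgebra.comul =
    (TensorProduct.lid k H).toLinearMap ∘ₗ
      TensorProduct.map omega (mulLeft₃ k H) ∘ₗ Coalgebra.comul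
  /-- `ω(h₁,g₁,l₁p₁) ω(h₂g₂,l₂,p₂) = ω(g₁,l₁,p₁) ω(h₁,g₂l₂,p₂) ω(h₂,g₃,l₃)`. -/
  cocycle : WithConv.toConv (omega ∘ₗ mulLast k H) * WithConv.toConv (omega ∘ₗ mulFirst k H) =
    WithConv.toConv (counitTimes omega) * WithConv.toConv (omega ∘ₗ mulMiddle k H) *
      WithConv.toConv (timesCounit omega)
  omega_one_middle : ∀ h g : H, omega (h ⊗ₜ ((1 : H) ⊗ₜ g)) = counit h * counit g

variable {k H}

/-- `f ⇀ h = h₁ f(h₂)`. -/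
def hitLeft [Coalgebra k H] (f : H →ₗ[k] k) : H →ₗ[k] H :=
  (TensorProduct.rid k H).toLinearMap ∘ₗ LinearMap.lTensor H f ∘ₗ Coalgebra.comul

/-- `h ↼ f = f(h₁) h₂`. -/
def hitRight [Coalgebra k H] (f : H →ₗ[k] k) : H →ₗ[k] H :=
  (TensorProduct.lid k H).toLinearMap ∘ₗ LinearMap.rTensor H f ∘ₗ Coalgebra.comul

variable (k H)

/-- `h ↦ h₁ ⊗ h₂ ⊗ h₃`. -/
def comul₃ [Coalgebra k H] : H →ₗ[k] H ⊗[k] (H ⊗[k] H) :=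
  LinearMap.lTensor H Coalgebra.comul ∘ₗ Coalgebra.comul

/-- A coquasi-Hopf algebra over the field `k`. -/
class CoquasiHopfAlgebra extends CoquasiBialgebra k H where
  /-- The antipode, a coalgebra antihomomorphism. -/
  S : H →ₗ[k] H
  counit_S : ∀ h : H, counit (S h) = counit h
  /-- `Δ(S(h)) = S(h₂) ⊗ S(h₁)`. -/
  comul_S : ∀ h : H, comul (S h) = TensorProduct.map S S (TensorProduct.comm k H H (comul h))
  alpha : H →ₗ[k] k
  beta : H →ₗ[k] k
  /-- `S(h₁) α(h₂) h₃ = α(h) 1`. -/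
  S_alpha_id : ∀ h : H,
    LinearMap.mul' k H (TensorProduct.map S (hitRight alpha) (comul h)) = alpha h • (1 : H)
  /-- `h₁ β(h₂) S(h₃) = β(h) 1`. -/
  id_beta_S : ∀ h : H,
    LinearMap.mul' k H (TensorProduct.map (hitLeft beta) S (comul h)) = beta h • (1 : H)
  /-- `ω(h₁ β(h₂), S(h₃), α(h₄) h₅) = ε(h)`. -/
  omega_antipode : ∀ h : H,
    omega (TensorProduct.map (hitLeft beta) (TensorProduct.map S (hitRight alpha)) (comul₃ k H h)) =
      counit h
  /-- `ω⁻¹(S(h₁), α(h₂) h₃ β(h₄), S(h₅)) = ε(h)`. -/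
  omegaInv_antipode : ∀ h : H,
    omegaInv (TensorProduct.map S (TensorProduct.map (hitLeft beta ∘ₗ hitRight alpha) S)
      (comul₃ k H h)) = counit h

end Coquasi

/-! ### Comodules, comodule algebras, relative Hopf modules -/

section Comodule

/-- A right comodule over the coalgebra `H`. -/
class RightComodule (k : Type w) (H : Type u) (M : Type u) [Field k] [AddCommGroup H] [Module k H]
    [Coalgebra k H] [AddCommGroup M] [Module k M] where
  /-- The coaction `m ↦ m₀ ⊗ m₁`. -/
  coact : M →ₗ[k] M ⊗[k] H
  coassoc : (TensorProduct.assoc k M H H).toLinearMap ∘ₗ LinearMap.rTensor H coact ∘ₗ coact =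
    LinearMap.lTensor M Coalgebra.comul ∘ₗ coact
  coact_counit : (TensorProduct.rid k M).toLinearMap ∘ₗ
    LinearMap.lTensor M Coalgebra.counit ∘ₗ coact = LinearMap.id

/-- The coaction `ρ : M → M ⊗ H`. -/
abbrev coaction (k : Type w) (H : Type u) (M : Type u) [Field k] [AddCommGroup H] [Module k H]
    [Coalgebra k H] [AddCommGroup M] [Module k M] [RightComodule k H M] : M →ₗ[k] M ⊗[k] H :=
  RightComodule.coact

variable (k : Type w) (H : Type u) [Field k] [NonAssocRing H] [Module k H]
  [IsScalarTower k H H] [SMulCommClass k H H] [CoquasiBialgebra k H]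

variable {k H} in
/-- For `p : U ⊗ (V ⊗ W) → M`, the map
`(u ⊗ h) ⊗ ((v ⊗ g) ⊗ (w ⊗ l)) ↦ ω(h, g, l) p(u ⊗ v ⊗ w)`. -/
def omegaTwist {U V W M : Type u} [AddCommGroup U] [Module k U] [AddCommGroup V] [Module k V]
    [AddCommGroup W] [Module k W] [AddCommGroup M] [Module k M] (p : U ⊗[k] (V ⊗[k] W) →ₗ[k] M) :
    (U ⊗[k] H) ⊗[k] ((V ⊗[k] H) ⊗[k] (W ⊗[k] H)) →ₗ[k] M :=
  (TensorProduct.rid k M).toLinearMap ∘ₗ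
    TensorProduct.map p (CoquasiBialgebra.omega (k := k) (H := H)) ∘ₗ
    (TensorProduct.tensorTensorTensorComm k U H (V ⊗[k] W) (H ⊗[k] H)).toLinearMap ∘ₗ
    LinearMap.lTensor (U ⊗[k] H) (TensorProduct.tensorTensorTensorComm k V H W H).toLinearMap

/-- A right `H`-comodule algebra: an algebra in the monoidal category of right `H`-comodules. -/
class ComoduleAlgebra (A : Type u) [NonAssocRing A] [Module k A] [IsScalarTower k A A]
    [SMulCommClass k A A] extends RightComodule k H A where
  coact_one : coact (1 : A) = (1 : A) ⊗ₜ[k] (1 : H)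
  /-- `ρ(ab) = a₀b₀ ⊗ a₁b₁`: the product on the right is the factorwise product of `A ⊗ H`. -/
  coact_mul : ∀ a b : A, coact (a * b) = coact a * coact b
  /-- `(ab)c = a₀(b₀c₀) ω(a₁, b₁, c₁)`. -/
  quasi_assoc : ∀ a b c : A, (a * b) * c =
    omegaTwist (LinearMap.mul' k A ∘ₗ LinearMap.lTensor A (LinearMap.mul' k A))
      (coact a ⊗ₜ (coact b ⊗ₜ coact c))

variable (A : Type u) [NonAssocRing A] [Module k A] [IsScalarTower k A A] [SMulCommClass k A A]
  [ComoduleAlgebra k H A]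

/-- A relative right `(H, A)`-Hopf module: a right `A`-module in the category of right
`H`-comodules. -/
class RelHopfModule (M : Type u) [AddCommGroup M] [Module k M] extends RightComodule k H M where
  /-- The right action `act m a = m a`. -/
  act : M →ₗ[k] A →ₗ[k] M
  act_one : ∀ m : M, act m 1 = m
  /-- `(ma)b = m₀(a₀b₀) ω(m₁, a₁, b₁)`. -/
  act_act : ∀ (m : M) (a b : A), act (act m a) b =
    omegaTwist (TensorProduct.lift act ∘ₗ LinearMap.lTensor M (LinearMap.mul' k A))
      (coact m ⊗ₜ (coaction k H A a ⊗ₜ coaction k H A b))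
  /-- `ρ(ma) = m₀a₀ ⊗ m₁a₁`. -/
  coact_act : ∀ (m : M) (a : A), coact (act m a) =
    TensorProduct.map (TensorProduct.lift act) (LinearMap.mul' k H)
      (TensorProduct.tensorTensorTensorComm k M H A H (coact m ⊗ₜ coaction k H A a))

end Comodule

/-! ### The reassociator at the unit -/

section OmegaOne

variable {k : Type w} {H : Type u} [Field k] [NonAssocRing H] [Module k H]
  [IsScalarTower k H H] [SMulCommClass k H H] [CoquasiBialgebra k H]

/-- `t ↦ 1 ⊗ t` as a coalgebra map. -/
def insOne (C : Type u) [AddCommGroup C] [Module k C] [Coalgebra k C] : C →ₗc[k] H ⊗[k] C where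
  toLinearMap := TensorProduct.mk k H C 1
  counit_comp := by
    ext t
    simp [TensorProduct.counit_tmul, CoquasiBialgebra.counit_one]
  map_comp_comul := by
    ext t
    simp only [LinearMap.comp_apply, TensorProduct.mk_apply, TensorProduct.comul_tmul,
      CoquasiBialgebra.comul_one]
    generalize Coalgebra.comul (R := k) t = s
    induction s with
    | zero => simp
    | add x y hx hy => rw [TensorProduct.tmul_add, map_add, map_add, hx, hy]
    | tmul a b => simp

theorem omega_one_left (h g : H) :
    CoquasiBialgebra.omega (k := k) ((1 : H) ⊗ₜ (h ⊗ₜ g)) =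
      Coalgebra.counit (R := k) h * Coalgebra.counit (R := k) g := by
  let j : H ⊗[k] H →ₗc[k] H ⊗[k] (H ⊗[k] H) := insOne (H ⊗[k] H)
  let i : H ⊗[k] H →ₗc[k] H ⊗[k] (H ⊗[k] (H ⊗[k] H)) := (insOne (H ⊗[k] (H ⊗[k] H))).comp j
  let om := CoquasiBialgebra.omega (k := k) (H := H)
  let e : WithConv (H ⊗[k] H →ₗ[k] k) := WithConv.toConv (om ∘ₗ j.toLinearMap)
  have h1 : e * WithConv.toConv (CoquasiBialgebra.omegaInv (k := k) (H := H) ∘ₗ j.toLinearMap)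
      = 1 := by
    have := congrArg (fun f => WithConv.toConv (f.ofConv ∘ₗ j.toLinearMap))
      (CoquasiBialgebra.omega_mul_omegaInv (k := k) (H := H))
    simp only [LinearMap.convMul_comp_coalgHom_distrib] at this
    refine Eq.trans ?_ (this.trans ?_)
    · rfl
    · ext a b
      simp [j, insOne, TensorProduct.counit_tmul, CoquasiBialgebra.counit_one]
  have h2 : e = e * e := by
    have := congrArg (fun f => WithConv.toConv (f.ofConv ∘ₗ i.toLinearMap))
      (CoquasiBialgebra.cocycle (k := k) (H := H))
    simp only [LinearMap.convMul_comp_coalgHom_distrib] at this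
    have w1 : WithConv.toConv ((om ∘ₗ mulLast k H) ∘ₗ i.toLinearMap) = 1 := by
      ext a b
      simp [om, i, j, insOne, mulLast, TensorProduct.counit_tmul, CoquasiBialgebra.counit_one,
        CoquasiBialgebra.omega_one_middle, CoquasiBialgebra.counit_mul, mul_comm]
    have w2 : WithConv.toConv ((om ∘ₗ mulFirst k H) ∘ₗ i.toLinearMap) = e := by
      ext a b
      simp [om, e, i, j, insOne, mulFirst]
    have w3 : WithConv.toConv ((counitTimes om) ∘ₗ i.toLinearMap) = e := by
      ext a b
      simp [om, e, i, j, insOne, counitTimes, CoquasiBialgebra.counit_one]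
    have w4 : WithConv.toConv ((om ∘ₗ mulMiddle k H) ∘ₗ i.toLinearMap) = e := by
      ext a b
      simp [om, e, i, j, insOne, mulMiddle]
    have w5 : WithConv.toConv ((timesCounit om) ∘ₗ i.toLinearMap) = 1 := by
      ext a b
      simp [om, i, j, insOne, timesCounit, TensorProduct.counit_tmul, CoquasiBialgebra.counit_one,
        CoquasiBialgebra.omega_one_middle, mul_comm]
    have key : WithConv.toConv ((om ∘ₗ mulLast k H) ∘ₗ i.toLinearMap) *
        WithConv.toConv ((om ∘ₗ mulFirst k H) ∘ₗ i.toLinearMap) =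
        WithConv.toConv ((counitTimes om) ∘ₗ i.toLinearMap) *
        WithConv.toConv ((om ∘ₗ mulMiddle k H) ∘ₗ i.toLinearMap) *
        WithConv.toConv ((timesCounit om) ∘ₗ i.toLinearMap) := this
    rw [w1, w2, w3, w4, w5, one_mul, mul_one] at key
    exact key
  have h3 : e = 1 := by
    calc e = e * (e * _) := by rw [h1, mul_one]
      _ = 1 := by rw [← mul_assoc, ← h2, h1]
  have := congrArg (fun f => f.ofConv (h ⊗ₜ g)) h3
  simpa [e, j, insOne, om, TensorProduct.counit_tmul, mul_comm] using this

end OmegaOne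

/-! ### Coinvariants -/

section Coinvariants

variable {k : Type w} {H : Type u} [Field k] [NonAssocRing H] [Module k H]
  [IsScalarTower k H H] [SMulCommClass k H H] [CoquasiBialgebra k H]

variable (k H) in
/-- `M^{coH} = {m | ρ(m) = m ⊗ 1}`. -/
def coinvariants (M : Type u) [AddCommGroup M] [Module k M] [RightComodule k H M] :
    Submodule k M :=
  LinearMap.eqLocus (coaction k H M) ((TensorProduct.mk k M H).flip 1)

theorem mem_coinvariants {M : Type u} [AddCommGroup M] [Module k M] [RightComodule k H M]
    {m : M} : m ∈ coinvariants k H M ↔ coaction k H M m = m ⊗ₜ (1 : H) := Iff.rfl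

theorem coaction_coe {M : Type u} [AddCommGroup M] [Module k M] [RightComodule k H M]
    (m : coinvariants k H M) : coaction k H M m = (m : M) ⊗ₜ (1 : H) := m.2

variable (k H) in
/-- `(id ⊗ ε)`. -/
def idCounit (V : Type u) [AddCommGroup V] [Module k V] : V ⊗[k] H →ₗ[k] V :=
  (TensorProduct.rid k V).toLinearMap ∘ₗ LinearMap.lTensor V Coalgebra.counit

theorem idCounit_coaction {M : Type u} [AddCommGroup M] [Module k M] [RightComodule k H M] (m : M) :
    idCounit k H M (coaction k H M m) = m :=
  LinearMap.congr_fun (RightComodule.coact_counit (k := k) (H := H) (M := M)) m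

section OmegaTwist

variable {U V W M : Type u} [AddCommGroup U] [Module k U] [AddCommGroup V] [Module k V]
    [AddCommGroup W] [Module k W] [AddCommGroup M] [Module k M]

theorem omegaTwist_tmul (p : U ⊗[k] (V ⊗[k] W) →ₗ[k] M) (x : U) (y : V) (z : W) (h g l : H) :
    omegaTwist p ((x ⊗ₜ h) ⊗ₜ ((y ⊗ₜ g) ⊗ₜ (z ⊗ₜ l))) =
      CoquasiBialgebra.omega (k := k) (h ⊗ₜ (g ⊗ₜ l)) • p (x ⊗ₜ (y ⊗ₜ z)) := by
  simp [omegaTwist]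

theorem omegaTwist_left (p : U ⊗[k] (V ⊗[k] W) →ₗ[k] M) (x : U) (s : V ⊗[k] H) (t : W ⊗[k] H) :
    omegaTwist p ((x ⊗ₜ (1 : H)) ⊗ₜ (s ⊗ₜ t)) =
      p (x ⊗ₜ (idCounit k H V s ⊗ₜ idCounit k H W t)) := by
  induction s with
  | zero => simp
  | add s s' hs hs' => simp only [TensorProduct.add_tmul, TensorProduct.tmul_add, map_add, hs, hs']
  | tmul y g =>
    induction t with
    | zero => simp
    | add t t' ht ht' => simp only [TensorProduct.tmul_add, map_add, ht, ht']
    | tmul z l =>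
      rw [omegaTwist_tmul, omega_one_left]
      simp only [idCounit, LinearMap.comp_apply, LinearMap.lTensor_tmul, LinearEquiv.coe_coe,
        TensorProduct.rid_tmul, TensorProduct.tmul_smul, ← TensorProduct.smul_tmul', map_smul,
        smul_smul, mul_comm]

theorem omegaTwist_middle (p : U ⊗[k] (V ⊗[k] W) →ₗ[k] M) (s : U ⊗[k] H) (y : V) (t : W ⊗[k] H) :
    omegaTwist p (s ⊗ₜ ((y ⊗ₜ (1 : H)) ⊗ₜ t)) =
      p (idCounit k H U s ⊗ₜ (y ⊗ₜ idCounit k H W t)) := by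
  induction s with
  | zero => simp
  | add s s' hs hs' => simp only [TensorProduct.add_tmul, map_add, hs, hs']
  | tmul x g =>
    induction t with
    | zero => simp
    | add t t' ht ht' => simp only [TensorProduct.tmul_add, map_add, ht, ht']
    | tmul z l =>
      rw [omegaTwist_tmul, CoquasiBialgebra.omega_one_middle]
      simp only [idCounit, LinearMap.comp_apply, LinearMap.lTensor_tmul, LinearEquiv.coe_coe,
        TensorProduct.rid_tmul, TensorProduct.tmul_smul, ← TensorProduct.smul_tmul', map_smul,
        smul_smul, mul_comm]

theorem omegaTwist_comp {M' : Type u} [AddCommGroup M'] [Module k M'] (f : M →ₗ[k] M')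
    (p : U ⊗[k] (V ⊗[k] W) →ₗ[k] M) (t : (U ⊗[k] H) ⊗[k] ((V ⊗[k] H) ⊗[k] (W ⊗[k] H))) :
    omegaTwist (f ∘ₗ p) t = f (omegaTwist p t) := by
  have : omegaTwist (H := H) (f ∘ₗ p) = f ∘ₗ omegaTwist p := by
    ext
    simp [omegaTwist]
  rw [this]; rfl

theorem omegaTwist_rTensor {U' : Type u} [AddCommGroup U'] [Module k U'] (f : U' →ₗ[k] U)
    (p : U ⊗[k] (V ⊗[k] W) →ₗ[k] M) (s : U' ⊗[k] H) (t : (V ⊗[k] H) ⊗[k] (W ⊗[k] H)) :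
    omegaTwist p (LinearMap.rTensor H f s ⊗ₜ t) =
      omegaTwist (p ∘ₗ LinearMap.rTensor (V ⊗[k] W) f) (s ⊗ₜ t) := by
  have : omegaTwist p ∘ₗ LinearMap.rTensor _ (LinearMap.rTensor H f) =
      omegaTwist (p ∘ₗ LinearMap.rTensor (V ⊗[k] W) f) := by
    ext
    simp [omegaTwist]
  rw [← this]; rfl

end OmegaTwist

variable {A : Type u} [NonAssocRing A] [Module k A] [IsScalarTower k A A] [SMulCommClass k A A]
  [ComoduleAlgebra k H A]

variable (H) in
/-- The action of `A` on a relative Hopf module. -/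
abbrev hopfAct {M : Type u} [AddCommGroup M] [Module k M] [RelHopfModule k H A M] (m : M) (a : A) :
    M := RelHopfModule.act (k := k) (H := H) m a

section Actions

variable {M : Type u} [AddCommGroup M] [Module k M] [RelHopfModule k H A M]

theorem hopfAct_hopfAct (m : M) (a b : A) :
    hopfAct (k := k) H (hopfAct (k := k) H m a) b =
      omegaTwist (TensorProduct.lift (RelHopfModule.act (k := k) (H := H)) ∘ₗ
          LinearMap.lTensor M (LinearMap.mul' k A))
        (coaction k H M m ⊗ₜ (coaction k H A a ⊗ₜ coaction k H A b)) :=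
  RelHopfModule.act_act m a b

theorem coaction_hopfAct (m : M) (a : A) : coaction k H M (hopfAct (k := k) H m a) =
    TensorProduct.map (TensorProduct.lift (RelHopfModule.act (k := k) (H := H)))
      (LinearMap.mul' k H) (TensorProduct.tensorTensorTensorComm k M H A H
        (coaction k H M m ⊗ₜ coaction k H A a)) :=
  RelHopfModule.coact_act m a

theorem act_act_coinv_left (m : coinvariants k H M) (a c : A) :
    hopfAct (k := k) H (hopfAct (k := k) H (m : M) a) c = hopfAct (k := k) H (m : M) (a * c) := by
  rw [hopfAct_hopfAct, coaction_coe m, omegaTwist_left, idCounit_coaction, idCounit_coaction]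
  rfl

theorem act_act_coinv_middle (m : M) (b : coinvariants k H A) (c : A) :
    hopfAct (k := k) H (hopfAct (k := k) H m (b : A)) c = hopfAct (k := k) H m (b * c) := by
  rw [hopfAct_hopfAct, coaction_coe b, omegaTwist_middle, idCounit_coaction, idCounit_coaction]
  rfl

theorem act_mem_coinvariants (m : coinvariants k H M) (b : coinvariants k H A) :
    hopfAct (k := k) H (m : M) (b : A) ∈ coinvariants k H M := by
  rw [mem_coinvariants, coaction_hopfAct, coaction_coe m, coaction_coe b]
  simp

end Actions

theorem mul_quasi_assoc (a b c : A) : (a * b) * c =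
    omegaTwist (LinearMap.mul' k A ∘ₗ LinearMap.lTensor A (LinearMap.mul' k A))
      (coaction k H A a ⊗ₜ (coaction k H A b ⊗ₜ coaction k H A c)) :=
  ComoduleAlgebra.quasi_assoc a b c

theorem coaction_mul (a b : A) :
    coaction k H A (a * b) = coaction k H A a * coaction k H A b :=
  ComoduleAlgebra.coact_mul a b

theorem mul_mul_coinv_left (b : coinvariants k H A) (a c : A) :
    ((b : A) * a) * c = (b : A) * (a * c) := by
  rw [mul_quasi_assoc (k := k) (H := H), coaction_coe b, omegaTwist_left, idCounit_coaction,
    idCounit_coaction]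
  rfl

theorem mul_mul_coinv_middle (a : A) (b : coinvariants k H A) (c : A) :
    (a * (b : A)) * c = a * ((b : A) * c) := by
  rw [mul_quasi_assoc (k := k) (H := H), coaction_coe b, omegaTwist_middle, idCounit_coaction,
    idCounit_coaction]
  rfl

variable (k H) in
theorem one_mem_coinvariants : (1 : A) ∈ coinvariants k H A :=
  ComoduleAlgebra.coact_one

theorem mul_mem_coinvariants (a b : coinvariants k H A) : (a : A) * (b : A) ∈ coinvariants k H A := by
  rw [mem_coinvariants, coaction_mul, coaction_coe a, coaction_coe b]
  simp

/-- `B = A^{coH}` is an associative unital ring with the operations of `A`. -/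
instance coinvariantsRing : Ring (coinvariants k H A) where
  __ := (inferInstance : AddCommGroup (coinvariants k H A))
  mul a b := ⟨(a : A) * (b : A), mul_mem_coinvariants a b⟩
  one := ⟨1, one_mem_coinvariants k H⟩
  left_distrib a b c := Subtype.ext (mul_add (a : A) b c)
  right_distrib a b c := Subtype.ext (add_mul (a : A) b c)
  zero_mul a := Subtype.ext (zero_mul (a : A))
  mul_zero a := Subtype.ext (mul_zero (a : A))
  one_mul a := Subtype.ext (one_mul (a : A))
  mul_one a := Subtype.ext (mul_one (a : A))
  mul_assoc a b c := Subtype.ext (mul_mul_coinv_left a (b : A) (c : A))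

theorem coe_coinv_mul (a b : coinvariants k H A) : ((a * b : coinvariants k H A) : A) = a * b := rfl

theorem coe_coinv_one : ((1 : coinvariants k H A) : A) = 1 := rfl

instance coinvariantsAlgebra : Algebra k (coinvariants k H A) :=
  Algebra.ofModule (fun r a b => Subtype.ext (smul_mul_assoc r (a : A) (b : A)))
    (fun r a b => Subtype.ext (mul_smul_comm r (a : A) (b : A)))

/-- `A` is a right `B`-module by multiplication. -/
instance algebraRightModule : Module (coinvariants k H A)ᵐᵒᵖ A where
  smul b a := a * (b.unop : A)
  one_smul a := mul_one a
  mul_smul b c a := (mul_mul_coinv_middle a c.unop (b.unop : A)).symm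
  smul_zero _ := zero_mul _
  smul_add _ _ _ := add_mul _ _ _
  add_smul _ _ _ := mul_add _ _ _
  zero_smul _ := mul_zero _

/-- `M^{coH}` is a right `B`-module by the action of `A` on `M`. -/
instance coinvariantsRightModule {M : Type u} [AddCommGroup M] [Module k M]
    [RelHopfModule k H A M] : Module (coinvariants k H A)ᵐᵒᵖ (coinvariants k H M) where
  smul b m := ⟨hopfAct (k := k) H (m : M) (b.unop : A), act_mem_coinvariants m b.unop⟩
  one_smul m := Subtype.ext (RelHopfModule.act_one (k := k) (H := H) (A := A) (m : M))
  mul_smul b c m := Subtype.ext (act_act_coinv_left m (c.unop : A) (b.unop : A)).symm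
  smul_zero _ := Subtype.ext (LinearMap.map_zero₂ _ _)
  smul_add _ _ _ := Subtype.ext (LinearMap.map_add₂ _ _ _ _)
  add_smul _ _ x := Subtype.ext (map_add (RelHopfModule.act (k := k) (H := H) (x : M)) _ _)
  zero_smul x := Subtype.ext (map_zero (RelHopfModule.act (k := k) (H := H) (x : M)))

end Coinvariants

/-! ### The tensor product over the coinvariants -/

section BalancedTensor

variable (k : Type w) (H : Type u) [Field k] [NonAssocRing H] [Module k H]
  [IsScalarTower k H H] [SMulCommClass k H H] [CoquasiBialgebra k H]
  (A : Type u) [NonAssocRing A] [Module k A] [IsScalarTower k A A] [SMulCommClass k A A]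
  [ComoduleAlgebra k H A]
  (N : Type u) [AddCommGroup N] [Module k N] [Module (coinvariants k H A)ᵐᵒᵖ N]

/-- The relations `n b ⊗ a = n ⊗ b a`, for `b ∈ B`. -/
def balancedRel : Submodule k (N ⊗[k] A) :=
  Submodule.span k {t | ∃ (n : N) (b : coinvariants k H A) (a : A),
    t = (MulOpposite.op b • n) ⊗ₜ[k] a - n ⊗ₜ[k] ((b : A) * a)}

/-- `N ⊗_B A` for a right `B`-module `N`, where `B = A^{coH}`. -/
abbrev BalancedTensor : Type u := (N ⊗[k] A) ⧸ balancedRel k H A N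

variable {N A}

/-- `n ⊗_B a`. -/
def btmul (n : N) (a : A) : BalancedTensor k H A N := (balancedRel k H A N).mkQ (n ⊗ₜ a)

theorem btmul_smul (n : N) (b : coinvariants k H A) (a : A) :
    btmul k H (MulOpposite.op b • n) a = btmul k H n ((b : A) * a) := by
  rw [← sub_eq_zero, btmul, btmul, ← map_sub]
  exact (Submodule.Quotient.mk_eq_zero _).2 (Submodule.subset_span ⟨n, b, a, rfl⟩)

variable {k H}

theorem balancedTensor_hom_ext {M : Type*} [AddCommGroup M] [Module k M]
    {f g : BalancedTensor k H A N →ₗ[k] M}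
    (h : ∀ n a, f (btmul k H n a) = g (btmul k H n a)) : f = g := by
  apply Submodule.linearMap_qext
  ext n a
  exact h n a

variable (H) in
/-- A linear map on `N ⊗ A` that respects the relations factors through `N ⊗_B A`. -/
def balancedLift {M : Type*} [AddCommGroup M] [Module k M] (f : N ⊗[k] A →ₗ[k] M)
    (hf : ∀ (n : N) (b : coinvariants k H A) (a : A),
      f ((MulOpposite.op b • n) ⊗ₜ[k] a) = f (n ⊗ₜ[k] ((b : A) * a))) :
    BalancedTensor k H A N →ₗ[k] M :=
  (balancedRel k H A N).liftQ f <| Submodule.span_le.2 <| by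
    rintro _ ⟨n, b, a, rfl⟩
    rw [SetLike.mem_coe, LinearMap.mem_ker, map_sub, hf, sub_self]

theorem balancedLift_btmul {M : Type*} [AddCommGroup M] [Module k M] (f : N ⊗[k] A →ₗ[k] M)
    (hf : ∀ (n : N) (b : coinvariants k H A) (a : A),
      f ((MulOpposite.op b • n) ⊗ₜ[k] a) = f (n ⊗ₜ[k] ((b : A) * a))) (n : N) (a : A) :
    balancedLift H f hf (btmul k H n a) = f (n ⊗ₜ a) := rfl

theorem coaction_coinv_mul (b : coinvariants k H A) (a : A) :
    coaction k H A ((b : A) * a) =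
      LinearMap.rTensor H (LinearMap.mulLeft k (b : A)) (coaction k H A a) := by
  rw [coaction_mul, coaction_coe b]
  generalize coaction k H A a = s
  induction s with
  | zero => simp
  | add x y hx hy => rw [mul_add, map_add, hx, hy]
  | tmul x y => simp

theorem coaction_mul_coinv (a : A) (b : coinvariants k H A) :
    coaction k H A (a * (b : A)) =
      LinearMap.rTensor H (LinearMap.mulRight k (b : A)) (coaction k H A a) := by
  rw [coaction_mul, coaction_coe b]
  generalize coaction k H A a = s
  induction s with
  | zero => simp
  | add x y hx hy => rw [add_mul, map_add, hx, hy]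
  | tmul x y => simp

variable (k H) in
/-- `a ↦ n ⊗_B a`. -/
def btmulRight (n : N) : A →ₗ[k] BalancedTensor k H A N :=
  (balancedRel k H A N).mkQ ∘ₗ TensorProduct.mk k N A n

theorem btmulRight_apply (n : N) (a : A) : btmulRight k H n a = btmul k H n a := rfl

variable (k H A N) in
/-- `n ⊗_B a ↦ (n ⊗_B a₀) ⊗ a₁`. -/
def balancedCoact : BalancedTensor k H A N →ₗ[k] BalancedTensor k H A N ⊗[k] H :=
  balancedLift H
    (LinearMap.rTensor H (balancedRel k H A N).mkQ ∘ₗ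
      (TensorProduct.assoc k N A H).symm.toLinearMap ∘ₗ LinearMap.lTensor N (coaction k H A)) <| by
    intro n b a
    simp only [LinearMap.comp_apply, LinearMap.lTensor_tmul, coaction_coinv_mul]
    generalize coaction k H A a = s
    induction s with
    | zero => simp
    | add x y hx hy => simp only [TensorProduct.tmul_add, map_add, hx, hy]
    | tmul x y => exact congrArg (· ⊗ₜ[k] y) (btmul_smul k H n b x)

theorem balancedCoact_btmul (n : N) (a : A) :
    balancedCoact k H A N (btmul k H n a) =
      LinearMap.rTensor H (btmulRight k H n) (coaction k H A a) := by
  refine (balancedLift_btmul _ _ n a).trans ?_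
  simp only [LinearMap.comp_apply, LinearMap.lTensor_tmul]
  generalize coaction k H A a = s
  induction s with
  | zero => simp
  | add x y hx hy => simp only [TensorProduct.tmul_add, map_add, hx, hy]
  | tmul x y => rfl

variable (k H A N) in
/-- `(n ⊗_B a) c = n ⊗_B a c`. -/
def balancedAct : BalancedTensor k H A N →ₗ[k] A →ₗ[k] BalancedTensor k H A N :=
  balancedLift H
    (TensorProduct.curry ((balancedRel k H A N).mkQ ∘ₗ LinearMap.lTensor N (LinearMap.mul' k A) ∘ₗ
      (TensorProduct.assoc k N A A).toLinearMap)) <| by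
    intro n b a
    ext c
    change btmul k H (MulOpposite.op b • n) (a * c) = btmul k H n (((b : A) * a) * c)
    rw [mul_mul_coinv_left, btmul_smul]

theorem balancedAct_btmul (n : N) (a c : A) :
    balancedAct k H A N (btmul k H n a) c = btmul k H n (a * c) := rfl

instance balancedRightComodule : RightComodule k H (BalancedTensor k H A N) where
  coact := balancedCoact k H A N
  coassoc := by
    apply balancedTensor_hom_ext
    intro n a
    have h := LinearMap.congr_fun (RightComodule.coassoc (k := k) (H := H) (M := A)) a
    simp only [LinearMap.comp_apply] at h ⊢
    rw [balancedCoact_btmul]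
    have e1 : ∀ s : A ⊗[k] H, (TensorProduct.assoc k _ H H).toLinearMap
        (LinearMap.rTensor H (balancedCoact k H A N)
          (LinearMap.rTensor H (btmulRight k H n) s)) =
        LinearMap.rTensor (H ⊗[k] H) (btmulRight k H n)
          ((TensorProduct.assoc k A H H).toLinearMap
            (LinearMap.rTensor H (coaction k H A) s)) := by
      intro s
      induction s with
      | zero => simp
      | add x y hx hy => simp only [map_add, hx, hy]
      | tmul x y =>
        simp only [LinearMap.rTensor_tmul, btmulRight_apply, balancedCoact_btmul]
        generalize coaction k H A x = t
        induction t with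
        | zero => simp
        | add x y hx hy => simp only [TensorProduct.add_tmul, map_add, hx, hy]
        | tmul x y => simp
    have e2 : ∀ s : A ⊗[k] H, LinearMap.lTensor _ Coalgebra.comul
          (LinearMap.rTensor H (btmulRight k H n) s) =
        LinearMap.rTensor (H ⊗[k] H) (btmulRight k H n)
          (LinearMap.lTensor A Coalgebra.comul s) := by
      intro s
      rw [← LinearMap.comp_apply, ← LinearMap.comp_apply, LinearMap.lTensor_comp_rTensor,
        LinearMap.rTensor_comp_lTensor]
    rw [e1, e2]
    exact congrArg _ h
  coact_counit := by
    apply balancedTensor_hom_ext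
    intro n a
    have h := idCounit_coaction (k := k) (H := H) a
    simp only [LinearMap.comp_apply, LinearMap.id_apply]
    rw [balancedCoact_btmul]
    have e1 : ∀ s : A ⊗[k] H, (TensorProduct.rid k _).toLinearMap
        (LinearMap.lTensor _ (Coalgebra.counit (R := k) (A := H))
          (LinearMap.rTensor H (btmulRight k H n) s)) = btmulRight k H n (idCounit k H A s) := by
      intro s
      induction s with
      | zero => simp
      | add x y hx hy => simp only [map_add, hx, hy]
      | tmul x y => simp [idCounit]
    rw [e1, h]; rfl

theorem coaction_btmul (n : N) (a : A) :
    coaction k H (BalancedTensor k H A N) (btmul k H n a) =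
      LinearMap.rTensor H (btmulRight k H n) (coaction k H A a) := balancedCoact_btmul n a

/-- `N ⊗_B A` is a relative Hopf module. -/
instance balancedRelHopfModule : RelHopfModule k H A (BalancedTensor k H A N) where
  __ := balancedRightComodule
  act := balancedAct k H A N
  act_one t := by
    have : (balancedAct k H A N).flip 1 = LinearMap.id := by
      apply balancedTensor_hom_ext
      intro n a
      rw [LinearMap.flip_apply, balancedAct_btmul, mul_one, LinearMap.id_apply]
    exact LinearMap.congr_fun this t
  act_act t a b := by
    set q := TensorProduct.lift (balancedAct k H A N) ∘ₗ
      LinearMap.lTensor (BalancedTensor k H A N) (LinearMap.mul' k A)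
    have e : ((balancedAct k H A N).flip b) ∘ₗ ((balancedAct k H A N).flip a) =
        (omegaTwist q ∘ₗ (TensorProduct.mk k _ _).flip (coaction k H A a ⊗ₜ coaction k H A b)) ∘ₗ
          balancedCoact k H A N := by
      apply balancedTensor_hom_ext
      intro n c
      simp only [LinearMap.comp_apply, LinearMap.flip_apply, balancedAct_btmul,
        TensorProduct.mk_apply]
      rw [balancedCoact_btmul, omegaTwist_rTensor,
        show q ∘ₗ LinearMap.rTensor (A ⊗[k] A) (btmulRight k H n) = btmulRight k H n ∘ₗ
          (LinearMap.mul' k A ∘ₗ LinearMap.lTensor A (LinearMap.mul' k A)) by ext; rfl,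
        omegaTwist_comp, ← mul_quasi_assoc]
      rfl
    exact LinearMap.congr_fun e t
  coact_act t a := by
    have e : balancedCoact k H A N ∘ₗ (balancedAct k H A N).flip a =
        (TensorProduct.map (TensorProduct.lift (balancedAct k H A N)) (LinearMap.mul' k H) ∘ₗ
          (TensorProduct.tensorTensorTensorComm k _ H A H).toLinearMap ∘ₗ
          (TensorProduct.mk k _ _).flip (coaction k H A a)) ∘ₗ balancedCoact k H A N := by
      apply balancedTensor_hom_ext
      intro n c
      simp only [LinearMap.comp_apply, LinearMap.flip_apply, balancedAct_btmul,
        TensorProduct.mk_apply]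
      rw [balancedCoact_btmul, balancedCoact_btmul, coaction_mul]
      generalize coaction k H A c = s
      generalize coaction k H A a = t
      induction s with
      | zero => simp
      | add x y hx hy => simp only [add_mul, TensorProduct.add_tmul, map_add, hx, hy]
      | tmul x y =>
        induction t with
        | zero => simp
        | add x y hx hy => simp only [mul_add, TensorProduct.tmul_add, map_add, hx, hy]
        | tmul z w =>
          simp only [Algebra.TensorProduct.tmul_mul_tmul, LinearMap.rTensor_tmul,
            LinearEquiv.coe_coe, TensorProduct.tensorTensorTensorComm_tmul, TensorProduct.map_tmul,
            TensorProduct.lift.tmul, btmulRight_apply, balancedAct_btmul, LinearMap.mul'_apply]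
    exact LinearMap.congr_fun e t

end BalancedTensor

/-! ### The category of relative Hopf modules, and the adjunction with right `B`-modules -/

section Category

variable (k : Type w) (H : Type u) [Field k] [NonAssocRing H] [Module k H]
  [IsScalarTower k H H] [SMulCommClass k H H] [CoquasiBialgebra k H]
  (A : Type u) [NonAssocRing A] [Module k A] [IsScalarTower k A A] [SMulCommClass k A A]
  [ComoduleAlgebra k H A]

/-- The objects of the category of relative right `(H, A)`-Hopf modules. -/
structure RelHopfModuleCat where
  carrier : Type u
  [addCommGroup : AddCommGroup carrier]
  [module : Module k carrier]
  [relHopfModule : RelHopfModule k H A carrier]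

attribute [instance] RelHopfModuleCat.addCommGroup RelHopfModuleCat.module
  RelHopfModuleCat.relHopfModule

variable {k H A}

/-- Morphisms of relative Hopf modules: colinear maps that respect the action of `A`. -/
@[ext]
structure RelHopfModuleCat.Hom (M M' : RelHopfModuleCat k H A) where
  toLinearMap : M.carrier →ₗ[k] M'.carrier
  colinear : ∀ m, coaction k H M'.carrier (toLinearMap m) =
    LinearMap.rTensor H toLinearMap (coaction k H M.carrier m)
  map_act : ∀ m (a : A),
    toLinearMap (hopfAct (k := k) H m a) = hopfAct (k := k) H (toLinearMap m) a

instance : Category (RelHopfModuleCat k H A) where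
  Hom M M' := RelHopfModuleCat.Hom M M'
  id M := ⟨LinearMap.id, fun m => by simp, fun _ _ => rfl⟩
  comp f g := ⟨g.toLinearMap ∘ₗ f.toLinearMap,
    fun m => by
      rw [LinearMap.comp_apply, g.colinear, f.colinear, LinearMap.rTensor_comp_apply],
    fun m a => by rw [LinearMap.comp_apply, f.map_act, g.map_act, LinearMap.comp_apply]⟩

/-- The linear map underlying a morphism of relative Hopf modules. -/
abbrev RelHopfModuleCat.lin {M M' : RelHopfModuleCat k H A} (f : M ⟶ M') :
    M.carrier →ₗ[k] M'.carrier := RelHopfModuleCat.Hom.toLinearMap f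

theorem RelHopfModuleCat.hom_ext {M M' : RelHopfModuleCat k H A} {f g : M ⟶ M'}
    (h : RelHopfModuleCat.lin f = RelHopfModuleCat.lin g) : f = g :=
  RelHopfModuleCat.Hom.ext h

theorem RelHopfModuleCat.lin_comp {M M' M'' : RelHopfModuleCat k H A} (f : M ⟶ M') (g : M' ⟶ M'') :
    RelHopfModuleCat.lin (f ≫ g) = RelHopfModuleCat.lin g ∘ₗ RelHopfModuleCat.lin f := rfl

theorem RelHopfModuleCat.lin_id (M : RelHopfModuleCat k H A) :
    RelHopfModuleCat.lin (𝟙 M) = LinearMap.id := rfl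

instance coinvariantsIsScalarTower {M : Type u} [AddCommGroup M] [Module k M]
    [RelHopfModule k H A M] :
    IsScalarTower k (coinvariants k H A)ᵐᵒᵖ (coinvariants k H M) where
  smul_assoc r b m := Subtype.ext
    (map_smul (RelHopfModule.act (k := k) (H := H) (m : M)) r (b.unop : A))

/-- The functor of coinvariants on morphisms. -/
def coinvariantsMap {M M' : RelHopfModuleCat k H A} (f : M ⟶ M') :
    coinvariants k H M.carrier →ₗ[(coinvariants k H A)ᵐᵒᵖ] coinvariants k H M'.carrier where
  toFun m := ⟨RelHopfModuleCat.lin f m, by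
    rw [mem_coinvariants, f.colinear, coaction_coe m]; rfl⟩
  map_add' x y := Subtype.ext (map_add (RelHopfModuleCat.lin f) _ _)
  map_smul' b x := Subtype.ext (f.map_act (x : M.carrier) (b.unop : A))

variable (k H A) in
/-- The functor of coinvariants, from relative Hopf modules to right `B`-modules. -/
def coinvariantsFunctor : RelHopfModuleCat k H A ⥤ ModuleCat.{u} (coinvariants k H A)ᵐᵒᵖ where
  obj M := ModuleCat.of _ (coinvariants k H M.carrier)
  map f := ModuleCat.ofHom (coinvariantsMap f)
  map_id _ := rfl
  map_comp _ _ := rfl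

open scoped ModuleCat

section

variable {N N' : Type u} [AddCommGroup N] [Module k N] [Module (coinvariants k H A)ᵐᵒᵖ N]
  [IsScalarTower k (coinvariants k H A)ᵐᵒᵖ N]
  [AddCommGroup N'] [Module k N'] [Module (coinvariants k H A)ᵐᵒᵖ N']
  [IsScalarTower k (coinvariants k H A)ᵐᵒᵖ N']

/-- `n ⊗_B a ↦ f(n) ⊗_B a`. -/
def balancedMap (f : N →ₗ[(coinvariants k H A)ᵐᵒᵖ] N') :
    BalancedTensor k H A N →ₗ[k] BalancedTensor k H A N' :=
  balancedLift H ((balancedRel k H A N').mkQ ∘ₗ LinearMap.rTensor A (f.restrictScalars k)) <| by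
    intro n b a
    have h : btmul k H (f (MulOpposite.op b • n)) a = btmul k H (f n) ((b : A) * a) := by
      rw [map_smul, btmul_smul]
    exact h

theorem balancedMap_btmul (f : N →ₗ[(coinvariants k H A)ᵐᵒᵖ] N') (n : N) (a : A) :
    balancedMap f (btmul k H n a) = btmul k H (f n) a := rfl

/-- `n ⊗_B a ↦ f(n) a`, for a right `B`-linear map `f : N → M^{coH}`. -/
def balancedEval {M : Type u} [AddCommGroup M] [Module k M] [RelHopfModule k H A M]
    (f : N →ₗ[(coinvariants k H A)ᵐᵒᵖ] coinvariants k H M) : BalancedTensor k H A N →ₗ[k] M :=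
  balancedLift H (TensorProduct.lift
      (RelHopfModule.act (k := k) (H := H) (A := A) ∘ₗ (coinvariants k H M).subtype ∘ₗ
        f.restrictScalars k)) <| by
    intro n b a
    have h : hopfAct (k := k) H ((f (MulOpposite.op b • n) : coinvariants k H M) : M) a =
        hopfAct (k := k) H ((f n : coinvariants k H M) : M) ((b : A) * a) := by
      rw [map_smul]
      exact act_act_coinv_left (f n) b a
    exact h

theorem balancedEval_btmul {M : Type u} [AddCommGroup M] [Module k M] [RelHopfModule k H A M]
    (f : N →ₗ[(coinvariants k H A)ᵐᵒᵖ] coinvariants k H M) (n : N) (a : A) :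
    balancedEval f (btmul k H n a) = hopfAct (k := k) H (f n : M) a := rfl

theorem coaction_hopfAct_coe {M : Type u} [AddCommGroup M] [Module k M] [RelHopfModule k H A M]
    (m : coinvariants k H M) (a : A) :
    coaction k H M (hopfAct (k := k) H (m : M) a) =
      LinearMap.rTensor H (RelHopfModule.act (k := k) (H := H) (m : M)) (coaction k H A a) := by
  rw [coaction_hopfAct, coaction_coe m]
  generalize coaction k H A a = s
  induction s with
  | zero => simp
  | add x y hx hy => simp only [TensorProduct.tmul_add, map_add, hx, hy]
  | tmul x y => simp

end

variable (k H A) in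
/-- The induction functor `(-) ⊗_B A`, from right `B`-modules to relative Hopf modules. -/
def inductionFunctor : ModuleCat.{u} (coinvariants k H A)ᵐᵒᵖ ⥤ RelHopfModuleCat k H A where
  obj N := ⟨BalancedTensor k H A N⟩
  map {N N'} f :=
    { toLinearMap := balancedMap f.hom
      colinear := by
        intro t
        have e : coaction k H (BalancedTensor k H A N') ∘ₗ balancedMap f.hom =
            LinearMap.rTensor H (balancedMap f.hom) ∘ₗ coaction k H (BalancedTensor k H A N) := by
          apply balancedTensor_hom_ext
          intro n a
          rw [LinearMap.comp_apply, LinearMap.comp_apply, balancedMap_btmul, coaction_btmul,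
            coaction_btmul, ← LinearMap.rTensor_comp_apply]
          rfl
        exact LinearMap.congr_fun e t
      map_act := by
        intro t a
        have e : balancedMap f.hom ∘ₗ (balancedAct k H A N).flip a =
            (balancedAct k H A N').flip a ∘ₗ balancedMap f.hom := by
          apply balancedTensor_hom_ext
          intro n c
          rfl
        exact LinearMap.congr_fun e t }
  map_id N := RelHopfModuleCat.hom_ext (balancedTensor_hom_ext fun _ _ => rfl)
  map_comp f g := RelHopfModuleCat.hom_ext (balancedTensor_hom_ext fun _ _ => rfl)

/-- The morphism `N ⊗_B A → M`, `n ⊗_B a ↦ f(n) a`, of relative Hopf modules. -/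
def evalHom {N : ModuleCat.{u} (coinvariants k H A)ᵐᵒᵖ} {M : RelHopfModuleCat k H A}
    (f : N →ₗ[(coinvariants k H A)ᵐᵒᵖ] coinvariants k H M.carrier) :
    (inductionFunctor k H A).obj N ⟶ M :=
  { toLinearMap := balancedEval f
    colinear := by
      intro t
      have e : coaction k H M.carrier ∘ₗ balancedEval f =
          LinearMap.rTensor H (balancedEval f) ∘ₗ coaction k H (BalancedTensor k H A N) := by
        apply balancedTensor_hom_ext
        intro n a
        rw [LinearMap.comp_apply, LinearMap.comp_apply, balancedEval_btmul, coaction_btmul,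
          coaction_hopfAct_coe, ← LinearMap.rTensor_comp_apply]
        rfl
      exact LinearMap.congr_fun e t
    map_act := by
      intro t a
      have e : balancedEval f ∘ₗ (balancedAct k H A N).flip a =
          (RelHopfModule.act (k := k) (H := H)).flip a ∘ₗ balancedEval f := by
        apply balancedTensor_hom_ext
        intro n c
        exact (act_act_coinv_left (f n) c a).symm
      exact LinearMap.congr_fun e t }

/-- The map `N → (N ⊗_B A)^{coH}`, `n ↦ n ⊗_B 1`, followed by a morphism of relative Hopf
modules. -/
def adjointMap {N : ModuleCat.{u} (coinvariants k H A)ᵐᵒᵖ} {M : RelHopfModuleCat k H A}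
    (g : (inductionFunctor k H A).obj N ⟶ M) :
    N →ₗ[(coinvariants k H A)ᵐᵒᵖ] coinvariants k H M.carrier where
  toFun n := ⟨RelHopfModuleCat.lin g (btmul k H n (1 : A)), by
    rw [mem_coinvariants]
    refine (g.colinear _).trans ?_
    have h : coaction k H (BalancedTensor k H A N) (btmul k H n (1 : A)) =
        btmul k H n (1 : A) ⊗ₜ (1 : H) := by
      rw [coaction_btmul, mem_coinvariants.1 (one_mem_coinvariants k H)]
      rfl
    exact (congrArg _ h).trans (LinearMap.rTensor_tmul _ _ _ _)⟩
  map_add' x y := Subtype.ext <| by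
    have h : btmul k H (x + y) (1 : A) = btmul k H x 1 + btmul k H y 1 := by
      rw [btmul, TensorProduct.add_tmul, map_add]; rfl
    exact (congrArg (RelHopfModuleCat.lin g) h).trans (map_add (RelHopfModuleCat.lin g) _ _)
  map_smul' b x := Subtype.ext <| by
    have h : btmul k H (b • x) (1 : A) = balancedAct k H A N (btmul k H x 1) (b.unop : A) := by
      rw [balancedAct_btmul, one_mul]
      refine (btmul_smul k H x b.unop 1).trans ?_
      rw [mul_one]
    exact (congrArg (RelHopfModuleCat.lin g) h).trans (g.map_act _ _)

variable (k H A) in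
/-- The induction functor is left adjoint to the functor of coinvariants. -/
def inductionAdjunction : inductionFunctor k H A ⊣ coinvariantsFunctor k H A :=
  Adjunction.mkOfHomEquiv
    { homEquiv := fun N M =>
        { toFun := fun g => ModuleCat.ofHom (adjointMap g)
          invFun := fun f => evalHom f.hom
          left_inv := by
            intro g
            apply RelHopfModuleCat.hom_ext
            apply balancedTensor_hom_ext
            intro n a
            have h : btmul k H n a = balancedAct k H A N (btmul k H n 1) a := by
              rw [balancedAct_btmul, one_mul]
            exact ((congrArg (RelHopfModuleCat.lin g) h).trans (g.map_act _ _)).symm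
          right_inv := by
            intro f
            ext n
            exact RelHopfModule.act_one (k := k) (H := H) (A := A) _ }
      homEquiv_naturality_left_symm := by
        intro N N' M f g
        apply RelHopfModuleCat.hom_ext
        apply balancedTensor_hom_ext
        intro n a
        rfl
      homEquiv_naturality_right := by
        intro N M M' f g
        rfl }

/-- The counit is `m ⊗_B a ↦ m a`. -/
theorem inductionAdjunction_counit (M : RelHopfModuleCat k H A) (m : coinvariants k H M.carrier)
    (a : A) :
    RelHopfModuleCat.lin ((inductionAdjunction k H A).counit.app M)
      (btmul k H (N := (coinvariantsFunctor k H A).obj M) m a) =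
        hopfAct (k := k) H (m : M.carrier) a := rfl

/-- The unit is `n ↦ n ⊗_B 1`. -/
theorem inductionAdjunction_unit (N : ModuleCat.{u} (coinvariants k H A)ᵐᵒᵖ) (n : N) :
    (((inductionAdjunction k H A).unit.app N).hom n).1 = btmul k H n (1 : A) := rfl

variable (k H A)

/-- The Weak Structure Theorem: for every relative Hopf module `M`, the counit
`M^{coH} ⊗_B A → M`, `m ⊗_B a ↦ m a`, is bijective. -/
def WeakStructureTheorem : Prop :=
  ∀ M : RelHopfModuleCat k H A,
    Function.Bijective (RelHopfModuleCat.lin ((inductionAdjunction k H A).counit.app M))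

/-- The Strong Structure Theorem: the induction functor and the functor of coinvariants are inverse
equivalences, that is, the unit and the counit of their adjunction are natural isomorphisms. -/
def StrongStructureTheorem : Prop :=
  IsIso (inductionAdjunction k H A).unit ∧ IsIso (inductionAdjunction k H A).counit

/-- The normal basis property: `A ≅ B ⊗ H` as left `B`-modules and right `H`-comodules. -/
def NormalBasisProperty : Prop :=
  ∃ ν : coinvariants k H A ⊗[k] H ≃ₗ[k] A,
    (∀ (b c : coinvariants k H A) (h : H), ν ((b * c) ⊗ₜ h) = (b : A) * ν (c ⊗ₜ h)) ∧
    ∀ (b : coinvariants k H A) (h : H), coaction k H A (ν (b ⊗ₜ h)) =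
      TensorProduct.map (ν.toLinearMap ∘ₗ TensorProduct.mk k _ H b) LinearMap.id
        (Coalgebra.comul h)

end Category

/-! ### Galois extensions and cleft extensions -/

section GaloisCleft

variable (k : Type w) (H : Type u) [Field k] [NonAssocRing H] [Module k H]
  [IsScalarTower k H H] [SMulCommClass k H H] [CoquasiHopfAlgebra k H]
  (A : Type u) [NonAssocRing A] [Module k A] [IsScalarTower k A A] [SMulCommClass k A A]
  [ComoduleAlgebra k H A]

open CoquasiBialgebra CoquasiHopfAlgebra

/-- `h ⊗ g ↦ ω⁻¹(h, g₁ β(g₂), S(g₃)) g₄`. -/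
def canTwist : H ⊗[k] H →ₗ[k] H :=
  (TensorProduct.lid k H).toLinearMap ∘ₗ LinearMap.rTensor H (omegaInv (k := k) (H := H)) ∘ₗ
    (TensorProduct.assoc k H (H ⊗[k] H) H).symm.toLinearMap ∘ₗ
    LinearMap.lTensor H (LinearMap.rTensor H
      (TensorProduct.map (hitLeft (beta (k := k) (H := H))) S ∘ₗ Coalgebra.comul) ∘ₗ
        Coalgebra.comul)

/-- The Galois map `a ⊗_B b ↦ a₀ b₀ ⊗ b₄ ω⁻¹(a₁, b₁ β(b₂), S(b₃))` from `A ⊗_B A` to `A ⊗ H`. -/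
def can : BalancedTensor k H A A →ₗ[k] A ⊗[k] H :=
  balancedLift H (TensorProduct.map (LinearMap.mul' k A) (canTwist k H) ∘ₗ
      (TensorProduct.tensorTensorTensorComm k A H A H).toLinearMap ∘ₗ
      TensorProduct.map (coaction k H A) (coaction k H A)) <| by
    intro a b c
    have h : MulOpposite.op b • a = a * (b : A) := rfl
    simp only [h, LinearMap.comp_apply, TensorProduct.map_tmul, coaction_mul_coinv,
      coaction_coinv_mul]
    generalize coaction k H A a = s
    generalize coaction k H A c = t
    induction s with
    | zero => simp
    | add x y hx hy => simp only [TensorProduct.add_tmul, map_add, hx, hy]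
    | tmul x y =>
      induction t with
      | zero => simp
      | add x y hx hy => simp only [TensorProduct.tmul_add, map_add, hx, hy]
      | tmul z w => simp [mul_mul_coinv_middle]

/-- The extension `B ⊆ A` is `H`-Galois. -/
def IsGalois : Prop := Function.Bijective (can k H A)

/-- The extension `B ⊆ A` is `H`-cleft, with cleaving map `γ` and companion map `δ`. -/
def IsCleft : Prop :=
  ∃ γ δ : H →ₗ[k] A,
    -- `γ` is colinear: `ρ(γ(h)) = γ(h₁) ⊗ h₂`
    (∀ h, coaction k H A (γ h) = LinearMap.rTensor H γ (Coalgebra.comul h)) ∧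
    -- `ρ(δ(h)) = δ(h₂) ⊗ S(h₁)`
    (∀ h, coaction k H A (δ h) =
      TensorProduct.map δ S (TensorProduct.comm k H H (Coalgebra.comul h))) ∧
    -- `δ(h₁) γ(h₂) = α(h) 1`
    (∀ h, LinearMap.mul' k A (TensorProduct.map δ γ (Coalgebra.comul h)) =
      alpha (k := k) h • (1 : A)) ∧
    -- `γ(h₁) β(h₂) δ(h₃) = ε(h) 1`
    ∀ h, LinearMap.mul' k A
        (TensorProduct.map (γ ∘ₗ hitLeft (beta (k := k) (H := H))) δ (Coalgebra.comul h)) =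
      Coalgebra.counit (R := k) h • (1 : A)

end GaloisCleft

end CoquasiHopf

end

noncomputable section

set_option linter.unusedSectionVars false
set_option linter.unusedSimpArgs false

open TensorProduct CategoryTheory

namespace CoquasiHopf

/-! ### Reordering iterated finite sums -/

section Sums

variable {R α β γ δ ε ζ θ ξ : Type*} [AddCommMonoid R] [Fintype α] [Fintype β] [Fintype γ]
  [Fintype δ] [Fintype ε] [Fintype ζ] [Fintype θ] [Fintype ξ]

/-! Over a field, coalgebras and comodules are locally finite. Every element of `H` is a combination
of entries of comatrices `c`, with `Δ(c i j) = ∑ c i m ⊗ c m j`. Every element of a comodule is a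
combination of members of finite families `x` with `ρ(x j) = ∑ x i ⊗ l i j`. Linear maps can
therefore be compared on comatrices and families, and Sweedler computations become computations with
finite sums. Evaluation at a comatrix turns convolution into matrix multiplication
(`IsComatrix.map_convMul`). The cocycle condition, evaluated at comatrices such as `b`, `c`, `S(c)`,
`c` and contracted with vectors built from `α` and `β`, yields the identities for the contracted
reassociators `eta`, `zeta` and `chi` on which everything rests.

A normal basis is the same as a colinear `γ : H → A` with `b ⊗ h ↦ b γ(h)` bijective. It identifies
`N ⊗_B A` with `N ⊗ H` for every right `B`-module `N`. Hence the counit at `M` is bijective iff `m ⊗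
h ↦ m γ(h)` from `M^{coH} ⊗ H` to `M` is (`IsNormalBasis.counit_bijective_iff`), and Galois means
that `galoisMap γ` is an automorphism of `A ⊗ H`.

Cleft implies the rest. The map `E(m) = m₀ β(m₁) δ(m₂)` takes values in the coinvariants, and `m ↦
E(m₀) ⊗ m₁` inverts `m ⊗ h ↦ m γ(h)` (`IsCleaving.coinvActMap_bijective`). The case `M = A` is the
normal basis, and all `M` together give the Weak Structure Theorem. The coinvariants of `N ⊗ H` are
`N ⊗ 1`, and `γ(1)` has the left inverse `E(1)` in `B`, so the unit is bijective as well. The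
inverse of `galoisMap γ` is `a ⊗ h ↦ a δ(h₁) ⊗ h₂`.

Galois with a normal basis implies cleft. Let `Ψ` be the inverse of `galoisMap γ` and put `δ(h) =
(id ⊗ ε)Ψ(1 ⊗ h)`. The linearity and colinearity of `galoisMap γ` force `Ψ(a ⊗ h) = a δ(h₁) ⊗ h₂`
and the coaction of `δ`. One composite with `Ψ` gives `γβδ = ε`. The other gives `δγ` only under a
sum weighted by `eta`, which is undone by `zeta` (`sum_zeta_mul_eta`).

Weak Structure Theorem with a normal basis implies cleft. The theorem is applied to one relative
Hopf module, `H ⊗ A`. The preimage of `h ⊗ 1` has the form `(h₁ ⊗ d(h₂)) ⊗ h₃` for a linear map `d :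
H → A`, because the preimage map respects both comodule structures of `H`
(`IsColinear.exists_translation`). The companion is `δ(h) = d(h₂)₀ χ(h₁, d(h₂)₁)`. It satisfies
`β(h₁) δ(h₂) = d(h)`, and the normal basis gives `γ(h₁) d(h₂) = ε(h) 1`. -/

theorem sum_rotate₃ (f : α → β → γ → R) :
    ∑ a, ∑ b, ∑ c, f a b c = ∑ b, ∑ c, ∑ a, f a b c := by
  rw [Finset.sum_comm]
  exact Finset.sum_congr rfl fun b _ => Finset.sum_comm

theorem sum_rotate₄ (f : α → β → γ → δ → R) :
    ∑ a, ∑ b, ∑ c, ∑ d, f a b c d = ∑ b, ∑ c, ∑ d, ∑ a, f a b c d := by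
  rw [Finset.sum_comm]
  exact Finset.sum_congr rfl fun b _ => sum_rotate₃ _

theorem sum_rotate₅ (f : α → β → γ → δ → ε → R) :
    ∑ a, ∑ b, ∑ c, ∑ d, ∑ e, f a b c d e = ∑ b, ∑ c, ∑ d, ∑ e, ∑ a, f a b c d e := by
  rw [Finset.sum_comm]
  exact Finset.sum_congr rfl fun b _ => sum_rotate₄ _

theorem sum_rotate₆ (f : α → β → γ → δ → ε → ζ → R) :
    ∑ a, ∑ b, ∑ c, ∑ d, ∑ e, ∑ g, f a b c d e g = ∑ b, ∑ c, ∑ d, ∑ e, ∑ g, ∑ a, f a b c d e g := by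
  rw [Finset.sum_comm]
  exact Finset.sum_congr rfl fun b _ => sum_rotate₅ _

theorem sum_comm₃₃ (f : α → β → γ → δ → ε → ζ → R) :
    ∑ a, ∑ b, ∑ c, ∑ d, ∑ e, ∑ g, f a b c d e g = ∑ d, ∑ e, ∑ g, ∑ a, ∑ b, ∑ c, f a b c d e g := by
  conv_lhs => enter [2, a, 2, b]; rw [sum_rotate₄]
  conv_lhs => enter [2, a]; rw [sum_rotate₄]
  rw [sum_rotate₄]

theorem sum_comm₃₄ (f : α → β → γ → δ → ε → ζ → θ → R) :
    ∑ a, ∑ b, ∑ c, ∑ d, ∑ e, ∑ g, ∑ h, f a b c d e g h =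
      ∑ d, ∑ e, ∑ g, ∑ h, ∑ a, ∑ b, ∑ c, f a b c d e g h := by
  conv_lhs => enter [2, a, 2, b]; rw [sum_rotate₅]
  conv_lhs => enter [2, a]; rw [sum_rotate₅]
  rw [sum_rotate₅]

theorem sum_comm₄₄ (f : α → β → γ → δ → ε → ζ → θ → ξ → R) :
    ∑ a, ∑ b, ∑ c, ∑ d, ∑ e, ∑ g, ∑ h, ∑ t, f a b c d e g h t =
      ∑ e, ∑ g, ∑ h, ∑ t, ∑ a, ∑ b, ∑ c, ∑ d, f a b c d e g h t := by
  conv_lhs => enter [2, a, 2, b, 2, c]; rw [sum_rotate₅]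
  conv_lhs => enter [2, a, 2, b]; rw [sum_rotate₅]
  conv_lhs => enter [2, a]; rw [sum_rotate₅]
  rw [sum_rotate₅]

end Sums

/-! ### Comatrices and evaluation of convolution identities -/

section Comatrix

variable (k : Type w) {C D ι κ : Type*} [Field k] [AddCommGroup C] [Module k C] [Coalgebra k C]
  [AddCommGroup D] [Module k D] [Coalgebra k D] [Fintype ι] [DecidableEq ι] [Fintype κ]
  [DecidableEq κ]

/-- A square matrix of elements of a coalgebra with `Δ(c i j) = ∑ m, c i m ⊗ c m j` and
`ε(c i j) = δ i j`. -/
structure IsComatrix (c : Matrix ι ι C) : Prop where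
  comul_apply : ∀ i j, Coalgebra.comul (R := k) (c i j) = ∑ m, c i m ⊗ₜ[k] c m j
  counit_apply : ∀ i j, Coalgebra.counit (R := k) (c i j) = (1 : Matrix ι ι k) i j

variable {k}

/-- The tensor product of two square matrices. -/
def tmulMatrix (c : Matrix ι ι C) (d : Matrix κ κ D) : Matrix (ι × κ) (ι × κ) (C ⊗[k] D) :=
  fun p q => c p.1 q.1 ⊗ₜ d p.2 q.2

theorem tmulMatrix_apply (c : Matrix ι ι C) (d : Matrix κ κ D) (p q : ι × κ) :
    tmulMatrix (k := k) c d p q = c p.1 q.1 ⊗ₜ d p.2 q.2 := rfl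

theorem IsComatrix.tmul {c : Matrix ι ι C} {d : Matrix κ κ D} (hc : IsComatrix k c)
    (hd : IsComatrix k d) : IsComatrix k (tmulMatrix (k := k) c d) where
  comul_apply := by
    rintro ⟨i, i'⟩ ⟨j, j'⟩
    simp only [tmulMatrix_apply, TensorProduct.comul_tmul, hc.comul_apply, hd.comul_apply,
      TensorProduct.sum_tmul, TensorProduct.tmul_sum, map_sum, Fintype.sum_prod_type]
    rw [Finset.sum_comm]
    rfl
  counit_apply := by
    rintro ⟨i, i'⟩ ⟨j, j'⟩
    simp only [tmulMatrix_apply, TensorProduct.counit_tmul, hc.counit_apply, hd.counit_apply,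
      Matrix.one_apply, Prod.mk.injEq, smul_eq_mul]
    split_ifs <;> simp_all

/-- The comultiplication of a comatrix is matrix multiplication. Hence any identity in a convolution
algebra, in particular the cocycle condition, can be read as an identity of matrices. -/
theorem IsComatrix.map_convMul {c : Matrix ι ι C} (hc : IsComatrix k c)
    (f g : WithConv (C →ₗ[k] k)) : c.map (f * g).ofConv = c.map f.ofConv * c.map g.ofConv := by
  ext i j
  rw [Matrix.map_apply, LinearMap.convMul_apply, hc.comul_apply, map_sum, map_sum,
    Matrix.mul_apply]
  rfl

theorem IsComatrix.map_one {c : Matrix ι ι C} (hc : IsComatrix k c) :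
    c.map (1 : WithConv (C →ₗ[k] k)).ofConv = 1 := by
  ext i j
  exact hc.counit_apply i j

theorem isComatrix_one_tmul {g : C} (h1 : Coalgebra.comul (R := k) g = g ⊗ₜ g)
    (h2 : Coalgebra.counit (R := k) g = 1) : IsComatrix k (fun _ _ : Unit => g) where
  comul_apply _ _ := by simp [h1]
  counit_apply _ _ := by simp [h2]

end Comatrix

/-! ### Local finiteness of comodules and coalgebras -/

section LocalFiniteness

variable {k : Type w} {H : Type u} [Field k] [AddCommGroup H] [Module k H] [Coalgebra k H]

variable (k) in
/-- A family of elements of a comodule with `ρ(x j) = ∑ i, x i ⊗ l i j`, for a comatrix `l`. -/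
structure IsComoduleFamily {M : Type u} [AddCommGroup M] [Module k M] [RightComodule k H M]
    {κ : Type*} [Fintype κ] [DecidableEq κ] (x : κ → M) (l : Matrix κ κ H) : Prop where
  isComatrix : IsComatrix k l
  coaction_apply : ∀ j, coaction k H M (x j) = ∑ i, x i ⊗ₜ[k] l i j

variable {M : Type u} [AddCommGroup M] [Module k M] [RightComodule k H M]

theorem idCounit_coact (m : M) : (TensorProduct.rid k M).toLinearMap
    (LinearMap.lTensor M (Coalgebra.counit (R := k) (A := H)) (coaction k H M m)) = m :=
  LinearMap.congr_fun (RightComodule.coact_counit (k := k) (H := H) (M := M)) m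

theorem coact_coassoc (m : M) : TensorProduct.assoc k M H H
    (LinearMap.rTensor H (coaction k H M) (coaction k H M m)) =
      LinearMap.lTensor M (Coalgebra.comul (R := k) (A := H)) (coaction k H M m) :=
  LinearMap.congr_fun (RightComodule.coassoc (k := k) (H := H) (M := M)) m

/-- An element of a comodule lies in a finite dimensional subspace `V` with
`ρ(V) ⊆ V ⊗ H`. -/
theorem exists_finite_subcomodule (m : M) : ∃ V : Submodule k M, Module.Finite k V ∧ m ∈ V ∧
    ∀ x ∈ V, coaction k H M x ∈ LinearMap.range (LinearMap.rTensor H V.subtype) := by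
  -- With `ρ(m) = ∑ c s ⊗ b s` over a basis `b` of `H`, the subspace is the span of the finitely
  -- many nonzero `c s`.
  let b := Module.Basis.ofVectorSpace k H
  obtain ⟨c, hc⟩ := TensorProduct.eq_repr_basis_right b (coaction k H M m)
  rw [Finsupp.sum] at hc
  have hmem : ∀ s ∈ c.support, c s ∈ Submodule.span k (c '' c.support) := fun s hs =>
    Submodule.subset_span ⟨s, hs, rfl⟩
  refine ⟨Submodule.span k (c '' c.support), ?_, ?_, ?_⟩
  · exact Module.Finite.span_of_finite k (c.support.finite_toSet.image _)
  · have h := idCounit_coact (k := k) (H := H) m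
    rw [← hc] at h
    simp only [map_sum, LinearMap.lTensor_tmul, LinearEquiv.coe_coe, TensorProduct.rid_tmul] at h
    rw [← h]
    exact Submodule.sum_mem _ fun s hs => Submodule.smul_mem _ _ (hmem s hs)
  · intro x hx
    rw [← Submodule.mem_comap]
    revert x
    change Submodule.span k (c '' c.support) ≤ _
    rw [Submodule.span_le]
    rintro _ ⟨t, ht, rfl⟩
    -- Applying the coordinate functional of `b t` to the last factor of the coassociativity
    -- relation isolates `ρ(c t)` on one side. On the other side only the vectors `c s` occur in the
    -- first factor.
    let P : M ⊗[k] (H ⊗[k] H) →ₗ[k] M ⊗[k] H := LinearMap.lTensor M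
      ((TensorProduct.rid k H).toLinearMap ∘ₗ LinearMap.lTensor H (b.coord t))
    have hP : ∀ (y : M ⊗[k] H) (h : H),
        P (TensorProduct.assoc k M H H (y ⊗ₜ h)) = b.coord t h • y := by
      intro y h
      induction y with
      | zero => simp
      | add y z hy hz => rw [TensorProduct.add_tmul, map_add, map_add, hy, hz, smul_add]
      | tmul y g => simp [P]
    have h := congrArg P (coact_coassoc (k := k) (H := H) m)
    rw [← hc] at h
    simp only [map_sum, LinearMap.rTensor_tmul, LinearMap.lTensor_tmul, hP] at h
    simp only [Module.Basis.coord_apply, Module.Basis.repr_self] at h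
    rw [Finset.sum_eq_single t (fun s _ hs => by rw [Finsupp.single_eq_of_ne' hs, zero_smul])
      (fun h => absurd ht h), Finsupp.single_eq_same, one_smul] at h
    simp only [SetLike.mem_coe, Submodule.mem_comap]
    rw [h]
    refine Submodule.sum_mem _ fun s hs => ⟨⟨c s, hmem s hs⟩ ⊗ₜ
      (TensorProduct.rid k H (LinearMap.lTensor H (b.coord t) (Coalgebra.comul (b s)))), ?_⟩
    simp [P]

/-- Finitely many elements of a comodule lie in a finite dimensional subspace `V` with
`ρ(V) ⊆ V ⊗ H`. -/
theorem exists_finite_subcomodule_family {σ : Type*} [Finite σ] (m : σ → M) :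
    ∃ V : Submodule k M, Module.Finite k V ∧ (∀ s, m s ∈ V) ∧
      ∀ x ∈ V, coaction k H M x ∈ LinearMap.range (LinearMap.rTensor H V.subtype) := by
  choose V hV hm hx using fun s => exists_finite_subcomodule (k := k) (H := H) (m s)
  refine ⟨⨆ s, V s, inferInstance, fun s => Submodule.mem_iSup_of_mem s (hm s), ?_⟩
  intro x hx'
  rw [← Submodule.mem_comap]
  revert x
  change (⨆ s, V s) ≤ _
  refine iSup_le fun s x hxs => ?_
  obtain ⟨t, ht⟩ := hx s x hxs
  refine ⟨LinearMap.rTensor H (Submodule.inclusion (le_iSup V s)) t, ?_⟩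
  rw [← ht, ← LinearMap.rTensor_comp_apply]
  rfl

/-- The coordinate functionals on the span of `x` extend to the whole space, and each of them reads
off one coefficient. -/
theorem sum_tmul_left_injective {κ : Type*} [Fintype κ] {V W : Type*} [AddCommGroup V]
    [Module k V] [AddCommGroup W] [Module k W] {x : κ → V} (hx : LinearIndependent k x)
    {f g : κ → W} (h : ∑ i, x i ⊗ₜ[k] f i = ∑ i, x i ⊗ₜ[k] g i) : f = g := by
  funext i
  obtain ⟨φ, hφ⟩ := LinearMap.exists_extend (Finsupp.lapply i ∘ₗ hx.repr :
    Submodule.span k (Set.range x) →ₗ[k] k)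
  have hφx : ∀ j, φ (x j) = Finsupp.single j (1 : k) i := by
    intro j
    have := LinearMap.congr_fun hφ ⟨x j, Submodule.subset_span ⟨j, rfl⟩⟩
    simpa [hx.repr_eq_single j ⟨x j, Submodule.subset_span ⟨j, rfl⟩⟩ rfl] using this
  have h' := congrArg (fun t => TensorProduct.lid k W (LinearMap.rTensor W φ t)) h
  simpa [hφx, Finsupp.single_apply, ite_smul] using h'

/-- Finitely many elements of a comodule lie in the span of a linearly independent finite
comodule family. -/
theorem exists_isComoduleFamily {σ : Type*} [Finite σ] (m : σ → M) :
    ∃ (n : ℕ) (x : Fin n → M) (l : Matrix (Fin n) (Fin n) H), LinearIndependent k x ∧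
      IsComoduleFamily k x l ∧ ∀ s, m s ∈ Submodule.span k (Set.range x) := by
  obtain ⟨V, hV, hm, hc⟩ := exists_finite_subcomodule_family (k := k) (H := H) m
  let b := Module.finBasis k V
  let x : Fin _ → M := fun i => b i
  have hx : LinearIndependent k x := b.linearIndependent.map' V.subtype V.ker_subtype
  have hex : ∀ j, ∃ l : Fin (Module.finrank k V) → H,
      coaction k H M (x j) = ∑ i, x i ⊗ₜ[k] l i := by
    intro j
    obtain ⟨t, ht⟩ := hc (x j) (b j).2
    obtain ⟨c, rfl⟩ := TensorProduct.eq_repr_basis_left b t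
    refine ⟨c, ?_⟩
    rw [← ht, Finsupp.sum_fintype _ _ (by simp), map_sum]
    rfl
  choose l hl using hex
  have hspan : Submodule.span k (Set.range x) = V := by
    have : Set.range x = V.subtype '' Set.range b := by rw [← Set.range_comp]; rfl
    rw [this, ← Submodule.map_span, b.span_eq, Submodule.map_top, Submodule.range_subtype]
  refine ⟨_, x, fun i j => l j i, hx, ⟨⟨?_, ?_⟩, hl⟩, fun s => hspan.symm ▸ hm s⟩
  -- Coassociativity, and below the counit law, are compared coefficientwise, which the independence
  -- of `x` allows.
  · intro i j
    have h := coact_coassoc (k := k) (H := H) (x j)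
    simp only [hl, map_sum, LinearMap.rTensor_tmul, LinearMap.lTensor_tmul,
      TensorProduct.sum_tmul, TensorProduct.assoc_tmul] at h
    rw [Finset.sum_comm] at h
    simp only [← TensorProduct.tmul_sum] at h
    exact (congrFun (sum_tmul_left_injective hx h) i).symm
  · intro i j
    have h := idCounit_coact (k := k) (H := H) (x j)
    simp only [hl, map_sum, LinearMap.lTensor_tmul, LinearEquiv.coe_coe,
      TensorProduct.rid_tmul] at h
    have h' : ∑ i, (Coalgebra.counit (R := k) (l j i) - (1 : Matrix _ _ k) i j) • x i = 0 := by
      simp [sub_smul, Finset.sum_sub_distrib, h, Matrix.one_apply, ite_smul]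
    exact sub_eq_zero.1 (Fintype.linearIndependent_iff.1 hx _ h' i)

/-- Linear maps on a comodule agree if they agree on comodule families. -/
theorem comodule_hom_ext {V : Type*} [AddCommGroup V] [Module k V] {f g : M →ₗ[k] V}
    (h : ∀ (n : ℕ) (x : Fin n → M) (l : Matrix (Fin n) (Fin n) H), IsComoduleFamily k x l →
      ∀ j, f (x j) = g (x j)) : f = g := by
  ext m
  obtain ⟨n, x, l, -, hx, hm⟩ := exists_isComoduleFamily (k := k) (H := H) fun _ : Unit => m
  refine LinearMap.eqOn_span' (f := f) (g := g) ?_ (hm ())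
  rintro _ ⟨j, rfl⟩
  exact h n x l hx j

/-- Induction over comodule families. -/
theorem comodule_induction {p : M → Prop} (h0 : p 0) (hadd : ∀ x y, p x → p y → p (x + y))
    (hsmul : ∀ (r : k) x, p x → p (r • x))
    (h : ∀ (n : ℕ) (x : Fin n → M) (l : Matrix (Fin n) (Fin n) H), IsComoduleFamily k x l →
      ∀ j, p (x j)) (m : M) : p m := by
  obtain ⟨n, x, l, -, hx, hm⟩ := exists_isComoduleFamily (k := k) (H := H) fun _ : Unit => m
  refine Submodule.span_induction ?_ h0 (fun x y _ _ => hadd x y) (fun r x _ => hsmul r x) (hm ())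
  rintro _ ⟨j, rfl⟩
  exact h n x l hx j

variable (k H) in
/-- The right comodule structure on a coalgebra given by the comultiplication. -/
abbrev regularComodule : RightComodule k H H where
  coact := Coalgebra.comul
  coassoc := Coalgebra.coassoc
  coact_counit := by
    ext h
    simp

/-- Induction over comatrices. -/
theorem coalgebra_induction {p : H → Prop} (h0 : p 0) (hadd : ∀ x y, p x → p y → p (x + y))
    (hsmul : ∀ (r : k) x, p x → p (r • x))
    (h : ∀ (n : ℕ) (c : Matrix (Fin n) (Fin n) H), IsComatrix k c → ∀ i j, p (c i j)) (x : H) :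
    p x := by
  let _ := regularComodule k H
  refine comodule_induction (k := k) (H := H) h0 hadd hsmul (fun n x l hx j => ?_) x
  -- Applying `ε ⊗ id` to `Δ(x j)` shows that `x j` is a combination of entries of its own
  -- coefficient comatrix.
  have e : x j = ∑ i, Coalgebra.counit (R := k) (x i) • l i j := by
    have := congrArg (fun t => TensorProduct.lid k H (LinearMap.rTensor H
      (Coalgebra.counit (R := k) (A := H)) t)) (hx.coaction_apply j)
    rw [show coaction k H H (x j) = Coalgebra.comul (x j) from rfl] at this
    simpa using this
  rw [e]
  exact Finset.sum_induction _ p hadd h0 fun i _ => hsmul _ _ (h n l hx.isComatrix i j)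

/-- Linear maps on a coalgebra agree if they agree on comatrices. -/
theorem coalgebra_hom_ext {V : Type*} [AddCommGroup V] [Module k V] {f g : H →ₗ[k] V}
    (h : ∀ (n : ℕ) (c : Matrix (Fin n) (Fin n) H), IsComatrix k c →
      ∀ i j, f (c i j) = g (c i j)) : f = g := by
  ext x
  exact coalgebra_induction (k := k) (p := fun x => f x = g x) (by simp)
    (fun x y hx hy => by simp [hx, hy]) (fun r x hx => by simp [hx]) h x

end LocalFiniteness

/-! ### Convolution identities for the reassociator -/

section Reassociator

open CoquasiBialgebra

variable {k : Type w} {H : Type u} [Field k] [NonAssocRing H] [Module k H]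
  [IsScalarTower k H H] [SMulCommClass k H H] [CoquasiBialgebra k H]

variable (k H) in
/-- The multiplication of a coquasi-bialgebra as a coalgebra morphism. -/
def mulCoalgHom : H ⊗[k] H →ₗc[k] H where
  toLinearMap := LinearMap.mul' k H
  counit_comp := by
    ext h g
    simp [counit_mul, TensorProduct.counit_tmul, mul_comm]
  map_comp_comul := by
    ext h g
    simp only [TensorProduct.AlgebraTensorModule.curry_apply, TensorProduct.curry_apply,
      LinearMap.restrictScalars_self, LinearMap.coe_comp, Function.comp_apply,
      TensorProduct.comul_tmul, LinearMap.mul'_apply, comul_mul]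
    generalize Coalgebra.comul (R := k) h = s
    generalize Coalgebra.comul (R := k) g = t
    induction s with
    | zero => simp
    | add x y hx hy => simp only [add_mul, TensorProduct.add_tmul, map_add, hx, hy]
    | tmul x y =>
      induction t with
      | zero => simp
      | add x y hx hy => simp only [mul_add, TensorProduct.tmul_add, map_add, hx, hy]
      | tmul z w => simp

variable {D : Type*} [AddCommGroup D] [Module k D] [Coalgebra k D]

theorem omega_comp_mul_omegaInv_comp (φ : D →ₗc[k] H ⊗[k] (H ⊗[k] H)) :
    WithConv.toConv (omega ∘ₗ φ.toLinearMap) * WithConv.toConv (omegaInv ∘ₗ φ.toLinearMap) = 1 := by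
  have h := congrArg (fun f => WithConv.toConv (f.ofConv ∘ₗ φ.toLinearMap))
    (omega_mul_omegaInv (k := k) (H := H))
  simp only [LinearMap.convMul_comp_coalgHom_distrib] at h
  refine Eq.trans ?_ (h.trans ?_)
  · rfl
  · ext x
    simp

theorem omegaInv_comp_mul_omega_comp (φ : D →ₗc[k] H ⊗[k] (H ⊗[k] H)) :
    WithConv.toConv (omegaInv ∘ₗ φ.toLinearMap) * WithConv.toConv (omega ∘ₗ φ.toLinearMap) = 1 := by
  have h := congrArg (fun f => WithConv.toConv (f.ofConv ∘ₗ φ.toLinearMap))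
    (omegaInv_mul_omega (k := k) (H := H))
  simp only [LinearMap.convMul_comp_coalgHom_distrib] at h
  refine Eq.trans ?_ (h.trans ?_)
  · rfl
  · ext x
    simp

/-- A functional on `H ⊗ H ⊗ H` after a coalgebra morphism has the inverse functional after it as
convolution inverse. -/
theorem omega_comp_mul_of_eq (φ : D →ₗc[k] H ⊗[k] (H ⊗[k] H)) {f g : D →ₗ[k] k}
    (hf : f = omega ∘ₗ φ.toLinearMap) (hg : g = omegaInv ∘ₗ φ.toLinearMap) :
    WithConv.toConv f * WithConv.toConv g = 1 ∧ WithConv.toConv g * WithConv.toConv f = 1 := by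
  subst hf hg
  exact ⟨omega_comp_mul_omegaInv_comp φ, omegaInv_comp_mul_omega_comp φ⟩

/-- Here and in the four lemmas that follow, the form is `ω` composed with a coalgebra morphism
built from the multiplication, the counit and associativity. Precomposition with such a morphism is
multiplicative for convolution, so the inverse is `ω⁻¹` composed with the same morphism. -/
theorem omega_mulLast_inverse :
    WithConv.toConv (omega ∘ₗ mulLast k H) * WithConv.toConv (omegaInv ∘ₗ mulLast k H) = 1 ∧
    WithConv.toConv (omegaInv ∘ₗ mulLast k H) * WithConv.toConv (omega ∘ₗ mulLast k H) = 1 :=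
  omega_comp_mul_of_eq (Coalgebra.TensorProduct.map (CoalgHom.id k H)
    (Coalgebra.TensorProduct.map (CoalgHom.id k H) (mulCoalgHom k H))) rfl rfl

theorem omega_mulMiddle_inverse :
    WithConv.toConv (omega ∘ₗ mulMiddle k H) * WithConv.toConv (omegaInv ∘ₗ mulMiddle k H) = 1 ∧
    WithConv.toConv (omegaInv ∘ₗ mulMiddle k H) * WithConv.toConv (omega ∘ₗ mulMiddle k H) = 1 :=
  omega_comp_mul_of_eq (Coalgebra.TensorProduct.map (CoalgHom.id k H)
    ((Coalgebra.TensorProduct.map (mulCoalgHom k H) (CoalgHom.id k H)).comp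
      (Coalgebra.TensorProduct.assoc k k H H H).symm.toCoalgHom)) rfl rfl

theorem omega_mulFirst_inverse :
    WithConv.toConv (omega ∘ₗ mulFirst k H) * WithConv.toConv (omegaInv ∘ₗ mulFirst k H) = 1 ∧
    WithConv.toConv (omegaInv ∘ₗ mulFirst k H) * WithConv.toConv (omega ∘ₗ mulFirst k H) = 1 :=
  omega_comp_mul_of_eq ((Coalgebra.TensorProduct.map (mulCoalgHom k H)
    (CoalgHom.id k (H ⊗[k] H))).comp
      (Coalgebra.TensorProduct.assoc k k H H (H ⊗[k] H)).symm.toCoalgHom) rfl rfl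

theorem omega_counitTimes_inverse :
    WithConv.toConv (counitTimes (omega (k := k) (H := H))) *
      WithConv.toConv (counitTimes omegaInv) = 1 ∧
    WithConv.toConv (counitTimes (omegaInv (k := k) (H := H))) *
      WithConv.toConv (counitTimes omega) = 1 :=
  omega_comp_mul_of_eq ((Coalgebra.TensorProduct.lid k (H ⊗[k] (H ⊗[k] H))).toCoalgHom.comp
    (Coalgebra.TensorProduct.map (Coalgebra.counitCoalgHom k H) (CoalgHom.id k _)))
    (by ext h g l p; exact (map_smul (omega (k := k) (H := H)) _ _).symm)
    (by ext h g l p; exact (map_smul (omegaInv (k := k) (H := H)) _ _).symm)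

theorem omega_timesCounit_inverse :
    WithConv.toConv (timesCounit (omega (k := k) (H := H))) *
      WithConv.toConv (timesCounit omegaInv) = 1 ∧
    WithConv.toConv (timesCounit (omegaInv (k := k) (H := H))) *
      WithConv.toConv (timesCounit omega) = 1 :=
  omega_comp_mul_of_eq (Coalgebra.TensorProduct.map (CoalgHom.id k H)
    (Coalgebra.TensorProduct.map (CoalgHom.id k H)
      ((Coalgebra.TensorProduct.rid k k H).toCoalgHom.comp
        (Coalgebra.TensorProduct.map (CoalgHom.id k H) (Coalgebra.counitCoalgHom k H)))))
    (by
      ext h g l p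
      refine (mul_comm _ _).trans ((map_smul (omega (k := k) (H := H)) (Coalgebra.counit p)
        (h ⊗ₜ (g ⊗ₜ l))).symm.trans ?_)
      rw [← TensorProduct.tmul_smul, ← TensorProduct.tmul_smul]
      rfl)
    (by
      ext h g l p
      refine (mul_comm _ _).trans ((map_smul (omegaInv (k := k) (H := H)) (Coalgebra.counit p)
        (h ⊗ₜ (g ⊗ₜ l))).symm.trans ?_)
      rw [← TensorProduct.tmul_smul, ← TensorProduct.tmul_smul]
      rfl)

variable (k H)

/-- `ω(h₁,g₁,l₁) ω⁻¹(h₂g₂,l₂,p) = ω⁻¹(h₁,g₁l₁,p₁) ω⁻¹(g₂,l₂,p₂) ω(h₂,g₃,l₃p₃)`. -/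
theorem timesCounit_mul_mulFirst :
    WithConv.toConv (timesCounit (omega (k := k) (H := H))) *
      WithConv.toConv (omegaInv ∘ₗ mulFirst k H) =
    WithConv.toConv (omegaInv ∘ₗ mulMiddle k H) * WithConv.toConv (counitTimes omegaInv) *
      WithConv.toConv (omega ∘ₗ mulLast k H) := by
  obtain ⟨hF, -⟩ := omega_mulFirst_inverse (k := k) (H := H)
  obtain ⟨-, hM⟩ := omega_mulMiddle_inverse (k := k) (H := H)
  obtain ⟨-, hc⟩ := omega_counitTimes_inverse (k := k) (H := H)
  have h := cocycle (k := k) (H := H)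
  generalize WithConv.toConv (omega ∘ₗ mulLast k H) = L at *
  generalize WithConv.toConv (omega ∘ₗ mulFirst k H) = F at *
  generalize WithConv.toConv (omegaInv ∘ₗ mulFirst k H) = F' at *
  calc _ = WithConv.toConv (omegaInv ∘ₗ mulMiddle k H) * (WithConv.toConv (counitTimes omegaInv) *
        WithConv.toConv (counitTimes omega)) * WithConv.toConv (omega ∘ₗ mulMiddle k H) *
        WithConv.toConv (timesCounit omega) * F' := by rw [hc, mul_one, hM, one_mul]
    _ = WithConv.toConv (omegaInv ∘ₗ mulMiddle k H) * WithConv.toConv (counitTimes omegaInv) *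
        (WithConv.toConv (counitTimes omega) * WithConv.toConv (omega ∘ₗ mulMiddle k H) *
        WithConv.toConv (timesCounit omega)) * F' := by simp only [mul_assoc]
    _ = _ := by rw [← h, ← mul_assoc, mul_assoc _ F, hF, mul_one]

/-- `ω(h₁g₁,l₁,p) ω⁻¹(h₂,g₂,l₂) = ω⁻¹(h₁,g₁,l₁p₁) ω(g₂,l₂,p₂) ω(h₂,g₃l₃,p₃)`. -/
theorem mulFirst_mul_timesCounit :
    WithConv.toConv (omega ∘ₗ mulFirst k H) *
      WithConv.toConv (timesCounit (omegaInv (k := k) (H := H))) =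
    WithConv.toConv (omegaInv ∘ₗ mulLast k H) * WithConv.toConv (counitTimes omega) *
      WithConv.toConv (omega ∘ₗ mulMiddle k H) := by
  obtain ⟨-, hL⟩ := omega_mulLast_inverse (k := k) (H := H)
  obtain ⟨ht, -⟩ := omega_timesCounit_inverse (k := k) (H := H)
  calc _ = WithConv.toConv (omegaInv ∘ₗ mulLast k H) * (WithConv.toConv (omega ∘ₗ mulLast k H) *
        WithConv.toConv (omega ∘ₗ mulFirst k H)) * WithConv.toConv (timesCounit omegaInv) := by
          rw [← mul_assoc, hL, one_mul]
    _ = _ := by rw [cocycle]; simp only [mul_assoc]; rw [ht, mul_one]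

/-- `ω⁻¹(g₁,l₁,p₁) ω(h₁,g₂,l₂p₂) ω(h₂g₃,l₃,p₃) = ω(h₁,g₁l₁,p) ω(h₂,g₂,l₂)`. -/
theorem counitTimes_mul_mulLast_mul_mulFirst :
    WithConv.toConv (counitTimes (omegaInv (k := k) (H := H))) *
      WithConv.toConv (omega ∘ₗ mulLast k H) * WithConv.toConv (omega ∘ₗ mulFirst k H) =
    WithConv.toConv (omega ∘ₗ mulMiddle k H) * WithConv.toConv (timesCounit omega) := by
  obtain ⟨-, hc⟩ := omega_counitTimes_inverse (k := k) (H := H)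
  rw [mul_assoc, cocycle, ← mul_assoc, ← mul_assoc, hc, one_mul]

/-- Quasi-associativity takes values in `H`. Composing it with a functional moves it into the
convolution algebra of scalar forms, where `ω` can be inverted. -/
theorem quasi_assoc_conv (φ : H →ₗ[k] k) :
    WithConv.toConv (φ ∘ₗ mulRight₃ k H) * WithConv.toConv omega =
      WithConv.toConv omega * WithConv.toConv (φ ∘ₗ mulLeft₃ k H) := by
  ext1
  have h := congrArg (φ ∘ₗ ·) (quasi_assoc (k := k) (H := H))
  refine Eq.trans ?_ (h.trans ?_)
  · rw [LinearMap.convMul_def]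
    change LinearMap.mul' k k ∘ₗ TensorProduct.map _ _ ∘ₗ _ = _
    rw [← LinearMap.comp_assoc, ← LinearMap.comp_assoc, ← LinearMap.comp_assoc]
    congr 1
    ext x y z x' y' z'
    simp [mul_comm]
  · rw [LinearMap.convMul_def]
    change _ = LinearMap.mul' k k ∘ₗ TensorProduct.map _ _ ∘ₗ _
    rw [← LinearMap.comp_assoc, ← LinearMap.comp_assoc, ← LinearMap.comp_assoc]
    congr 1
    ext x y z x' y' z'
    simp

/-- `φ((h₁g₁)l₁) ω⁻¹(h₂,g₂,l₂) = ω⁻¹(h₁,g₁,l₁) φ(h₂(g₂l₂))`. -/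
theorem quasi_assoc_omegaInv (φ : H →ₗ[k] k) :
    WithConv.toConv (φ ∘ₗ mulLeft₃ k H) * WithConv.toConv omegaInv =
      WithConv.toConv omegaInv * WithConv.toConv (φ ∘ₗ mulRight₃ k H) := by
  calc _ = WithConv.toConv omegaInv * (WithConv.toConv omega *
        WithConv.toConv (φ ∘ₗ mulLeft₃ k H)) * WithConv.toConv omegaInv := by
          rw [← mul_assoc, omegaInv_mul_omega, one_mul]
    _ = _ := by rw [← quasi_assoc_conv, mul_assoc, mul_assoc, omega_mul_omegaInv, mul_one]

end Reassociator

/-! ### Products of comatrices, and the reassociator at the unit -/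

section Matrices

open CoquasiBialgebra

variable {k : Type w} {H : Type u} [Field k] [NonAssocRing H] [Module k H]
  [IsScalarTower k H H] [SMulCommClass k H H] [CoquasiBialgebra k H]
  {ι κ l μ : Type*} [Fintype ι] [DecidableEq ι] [Fintype κ] [DecidableEq κ] [Fintype l]
  [DecidableEq l] [Fintype μ] [DecidableEq μ]

/-- The product of two square matrices. -/
def mulMatrix (c : Matrix ι ι H) (d : Matrix κ κ H) : Matrix (ι × κ) (ι × κ) H :=
  fun p q => c p.1 q.1 * d p.2 q.2

theorem IsComatrix.mul {c : Matrix ι ι H} {d : Matrix κ κ H} (hc : IsComatrix k c)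
    (hd : IsComatrix k d) : IsComatrix k (mulMatrix c d) where
  comul_apply p q := by
    rw [mulMatrix, comul_mul, hc.comul_apply, hd.comul_apply, Finset.sum_mul_sum,
      Fintype.sum_prod_type]
    simp only [Algebra.TensorProduct.tmul_mul_tmul, mulMatrix]
  counit_apply p q := by
    rw [mulMatrix, counit_mul, hc.counit_apply, hd.counit_apply]
    simp only [Matrix.one_apply, Prod.ext_iff]
    split_ifs <;> simp_all

theorem isComatrix_one : IsComatrix k (fun _ _ : Unit => (1 : H)) :=
  isComatrix_one_tmul comul_one counit_one

/-- At `(h, g, 1, 1)` the cocycle condition reads `X = X * X` for the form `X = ω(h, g, 1)`, which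
is invertible, so `X` is trivial. -/
theorem omega_one_right (h g : H) : omega (k := k) (h ⊗ₜ (g ⊗ₜ (1 : H))) =
    Coalgebra.counit (R := k) h * Coalgebra.counit (R := k) g := by
  refine coalgebra_induction (k := k) (p := fun h => omega (k := k) (h ⊗ₜ (g ⊗ₜ (1 : H))) =
    Coalgebra.counit (R := k) h * Coalgebra.counit (R := k) g) (by simp)
    (fun x y hx hy => by simp only [TensorProduct.add_tmul, map_add, hx, hy, add_mul])
    (fun r x hx => by
      simp only [← TensorProduct.smul_tmul', map_smul, hx, smul_mul_assoc]) ?_ h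
  intro n b hb i j
  refine coalgebra_induction (k := k) (p := fun g => omega (k := k) (b i j ⊗ₜ (g ⊗ₜ (1 : H))) =
    Coalgebra.counit (R := k) (b i j) * Coalgebra.counit (R := k) g) (by simp)
    (fun x y hx hy => by
      simp only [TensorProduct.add_tmul, TensorProduct.tmul_add, map_add, hx, hy, mul_add])
    (fun r x hx => by
      simp only [← TensorProduct.smul_tmul', TensorProduct.tmul_smul, map_smul, hx,
        mul_smul_comm]) ?_ g
  intro m a ha p q
  have hT := hb.tmul (ha.tmul ((isComatrix_one (k := k) (H := H)).tmul
    (isComatrix_one (k := k) (H := H))))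
  set T := tmulMatrix (k := k) b (tmulMatrix (k := k) a (tmulMatrix (k := k)
    (fun _ _ : Unit => (1 : H)) (fun _ _ : Unit => (1 : H))))
  have w := congrArg (fun f => T.map f.ofConv) (cocycle (k := k) (H := H))
  simp only [hT.map_convMul] at w
  have hF : T.map (omega ∘ₗ mulFirst k H) = 1 := by
    rw [← hT.map_one]
    ext x y
    simp [T, tmulMatrix, mulFirst, omega_one_middle, counit_mul, counit_one,
      TensorProduct.counit_tmul, mul_comm]
  have hc : T.map (counitTimes (omega (k := k) (H := H))) = 1 := by
    rw [← hT.map_one]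
    ext x y
    simp [T, tmulMatrix, counitTimes, omega_one_middle, counit_one,
      TensorProduct.counit_tmul, mul_comm]
  have hM : T.map (omega ∘ₗ mulMiddle k H) = T.map (omega ∘ₗ mulLast k H) := by
    ext x y
    simp [T, tmulMatrix, mulMiddle, mulLast]
  have ht : T.map (timesCounit (omega (k := k) (H := H))) = T.map (omega ∘ₗ mulLast k H) := by
    ext x y
    simp [T, tmulMatrix, timesCounit, mulLast, counit_one]
  have hinv := congrArg (fun f => T.map f.ofConv) (omega_mulLast_inverse (k := k) (H := H)).1
  simp only [hT.map_convMul, hT.map_one] at hinv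
  rw [hF, hc, hM, ht, one_mul, mul_one] at w
  have hL : T.map (omega ∘ₗ mulLast k H) = 1 := by
    have w' := congrArg (· * T.map (omegaInv ∘ₗ mulLast k H)) w
    simp only [mul_assoc] at w'
    rw [hinv, mul_one] at w'
    exact w'.symm
  rw [← hT.map_one] at hL
  have := congrFun (congrFun hL (i, p, (), ())) (j, q, (), ())
  simpa [T, tmulMatrix, mulLast, counit_one, TensorProduct.counit_tmul, mul_comm] using this

/-- A functional on `H ⊗ H ⊗ H` that is trivial on a comatrix has trivial convolution inverse on
it. -/
theorem IsComatrix.map_omegaInv {c : Matrix ι ι (H ⊗[k] (H ⊗[k] H))} (hc : IsComatrix k c)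
    (h : c.map omega = 1) : c.map omegaInv = 1 := by
  have := hc.map_convMul (WithConv.toConv omega) (WithConv.toConv omegaInv)
  rw [omega_mul_omegaInv, hc.map_one] at this
  change 1 = c.map omega * c.map omegaInv at this
  rw [this, h, one_mul]

/-- On a comatrix with `1` in this slot `ω` evaluates to the identity matrix, hence so does its
convolution inverse. The same argument gives the two other slots. -/
theorem omegaInv_one_middle (h g : H) : omegaInv (k := k) (h ⊗ₜ ((1 : H) ⊗ₜ g)) =
    Coalgebra.counit (R := k) h * Coalgebra.counit (R := k) g := by
  refine coalgebra_induction (k := k) (p := fun h => omegaInv (k := k) (h ⊗ₜ ((1 : H) ⊗ₜ g)) =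
    Coalgebra.counit (R := k) h * Coalgebra.counit (R := k) g) (by simp)
    (fun x y hx hy => by
      simp only [TensorProduct.add_tmul, TensorProduct.tmul_add, map_add, hx, hy, add_mul])
    (fun r x hx => by
      simp only [← TensorProduct.smul_tmul', TensorProduct.tmul_smul, map_smul, hx,
        smul_mul_assoc]) ?_ h
  intro n b hb i j
  refine coalgebra_induction (k := k) (p := fun g => omegaInv (k := k) (b i j ⊗ₜ ((1 : H) ⊗ₜ g)) =
    Coalgebra.counit (R := k) (b i j) * Coalgebra.counit (R := k) g) (by simp)
    (fun x y hx hy => by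
      simp only [TensorProduct.add_tmul, TensorProduct.tmul_add, map_add, hx, hy, mul_add])
    (fun r x hx => by
      simp only [← TensorProduct.smul_tmul', TensorProduct.tmul_smul, map_smul, hx,
        mul_smul_comm]) ?_ g
  intro m a ha p q
  have hT := hb.tmul ((isComatrix_one (k := k) (H := H)).tmul ha)
  have := congrFun (congrFun ((hT.map_omegaInv (by
    rw [← hT.map_one]
    ext x y
    simp [tmulMatrix, omega_one_middle, counit_one, TensorProduct.counit_tmul, mul_comm])).trans
      hT.map_one.symm) (i, (), p)) (j, (), q)
  simpa [tmulMatrix, counit_one, TensorProduct.counit_tmul, mul_comm] using this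

theorem omegaInv_one_right (h g : H) : omegaInv (k := k) (h ⊗ₜ (g ⊗ₜ (1 : H))) =
    Coalgebra.counit (R := k) h * Coalgebra.counit (R := k) g := by
  refine coalgebra_induction (k := k) (p := fun h => omegaInv (k := k) (h ⊗ₜ (g ⊗ₜ (1 : H))) =
    Coalgebra.counit (R := k) h * Coalgebra.counit (R := k) g) (by simp)
    (fun x y hx hy => by
      simp only [TensorProduct.add_tmul, TensorProduct.tmul_add, map_add, hx, hy, add_mul])
    (fun r x hx => by
      simp only [← TensorProduct.smul_tmul', TensorProduct.tmul_smul, map_smul, hx,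
        smul_mul_assoc]) ?_ h
  intro n b hb i j
  refine coalgebra_induction (k := k) (p := fun g => omegaInv (k := k) (b i j ⊗ₜ (g ⊗ₜ (1 : H))) =
    Coalgebra.counit (R := k) (b i j) * Coalgebra.counit (R := k) g) (by simp)
    (fun x y hx hy => by
      simp only [TensorProduct.add_tmul, TensorProduct.tmul_add, map_add, hx, hy, mul_add])
    (fun r x hx => by
      simp only [← TensorProduct.smul_tmul', TensorProduct.tmul_smul, map_smul, hx,
        mul_smul_comm]) ?_ g
  intro m a ha p q
  have hT := hb.tmul (ha.tmul (isComatrix_one (k := k) (H := H)))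
  have := congrFun (congrFun ((hT.map_omegaInv (by
    rw [← hT.map_one]
    ext x y
    simp [tmulMatrix, omega_one_right, counit_one, TensorProduct.counit_tmul, mul_comm])).trans
      hT.map_one.symm) (i, p, ())) (j, q, ())
  simpa [tmulMatrix, counit_one, TensorProduct.counit_tmul, mul_comm] using this

theorem omegaInv_one_left (h g : H) : omegaInv (k := k) ((1 : H) ⊗ₜ (h ⊗ₜ g)) =
    Coalgebra.counit (R := k) h * Coalgebra.counit (R := k) g := by
  refine coalgebra_induction (k := k) (p := fun h => omegaInv (k := k) ((1 : H) ⊗ₜ (h ⊗ₜ g)) =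
    Coalgebra.counit (R := k) h * Coalgebra.counit (R := k) g) (by simp)
    (fun x y hx hy => by
      simp only [TensorProduct.add_tmul, TensorProduct.tmul_add, map_add, hx, hy, add_mul])
    (fun r x hx => by
      simp only [← TensorProduct.smul_tmul', TensorProduct.tmul_smul, map_smul, hx,
        smul_mul_assoc]) ?_ h
  intro n b hb i j
  refine coalgebra_induction (k := k) (p := fun g => omegaInv (k := k) ((1 : H) ⊗ₜ (b i j ⊗ₜ g)) =
    Coalgebra.counit (R := k) (b i j) * Coalgebra.counit (R := k) g) (by simp)
    (fun x y hx hy => by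
      simp only [TensorProduct.add_tmul, TensorProduct.tmul_add, map_add, hx, hy, mul_add])
    (fun r x hx => by
      simp only [← TensorProduct.smul_tmul', TensorProduct.tmul_smul, map_smul, hx,
        mul_smul_comm]) ?_ g
  intro m a ha p q
  have hT := (isComatrix_one (k := k) (H := H)).tmul (hb.tmul ha)
  have := congrFun (congrFun ((hT.map_omegaInv (by
    rw [← hT.map_one]
    ext x y
    simp [tmulMatrix, omega_one_left, counit_one, TensorProduct.counit_tmul, mul_comm])).trans
      hT.map_one.symm) ((), i, p)) ((), j, q)
  simpa [tmulMatrix, counit_one, TensorProduct.counit_tmul, mul_comm] using this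

end Matrices

/-! ### The antipode axioms on comatrices, and the contracted reassociators -/

section Antipode

open CoquasiBialgebra CoquasiHopfAlgebra

variable {k : Type w} {H : Type u} [Field k] [NonAssocRing H] [Module k H]
  [IsScalarTower k H H] [SMulCommClass k H H] [CoquasiHopfAlgebra k H]
  {ι κ l μ : Type*} [Fintype ι] [DecidableEq ι] [Fintype κ] [DecidableEq κ] [Fintype l]
  [DecidableEq l] [Fintype μ] [DecidableEq μ]

variable (k) in
/-- The matrix `S(c j i)`. -/
def antipodeMatrix (c : Matrix ι ι H) : Matrix ι ι H := fun i j => S (k := k) (c j i)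

theorem antipodeMatrix_apply (c : Matrix ι ι H) (i j : ι) :
    antipodeMatrix k c i j = S (k := k) (c j i) := rfl

/-- The transpose in `antipodeMatrix` compensates for `S` reversing the comultiplication. -/
theorem IsComatrix.antipode {c : Matrix ι ι H} (hc : IsComatrix k c) :
    IsComatrix k (antipodeMatrix k c) where
  comul_apply i j := by
    simp [antipodeMatrix, comul_S, hc.comul_apply]
  counit_apply i j := by
    rw [antipodeMatrix, counit_S, hc.counit_apply, ← Matrix.transpose_apply (1 : Matrix ι ι k),
      Matrix.transpose_one]

theorem IsComatrix.hitLeft_apply {c : Matrix ι ι H} (hc : IsComatrix k c) (f : H →ₗ[k] k) (i j : ι) :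
    hitLeft f (c i j) = ∑ m, f (c m j) • c i m := by
  simp [hitLeft, hc.comul_apply]

theorem IsComatrix.hitRight_apply {c : Matrix ι ι H} (hc : IsComatrix k c) (f : H →ₗ[k] k) (i j : ι) :
    hitRight f (c i j) = ∑ m, f (c i m) • c m j := by
  simp [hitRight, hc.comul_apply]

theorem IsComatrix.sum_S_alpha {c : Matrix ι ι H} (hc : IsComatrix k c) (i j : ι) :
    ∑ m, ∑ n, alpha (k := k) (c m n) • (S (k := k) (c i m) * c n j) =
      alpha (k := k) (c i j) • (1 : H) := by
  rw [← S_alpha_id]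
  simp [hc.comul_apply, hc.hitRight_apply, Finset.mul_sum, mul_smul_comm]

theorem IsComatrix.sum_beta_S {c : Matrix ι ι H} (hc : IsComatrix k c) (i j : ι) :
    ∑ m, ∑ n, beta (k := k) (c m n) • (c i m * S (k := k) (c n j)) =
      beta (k := k) (c i j) • (1 : H) := by
  rw [← id_beta_S, Finset.sum_comm]
  simp [hc.comul_apply, hc.hitLeft_apply, Finset.sum_mul, smul_mul_assoc]

variable (k H)

/-- `a ⊗ h ↦ ω⁻¹(a, h₁ β(h₂), S(h₃))`. -/
def eta : H ⊗[k] H →ₗ[k] k :=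
  omegaInv ∘ₗ LinearMap.lTensor H (TensorProduct.map (hitLeft (beta (k := k) (H := H))) S ∘ₗ
    Coalgebra.comul)

/-- `a ⊗ h ↦ ω(a, S(h₁), α(h₂) h₃)`. -/
def zeta : H ⊗[k] H →ₗ[k] k :=
  omega ∘ₗ LinearMap.lTensor H (TensorProduct.map S (hitRight (alpha (k := k) (H := H))) ∘ₗ
    Coalgebra.comul)

/-- `h ⊗ l ↦ ω⁻¹(S(h₁), α(h₂) h₃, l)`. -/
def chi : H ⊗[k] H →ₗ[k] k :=
  omegaInv ∘ₗ (TensorProduct.assoc k H H H).toLinearMap ∘ₗ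
    LinearMap.rTensor H (TensorProduct.map S (hitRight (alpha (k := k) (H := H))) ∘ₗ
      Coalgebra.comul)

variable {k H}

theorem IsComatrix.eta_apply {c : Matrix ι ι H} (hc : IsComatrix k c) (a : H) (i j : ι) :
    eta k H (a ⊗ₜ c i j) =
      ∑ m, ∑ n, omegaInv (k := k) (a ⊗ₜ (c i m ⊗ₜ S (k := k) (c n j))) * beta (c m n) := by
  rw [Finset.sum_comm]
  simp [eta, hc.comul_apply, hc.hitLeft_apply, TensorProduct.sum_tmul, TensorProduct.tmul_sum,
    ← TensorProduct.smul_tmul', mul_comm]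

theorem IsComatrix.zeta_apply {c : Matrix ι ι H} (hc : IsComatrix k c) (a : H) (i j : ι) :
    zeta k H (a ⊗ₜ c i j) =
      ∑ m, ∑ n, alpha (c m n) * omega (k := k) (a ⊗ₜ (S (k := k) (c i m) ⊗ₜ c n j)) := by
  simp [zeta, hc.comul_apply, hc.hitRight_apply, TensorProduct.sum_tmul, TensorProduct.tmul_sum]

theorem IsComatrix.chi_apply {c : Matrix ι ι H} (hc : IsComatrix k c) (i j : ι) (a : H) :
    chi k H (c i j ⊗ₜ a) =
      ∑ m, ∑ n, alpha (c m n) * omegaInv (k := k) (S (k := k) (c i m) ⊗ₜ (c n j ⊗ₜ a)) := by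
  simp [chi, hc.comul_apply, hc.hitRight_apply, TensorProduct.sum_tmul, TensorProduct.tmul_sum,
    ← TensorProduct.smul_tmul']

/-- This is the axiom `ω(h₁ β(h₂), S(h₃), α(h₄) h₅) = ε(h)`, regrouped as `ζ(h₁, h₃) β(h₂) = ε(h)`.
-/
theorem IsComatrix.sum_zeta {c : Matrix ι ι H} (hc : IsComatrix k c) (i j : ι) :
    ∑ m, ∑ n, zeta k H (c i m ⊗ₜ c n j) * beta (k := k) (c m n) = (1 : Matrix ι ι k) i j := by
  rw [← hc.counit_apply, ← omega_antipode]
  simp only [hc.zeta_apply]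
  simp [comul₃, hc.comul_apply, hc.hitLeft_apply, hc.hitRight_apply, TensorProduct.sum_tmul, TensorProduct.tmul_sum, ← TensorProduct.smul_tmul', Finset.mul_sum, Finset.sum_mul]
  rw [sum_rotate₄]
  exact Finset.sum_congr rfl fun _ _ => Finset.sum_congr rfl fun _ _ => Finset.sum_congr rfl
    fun _ _ => Finset.sum_congr rfl fun _ _ => by ring

/-- This is the axiom on `ω⁻¹`, regrouped as `α(h₂) η(S(h₁), h₃) = ε(h)`. -/
theorem IsComatrix.sum_eta {c : Matrix ι ι H} (hc : IsComatrix k c) (i j : ι) :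
    ∑ m, ∑ n, alpha (k := k) (c m n) * eta k H (S (k := k) (c i m) ⊗ₜ c n j)  =
      (1 : Matrix ι ι k) i j := by
  rw [← hc.counit_apply, ← omegaInv_antipode]
  simp only [hc.eta_apply]
  simp [comul₃, hc.comul_apply, hc.hitLeft_apply, hc.hitRight_apply, TensorProduct.sum_tmul, TensorProduct.tmul_sum, ← TensorProduct.smul_tmul', Finset.mul_sum, Finset.sum_mul]
  refine Finset.sum_congr rfl fun _ _ => ?_
  rw [← sum_rotate₃]
  exact Finset.sum_congr rfl fun _ _ => Finset.sum_congr rfl fun _ _ => Finset.sum_congr rfl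
    fun _ _ => by ring

end Antipode

/-! ### Contracted cocycle identities -/

section Identities

open CoquasiBialgebra CoquasiHopfAlgebra

variable {k : Type w} {H : Type u} [Field k] [NonAssocRing H] [Module k H]
  [IsScalarTower k H H] [SMulCommClass k H H] [CoquasiHopfAlgebra k H]
  {ι κ l μ : Type*} [Fintype ι] [DecidableEq ι] [Fintype κ] [DecidableEq κ] [Fintype l]
  [DecidableEq l] [Fintype μ] [DecidableEq μ]

theorem eq_of_forall_dual {V : Type*} [AddCommGroup V] [Module k V] {x y : V}
    (h : ∀ φ : V →ₗ[k] k, φ x = φ y) : x = y :=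
  sub_eq_zero.1 ((Module.forall_dual_apply_eq_zero_iff k _).1 fun φ => by
    rw [map_sub, h φ, sub_self])

/-- The cocycle condition at `(b, a, c, S(c))` is contracted with `β` in the last two slots. The
factor `ω(b, a, c S(c))` then disappears because `h₁ β(h₂) S(h₃) = β(h) 1`. The outcome is `ω(b₁,
a₁, c₁) η(b₂a₂, c₂) = ω⁻¹(b, a₁c₁, S(c₃)) η(a₂, c₂)`. -/
theorem sum_omega_mul_eta {b : Matrix ι ι H} {a : Matrix κ κ H} {c : Matrix l l H}
    (hb : IsComatrix k b) (ha : IsComatrix k a) (hc : IsComatrix k c) (p p' : ι) (q q' : κ)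
    (i j : l) :
    ∑ p'', ∑ q'', ∑ i'', omega (k := k) (b p p'' ⊗ₜ (a q q'' ⊗ₜ c i i'')) *
        eta k H ((b p'' p' * a q'' q') ⊗ₜ c i'' j) =
      ∑ q'', ∑ i'', ∑ j'', omegaInv (b p p' ⊗ₜ ((a q q'' * c i i'') ⊗ₜ S (k := k) (c j'' j))) *
        eta k H (a q'' q' ⊗ₜ c i'' j'') := by
  have hT := hb.tmul (ha.tmul (hc.tmul hc.antipode))
  set T := tmulMatrix (k := k) b (tmulMatrix (k := k) a (tmulMatrix (k := k) c
    (antipodeMatrix k c))) with T_def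
  have hw := congrArg (fun f => T.map f.ofConv) (timesCounit_mul_mulFirst k H)
  simp only [hT.map_convMul] at hw
  -- Multiplying by this vector fixes the column indices `p'` and `q'` of `b` and `a`, and inserts
  -- `β` between `c` and `S(c)`.
  let v : ι × κ × l × l → k := fun x =>
    (1 : Matrix ι ι k) x.1 p' * (1 : Matrix κ κ k) x.2.1 q' * beta (c x.2.2.1 x.2.2.2)
  have hL : (T.map (omega ∘ₗ mulLast k H)).mulVec v = v := by
    funext ⟨x, y, m, n⟩
    have := congrArg (fun t => omega (k := k) (b x p' ⊗ₜ (a y q' ⊗ₜ t))) (hc.sum_beta_S m n)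
    simp only [TensorProduct.tmul_sum, map_sum, TensorProduct.tmul_smul, map_smul,
      omega_one_right, hb.counit_apply, ha.counit_apply, Matrix.one_apply, smul_eq_mul,
      mul_comm (beta _)] at this
    simp only [Matrix.mulVec, dotProduct, Fintype.sum_prod_type, v, Matrix.map_apply, T,
      tmulMatrix, antipodeMatrix, mulLast, LinearMap.comp_apply, LinearMap.lTensor_tmul,
      LinearMap.mul'_apply, Matrix.one_apply, mul_ite, ite_mul, mul_one, one_mul, mul_zero,
      zero_mul, Finset.sum_ite_irrel, Finset.sum_const_zero, Finset.sum_ite_eq',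
      Finset.sum_ite_eq, Finset.mem_univ, if_true, this]
  have hF : (T.map (omegaInv ∘ₗ mulFirst k H)).mulVec v = fun x =>
      eta k H ((b x.1 p' * a x.2.1 q') ⊗ₜ c x.2.2.1 x.2.2.2) := by
    funext ⟨x, y, m, n⟩
    simp only [hc.eta_apply, Matrix.mulVec, dotProduct, Fintype.sum_prod_type, v,
      Matrix.map_apply, T,
      tmulMatrix, antipodeMatrix, mulFirst, LinearMap.comp_apply, LinearMap.rTensor_tmul,
      LinearEquiv.coe_coe, TensorProduct.assoc_symm_tmul,
      LinearMap.mul'_apply, Matrix.one_apply, mul_ite, ite_mul, mul_one, one_mul, mul_zero,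
      zero_mul, Finset.sum_ite_irrel, Finset.sum_const_zero, Finset.sum_ite_eq',
      Finset.sum_ite_eq, Finset.mem_univ, if_true]
  have hc' : (T.map (counitTimes (omegaInv (k := k) (H := H)))).mulVec v = fun x =>
      (1 : Matrix ι ι k) x.1 p' * eta k H (a x.2.1 q' ⊗ₜ c x.2.2.1 x.2.2.2) := by
    funext ⟨x, y, m, n⟩
    simp only [hc.eta_apply, Matrix.mulVec, dotProduct, Fintype.sum_prod_type, v,
      Matrix.map_apply, T, hb.counit_apply,
      tmulMatrix, antipodeMatrix, counitTimes, LinearMap.comp_apply, TensorProduct.map_tmul,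
      LinearMap.mul'_apply, Matrix.one_apply, mul_ite, ite_mul, mul_one, one_mul, mul_zero,
      zero_mul, Finset.sum_ite_irrel, Finset.sum_const_zero, Finset.sum_ite_eq',
      Finset.sum_ite_eq, Finset.mem_univ, if_true]
  have := congrFun (congrArg (Matrix.mulVec · v) hw) (p, q, i, j)
  simp only [← Matrix.mulVec_mulVec, hL, hF, hc'] at this
  simp only [Matrix.mulVec, dotProduct, Fintype.sum_prod_type, Matrix.map_apply, T,
      tmulMatrix, antipodeMatrix, timesCounit, mulMiddle, LinearMap.comp_apply,
      TensorProduct.map_tmul, LinearMap.lTensor_tmul, LinearMap.rTensor_tmul, LinearEquiv.coe_coe,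
      TensorProduct.assoc_symm_tmul, counit_S, hc.counit_apply,
      LinearMap.mul'_apply, Matrix.one_apply, mul_ite, ite_mul, mul_one, one_mul, mul_zero,
      zero_mul, Finset.sum_ite_irrel, Finset.sum_const_zero, Finset.sum_ite_eq',
      Finset.sum_ite_eq, Finset.mem_univ, if_true] at this
  exact this

/-- In Sweedler form: `ζ(b₁c₁, c₃) η(b₂, c₂) = ε(b) ε(c)`, so that `ζ` undoes a contraction with
`η`. The cocycle condition at `(b, c, S(c), c)` is contracted with `α` on the left and `β` on the
right. Each antipode axiom removes one factor, and what remains is `IsComatrix.sum_zeta`. -/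
theorem sum_zeta_mul_eta {b : Matrix ι ι H} {c : Matrix l l H} (hb : IsComatrix k b)
    (hc : IsComatrix k c) (p p' : ι) (i j : l) :
    ∑ p'', ∑ i'', ∑ j'', zeta k H ((b p p'' * c i i'') ⊗ₜ c j'' j) *
        eta k H (b p'' p' ⊗ₜ c i'' j'') =
      (1 : Matrix ι ι k) p p' * (1 : Matrix l l k) i j := by
  have hT := hb.tmul (hc.tmul (hc.antipode.tmul hc))
  set T := tmulMatrix (k := k) b (tmulMatrix (k := k) c (tmulMatrix (k := k)
    (antipodeMatrix k c) c)) with T_def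
  have hw := congrArg (fun f => T.map f.ofConv) (mulFirst_mul_timesCounit k H)
  simp only [hT.map_convMul] at hw
  -- The row vector `u` places `α` on the slots `S(c)`, `c`. The column vector `v` places `β` on the
  -- slots `c`, `S(c)`.
  let u : ι × l × l × l → k := fun x =>
    (1 : Matrix ι ι k) p x.1 * (1 : Matrix l l k) i x.2.1 * alpha (c x.2.2.1 x.2.2.2)
  let v : ι × l × l × l → k := fun x =>
    (1 : Matrix ι ι k) x.1 p' * (1 : Matrix l l k) x.2.2.2 j * beta (c x.2.1 x.2.2.1)
  have h1 : Matrix.vecMul u (T.map (omega ∘ₗ mulFirst k H)) = fun x =>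
      zeta k H ((b p x.1 * c i x.2.1) ⊗ₜ c x.2.2.1 x.2.2.2) := by
    funext ⟨x, y, m, n⟩
    simp only [hc.zeta_apply, u, mulFirst, Matrix.mulVec, Matrix.vecMul, dotProduct, Fintype.sum_prod_type,
      Matrix.map_apply, T, tmulMatrix, antipodeMatrix, LinearMap.comp_apply,
      TensorProduct.map_tmul, LinearMap.lTensor_tmul, LinearMap.rTensor_tmul, LinearEquiv.coe_coe,
      TensorProduct.assoc_symm_tmul, LinearMap.mul'_apply, counit_S, Matrix.one_apply, mul_ite,
      ite_mul, mul_one, one_mul, mul_zero, zero_mul, Finset.sum_ite_irrel, Finset.sum_const_zero,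
      Finset.sum_ite_eq', Finset.sum_ite_eq, Finset.mem_univ, if_true]
  have h2 : (T.map (timesCounit (omegaInv (k := k) (H := H)))).mulVec v = fun x =>
      eta k H (b x.1 p' ⊗ₜ c x.2.1 x.2.2.1) * (1 : Matrix l l k) x.2.2.2 j := by
    funext ⟨x, y, m, n⟩
    simp only [hc.eta_apply, v, timesCounit, hc.counit_apply, Matrix.mulVec, Matrix.vecMul, dotProduct, Fintype.sum_prod_type,
      Matrix.map_apply, T, tmulMatrix, antipodeMatrix, LinearMap.comp_apply,
      TensorProduct.map_tmul, LinearMap.lTensor_tmul, LinearMap.rTensor_tmul, LinearEquiv.coe_coe,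
      TensorProduct.assoc_symm_tmul, LinearMap.mul'_apply, counit_S, Matrix.one_apply, mul_ite,
      ite_mul, mul_one, one_mul, mul_zero, zero_mul, Finset.sum_ite_irrel, Finset.sum_const_zero,
      Finset.sum_ite_eq', Finset.sum_ite_eq, Finset.mem_univ, if_true]
  have h3 : Matrix.vecMul u (T.map (omegaInv ∘ₗ mulLast k H)) = u := by
    funext ⟨x, y, m, n⟩
    have := congrArg (fun t => omegaInv (k := k) (b p x ⊗ₜ (c i y ⊗ₜ t))) (hc.sum_S_alpha m n)
    simp only [TensorProduct.tmul_sum, map_sum, TensorProduct.tmul_smul, map_smul,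
      omegaInv_one_right, hb.counit_apply, hc.counit_apply, Matrix.one_apply, smul_eq_mul] at this
    simp only [u, mulLast, this, Matrix.mulVec, Matrix.vecMul, dotProduct, Fintype.sum_prod_type,
      Matrix.map_apply, T, tmulMatrix, antipodeMatrix, LinearMap.comp_apply,
      TensorProduct.map_tmul, LinearMap.lTensor_tmul, LinearMap.rTensor_tmul, LinearEquiv.coe_coe,
      TensorProduct.assoc_symm_tmul, LinearMap.mul'_apply, counit_S, Matrix.one_apply, mul_ite,
      ite_mul, mul_one, one_mul, mul_zero, zero_mul, Finset.sum_ite_irrel, Finset.sum_const_zero,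
      Finset.sum_ite_eq', Finset.sum_ite_eq, Finset.mem_univ, if_true]
  have h4 : (T.map (omega ∘ₗ mulMiddle k H)).mulVec v = v := by
    funext ⟨x, y, m, n⟩
    have := congrArg (fun t => omega (k := k) (b x p' ⊗ₜ (t ⊗ₜ c n j))) (hc.sum_beta_S y m)
    simp only [TensorProduct.tmul_sum, TensorProduct.sum_tmul, map_sum, TensorProduct.tmul_smul,
      ← TensorProduct.smul_tmul', map_smul,
      omega_one_middle, hb.counit_apply, hc.counit_apply, Matrix.one_apply, smul_eq_mul,
      mul_comm (beta _)] at this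
    simp only [v, mulMiddle, this, Matrix.mulVec, Matrix.vecMul, dotProduct, Fintype.sum_prod_type,
      Matrix.map_apply, T, tmulMatrix, antipodeMatrix, LinearMap.comp_apply,
      TensorProduct.map_tmul, LinearMap.lTensor_tmul, LinearMap.rTensor_tmul, LinearEquiv.coe_coe,
      TensorProduct.assoc_symm_tmul, LinearMap.mul'_apply, counit_S, Matrix.one_apply, mul_ite,
      ite_mul, mul_one, one_mul, mul_zero, zero_mul, Finset.sum_ite_irrel, Finset.sum_const_zero,
      Finset.sum_ite_eq', Finset.sum_ite_eq, Finset.mem_univ, if_true]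
  have h5 : Matrix.vecMul u (T.map (counitTimes (omega (k := k) (H := H)))) = fun x =>
      (1 : Matrix ι ι k) p x.1 * zeta k H (c i x.2.1 ⊗ₜ c x.2.2.1 x.2.2.2) := by
    funext ⟨x, y, m, n⟩
    simp only [hc.zeta_apply, u, counitTimes, hb.counit_apply, Matrix.mulVec, Matrix.vecMul, dotProduct, Fintype.sum_prod_type,
      Matrix.map_apply, T, tmulMatrix, antipodeMatrix, LinearMap.comp_apply,
      TensorProduct.map_tmul, LinearMap.lTensor_tmul, LinearMap.rTensor_tmul, LinearEquiv.coe_coe,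
      TensorProduct.assoc_symm_tmul, LinearMap.mul'_apply, counit_S, Matrix.one_apply, mul_ite,
      ite_mul, mul_one, one_mul, mul_zero, zero_mul, Finset.sum_ite_irrel, Finset.sum_const_zero,
      Finset.sum_ite_eq', Finset.sum_ite_eq, Finset.mem_univ, if_true]
  have := congrArg (fun M => dotProduct u (Matrix.mulVec M v)) hw
  simp only [← Matrix.mulVec_mulVec, Matrix.dotProduct_mulVec] at this
  rw [← Matrix.dotProduct_mulVec _ _ v, ← Matrix.dotProduct_mulVec _ _ v, h1, h2, h3, h4, h5] at this
  have hz := hc.sum_zeta i j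
  simp only [v, Matrix.mulVec, Matrix.vecMul, dotProduct, Fintype.sum_prod_type,
      Matrix.map_apply, T, tmulMatrix, antipodeMatrix, LinearMap.comp_apply,
      TensorProduct.map_tmul, LinearMap.lTensor_tmul, LinearMap.rTensor_tmul, LinearEquiv.coe_coe,
      TensorProduct.assoc_symm_tmul, LinearMap.mul'_apply, counit_S, Matrix.one_apply, mul_ite,
      ite_mul, mul_one, one_mul, mul_zero, zero_mul, Finset.sum_ite_irrel, Finset.sum_const_zero,
      Finset.sum_ite_eq', Finset.sum_ite_eq, Finset.mem_univ, if_true] at this hz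
  rw [this]
  rw [hz, Matrix.one_apply, Matrix.one_apply]
  split_ifs <;> simp

/-- Only `ω * ω⁻¹ = 1` at `(b, c, S(c))` is needed, applied to the vector given by `β`. -/
theorem sum_omega_mul_eta_antipode {b : Matrix ι ι H} {c : Matrix l l H} (hb : IsComatrix k b)
    (hc : IsComatrix k c) (p p' : ι) (i j : l) :
    ∑ p'', ∑ i'', ∑ j'', omega (k := k) (b p p'' ⊗ₜ (c i i'' ⊗ₜ S (k := k) (c j'' j))) *
        eta k H (b p'' p' ⊗ₜ c i'' j'') =
      (1 : Matrix ι ι k) p p' * beta (k := k) (c i j) := by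
  have hT := hb.tmul (hc.tmul hc.antipode)
  set T := tmulMatrix (k := k) b (tmulMatrix (k := k) c (antipodeMatrix k c)) with T_def
  have hw := congrArg (fun f => T.map f.ofConv) (omega_mul_omegaInv (k := k) (H := H))
  simp only [hT.map_convMul, hT.map_one] at hw
  let v : ι × l × l → k := fun x => (1 : Matrix ι ι k) x.1 p' * beta (c x.2.1 x.2.2)
  have h2 : (T.map (omegaInv (k := k) (H := H))).mulVec v = fun x =>
      eta k H (b x.1 p' ⊗ₜ c x.2.1 x.2.2) := by
    funext ⟨x, y, m⟩
    simp only [hc.eta_apply, v, Matrix.mulVec, Matrix.vecMul, dotProduct, Fintype.sum_prod_type,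
      Matrix.map_apply, T, tmulMatrix, antipodeMatrix, LinearMap.comp_apply,
      TensorProduct.map_tmul, LinearMap.lTensor_tmul, LinearMap.rTensor_tmul, LinearEquiv.coe_coe,
      TensorProduct.assoc_symm_tmul, LinearMap.mul'_apply, counit_S, Matrix.one_apply, mul_ite,
      ite_mul, mul_one, one_mul, mul_zero, zero_mul, Finset.sum_ite_irrel, Finset.sum_const_zero,
      Finset.sum_ite_eq', Finset.sum_ite_eq, Finset.mem_univ, if_true]
  have := congrFun (congrArg (Matrix.mulVec · v) hw) (p, i, j)
  simp only [← Matrix.mulVec_mulVec, h2, Matrix.one_mulVec] at this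
  exact Eq.trans (by simp only [antipodeMatrix, Matrix.mulVec, Matrix.vecMul, dotProduct, Fintype.sum_prod_type,
      Matrix.map_apply, T, tmulMatrix, antipodeMatrix, LinearMap.comp_apply,
      TensorProduct.map_tmul, LinearMap.lTensor_tmul, LinearMap.rTensor_tmul, LinearEquiv.coe_coe,
      TensorProduct.assoc_symm_tmul, LinearMap.mul'_apply, counit_S, Matrix.one_apply, mul_ite,
      ite_mul, mul_one, one_mul, mul_zero, zero_mul, Finset.sum_ite_irrel, Finset.sum_const_zero,
      Finset.sum_ite_eq', Finset.sum_ite_eq, Finset.mem_univ, if_true]) this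

/-- The hypothesis on `t` expresses coinvariance of an element with coefficients `t` in a product of
two comodules. It replaces the axiom for `β` in collapsing the slots `c`, `x`, while `α` collapses
the slots `S(c)`, `c`. The source is the cocycle condition at `(S(c), c, x, d)`. -/
theorem sum_chi_mul_omega {c : Matrix ι ι H} {x : Matrix κ κ H} {d : Matrix l l H}
    (hc : IsComatrix k c) (hx : IsComatrix k x) (hd : IsComatrix k d) {t : ι → κ → k}
    (ht : ∀ j m, ∑ j', ∑ m', t j' m' • (c j j' * x m m') = t j m • (1 : H)) (i : ι) (m : κ)
    (n n' : l) :
    ∑ j', ∑ m', chi k H (c i j' ⊗ₜ x m m') * (t j' m' * (1 : Matrix l l k) n n') =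
      ∑ j', ∑ m', ∑ n'', chi k H (c i j' ⊗ₜ (x m m' * d n n'')) *
        ∑ j'', ∑ m'', omega (k := k) (c j' j'' ⊗ₜ (x m' m'' ⊗ₜ d n'' n')) * t j'' m'' := by
  have hT := hc.antipode.tmul (hc.tmul (hx.tmul hd))
  set T := tmulMatrix (k := k) (antipodeMatrix k c) (tmulMatrix (k := k) c (tmulMatrix (k := k)
    x d)) with T_def
  have hw := congrArg (fun f => T.map f.ofConv) (mulFirst_mul_timesCounit k H)
  simp only [hT.map_convMul] at hw
  let u : ι × ι × κ × l → k := fun y =>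
    (1 : Matrix κ κ k) m y.2.2.1 * (1 : Matrix l l k) n y.2.2.2 * alpha (c y.1 y.2.1)
  let v : ι × ι × κ × l → k := fun y =>
    (1 : Matrix ι ι k) i y.1 * (1 : Matrix l l k) y.2.2.2 n' * t y.2.1 y.2.2.1
  have h1 : Matrix.vecMul u (T.map (omega ∘ₗ mulFirst k H)) = u := by
    funext ⟨y, z, m', n'⟩
    have := congrArg (fun t => omega (k := k) (t ⊗ₜ (x m m' ⊗ₜ d n n'))) (hc.sum_S_alpha y z)
    simp only [TensorProduct.sum_tmul, map_sum, ← TensorProduct.smul_tmul', map_smul,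
      omega_one_left, hx.counit_apply, hd.counit_apply, Matrix.one_apply, smul_eq_mul] at this
    simp only [u, mulFirst, this, Matrix.mulVec, Matrix.vecMul, dotProduct, Fintype.sum_prod_type,
      Matrix.map_apply, T, tmulMatrix, antipodeMatrix, LinearMap.comp_apply,
      TensorProduct.map_tmul, LinearMap.lTensor_tmul, LinearMap.rTensor_tmul, LinearEquiv.coe_coe,
      TensorProduct.assoc_symm_tmul, LinearMap.mul'_apply, counit_S, Matrix.one_apply, mul_ite,
      ite_mul, mul_one, one_mul, mul_zero, zero_mul, Finset.sum_ite_irrel, Finset.sum_const_zero,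
      Finset.sum_ite_eq', Finset.sum_ite_eq, Finset.mem_univ, if_true]
  have h2 : Matrix.vecMul u (T.map (timesCounit (omegaInv (k := k) (H := H)))) = fun y =>
      chi k H (c y.1 y.2.1 ⊗ₜ x m y.2.2.1) * (1 : Matrix l l k) n y.2.2.2 := by
    funext ⟨y, z, m', n'⟩
    simp only [hc.chi_apply, u, timesCounit, hd.counit_apply, Matrix.mulVec, Matrix.vecMul, dotProduct, Fintype.sum_prod_type,
      Matrix.map_apply, T, tmulMatrix, antipodeMatrix, LinearMap.comp_apply,
      TensorProduct.map_tmul, LinearMap.lTensor_tmul, LinearMap.rTensor_tmul, LinearEquiv.coe_coe,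
      TensorProduct.assoc_symm_tmul, LinearMap.mul'_apply, counit_S, Matrix.one_apply, mul_ite,
      ite_mul, mul_one, one_mul, mul_zero, zero_mul, Finset.sum_ite_irrel, Finset.sum_const_zero,
      Finset.sum_ite_eq', Finset.sum_ite_eq, Finset.mem_univ, if_true]
  have h3 : Matrix.vecMul u (T.map (omegaInv ∘ₗ mulLast k H)) = fun y =>
      chi k H (c y.1 y.2.1 ⊗ₜ (x m y.2.2.1 * d n y.2.2.2)) := by
    funext ⟨y, z, m', n'⟩
    simp only [hc.chi_apply, u, mulLast, Matrix.mulVec, Matrix.vecMul, dotProduct, Fintype.sum_prod_type,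
      Matrix.map_apply, T, tmulMatrix, antipodeMatrix, LinearMap.comp_apply,
      TensorProduct.map_tmul, LinearMap.lTensor_tmul, LinearMap.rTensor_tmul, LinearEquiv.coe_coe,
      TensorProduct.assoc_symm_tmul, LinearMap.mul'_apply, counit_S, Matrix.one_apply, mul_ite,
      ite_mul, mul_one, one_mul, mul_zero, zero_mul, Finset.sum_ite_irrel, Finset.sum_const_zero,
      Finset.sum_ite_eq', Finset.sum_ite_eq, Finset.mem_univ, if_true]
  have h4 : (T.map (omega ∘ₗ mulMiddle k H)).mulVec v = v := by
    funext ⟨y, z, m', n''⟩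
    have := congrArg (fun t => omega (k := k) (S (k := k) (c i y) ⊗ₜ (t ⊗ₜ d n'' n'))) (ht z m')
    simp only [TensorProduct.tmul_sum, TensorProduct.sum_tmul, map_sum, TensorProduct.tmul_smul,
      ← TensorProduct.smul_tmul', map_smul, counit_S,
      omega_one_middle, hd.counit_apply, hc.counit_apply, Matrix.one_apply, smul_eq_mul,
      mul_comm (t _ _)] at this
    simp only [v, mulMiddle, this, Matrix.mulVec, Matrix.vecMul, dotProduct, Fintype.sum_prod_type,
      Matrix.map_apply, T, tmulMatrix, antipodeMatrix, LinearMap.comp_apply,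
      TensorProduct.map_tmul, LinearMap.lTensor_tmul, LinearMap.rTensor_tmul, LinearEquiv.coe_coe,
      TensorProduct.assoc_symm_tmul, LinearMap.mul'_apply, counit_S, Matrix.one_apply, mul_ite,
      ite_mul, mul_one, one_mul, mul_zero, zero_mul, Finset.sum_ite_irrel, Finset.sum_const_zero,
      Finset.sum_ite_eq', Finset.sum_ite_eq, Finset.mem_univ, if_true]
  have h5 : (T.map (counitTimes (omega (k := k) (H := H)))).mulVec v = fun y =>
      (1 : Matrix ι ι k) i y.1 *
        ∑ j'', ∑ m'', omega (k := k) (c y.2.1 j'' ⊗ₜ (x y.2.2.1 m'' ⊗ₜ d y.2.2.2 n')) * t j'' m'' := by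
    funext ⟨y, z, m', n''⟩
    simp only [v, counitTimes, hc.counit_apply, Matrix.mulVec, Matrix.vecMul, dotProduct, Fintype.sum_prod_type,
      Matrix.map_apply, T, tmulMatrix, antipodeMatrix, LinearMap.comp_apply,
      TensorProduct.map_tmul, LinearMap.lTensor_tmul, LinearMap.rTensor_tmul, LinearEquiv.coe_coe,
      TensorProduct.assoc_symm_tmul, LinearMap.mul'_apply, counit_S, Matrix.one_apply, mul_ite,
      ite_mul, mul_one, one_mul, mul_zero, zero_mul, Finset.sum_ite_irrel, Finset.sum_const_zero,
      Finset.sum_ite_eq', Finset.sum_ite_eq, Finset.mem_univ, if_true]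
  have := congrArg (fun M => dotProduct u (Matrix.mulVec M v)) hw
  simp only [← Matrix.mulVec_mulVec, h4, h5] at this
  rw [Matrix.dotProduct_mulVec, Matrix.dotProduct_mulVec, Matrix.dotProduct_mulVec, h1, h2, h3] at this
  simp only [v, Matrix.mulVec, Matrix.vecMul, dotProduct, Fintype.sum_prod_type,
      Matrix.map_apply, T, tmulMatrix, antipodeMatrix, LinearMap.comp_apply,
      TensorProduct.map_tmul, LinearMap.lTensor_tmul, LinearMap.rTensor_tmul, LinearEquiv.coe_coe,
      TensorProduct.assoc_symm_tmul, LinearMap.mul'_apply, counit_S, Matrix.one_apply, mul_ite,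
      ite_mul, mul_one, one_mul, mul_zero, zero_mul, Finset.sum_ite_irrel, Finset.sum_const_zero,
      Finset.sum_ite_eq', Finset.sum_ite_eq, Finset.mem_univ, if_true] at this
  simp only [u, Matrix.mulVec, Matrix.vecMul, dotProduct, Fintype.sum_prod_type,
      Matrix.map_apply, T, tmulMatrix, antipodeMatrix, LinearMap.comp_apply,
      TensorProduct.map_tmul, LinearMap.lTensor_tmul, LinearMap.rTensor_tmul, LinearEquiv.coe_coe,
      TensorProduct.assoc_symm_tmul, LinearMap.mul'_apply, counit_S, Matrix.one_apply, mul_ite,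
      ite_mul, mul_one, one_mul, mul_zero, zero_mul, Finset.sum_ite_irrel, Finset.sum_const_zero,
      Finset.sum_ite_eq', Finset.sum_ite_eq, Finset.mem_univ, if_true]
  exact this

/-- Contracting `χ` with `β` gives back the coefficients `t`. In the cocycle condition at `(c, S(c),
c, x)`, `β` sits on the first two slots, `α` on the middle two and `t` on the last two. All products
collapse, and `IsComatrix.sum_zeta` finishes. -/
theorem sum_chi_mul_beta {c : Matrix ι ι H} {x : Matrix κ κ H} (hc : IsComatrix k c)
    (hx : IsComatrix k x) {t : ι → κ → k}
    (ht : ∀ j m, ∑ j', ∑ m', t j' m' • (c j j' * x m m') = t j m • (1 : H)) (i : ι) (n : κ) :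
    ∑ j, ∑ m, ∑ n', chi k H (c j m ⊗ₜ x n n') * (beta (c i j) * t m n') = t i n := by
  have hT := hc.tmul (hc.antipode.tmul (hc.tmul hx))
  set T := tmulMatrix (k := k) c (tmulMatrix (k := k) (antipodeMatrix k c) (tmulMatrix (k := k)
    c x)) with T_def
  have hw := congrArg (fun f => T.map f.ofConv) (counitTimes_mul_mulLast_mul_mulFirst k H)
  simp only [hT.map_convMul] at hw
  let u : ι × ι × ι × κ → k := fun y =>
    (1 : Matrix ι ι k) i y.1 * (1 : Matrix κ κ k) n y.2.2.2 * alpha (c y.2.1 y.2.2.1)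
  let v : ι × ι × ι × κ → k := fun y => beta (c y.1 y.2.1) * t y.2.2.1 y.2.2.2
  have h1 : (T.map (omega ∘ₗ mulFirst k H)).mulVec v = v := by
    funext ⟨y, z, m, n⟩
    have hh : ∀ m' n', ∑ y', ∑ z', omega (k := k) ((c y y' * S (k := k) (c z' z)) ⊗ₜ
        (c m m' ⊗ₜ x n n')) * beta (c y' z') = beta (c y z) * ((1 : Matrix ι ι k) m m' *
        (1 : Matrix κ κ k) n n') := by
      intro m' n'
      have := congrArg (fun t => omega (k := k) (t ⊗ₜ (c m m' ⊗ₜ x n n'))) (hc.sum_beta_S y z)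
      simpa only [TensorProduct.sum_tmul, map_sum, ← TensorProduct.smul_tmul', map_smul,
        omega_one_left, hx.counit_apply, hc.counit_apply, smul_eq_mul, mul_comm (beta _)]
        using this
    simp only [Matrix.mulVec, dotProduct, Fintype.sum_prod_type, mulFirst, v, Matrix.map_apply, T, tmulMatrix, antipodeMatrix, LinearMap.comp_apply,
      TensorProduct.map_tmul, LinearMap.lTensor_tmul, LinearMap.rTensor_tmul, LinearEquiv.coe_coe,
      TensorProduct.assoc_symm_tmul, LinearMap.mul'_apply]
    rw [sum_rotate₄, sum_rotate₄]
    simp only [← mul_assoc, ← Finset.sum_mul, hh]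
    simp [Matrix.one_apply]
  have h2 : (T.map (omega ∘ₗ mulLast k H)).mulVec v = v := by
    funext ⟨y, z, m, n⟩
    have hh : ∀ y' z', ∑ m', ∑ n', omega (k := k) (c y y' ⊗ₜ (S (k := k) (c z' z) ⊗ₜ
        (c m m' * x n n'))) * t m' n' = t m n * ((1 : Matrix ι ι k) y y' *
        (1 : Matrix ι ι k) z' z) := by
      intro y' z'
      have := congrArg (fun t => omega (k := k) (c y y' ⊗ₜ (S (k := k) (c z' z) ⊗ₜ t))) (ht m n)
      simpa only [TensorProduct.tmul_sum, map_sum, TensorProduct.tmul_smul, map_smul, counit_S,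
        omega_one_right, hc.counit_apply, smul_eq_mul, mul_comm (t _ _)] using this
    simp only [Matrix.mulVec, dotProduct, Fintype.sum_prod_type, mulLast, v, Matrix.map_apply, T, tmulMatrix, antipodeMatrix, LinearMap.comp_apply,
      TensorProduct.map_tmul, LinearMap.lTensor_tmul, LinearMap.rTensor_tmul, LinearEquiv.coe_coe,
      TensorProduct.assoc_symm_tmul, LinearMap.mul'_apply]
    simp only [mul_left_comm _ (beta _), ← Finset.mul_sum, hh]
    simp [Matrix.one_apply, mul_comm]
  have h3 : Matrix.vecMul u (T.map (counitTimes (omegaInv (k := k) (H := H)))) = fun y =>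
      (1 : Matrix ι ι k) i y.1 * chi k H (c y.2.1 y.2.2.1 ⊗ₜ x n y.2.2.2) := by
    funext ⟨y, z, m', n'⟩
    simp only [hc.chi_apply, u, counitTimes, hc.counit_apply, Matrix.mulVec, Matrix.vecMul, dotProduct, Fintype.sum_prod_type,
      Matrix.map_apply, T, tmulMatrix, antipodeMatrix, LinearMap.comp_apply,
      TensorProduct.map_tmul, LinearMap.lTensor_tmul, LinearMap.rTensor_tmul, LinearEquiv.coe_coe,
      TensorProduct.assoc_symm_tmul, LinearMap.mul'_apply, counit_S, Matrix.one_apply, mul_ite,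
      ite_mul, mul_one, one_mul, mul_zero, zero_mul, Finset.sum_ite_irrel, Finset.sum_const_zero,
      Finset.sum_ite_eq', Finset.sum_ite_eq, Finset.mem_univ, if_true]
  have h4 : Matrix.vecMul u (T.map (omega ∘ₗ mulMiddle k H)) = u := by
    funext ⟨y, z, m', n'⟩
    have := congrArg (fun t => omega (k := k) (c i y ⊗ₜ (t ⊗ₜ x n n'))) (hc.sum_S_alpha z m')
    simp only [TensorProduct.tmul_sum, TensorProduct.sum_tmul, map_sum, TensorProduct.tmul_smul,
      ← TensorProduct.smul_tmul', map_smul, counit_S,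
      omega_one_middle, hx.counit_apply, hc.counit_apply, Matrix.one_apply, smul_eq_mul] at this
    simp only [u, mulMiddle, this, Matrix.mulVec, Matrix.vecMul, dotProduct, Fintype.sum_prod_type,
      Matrix.map_apply, T, tmulMatrix, antipodeMatrix, LinearMap.comp_apply,
      TensorProduct.map_tmul, LinearMap.lTensor_tmul, LinearMap.rTensor_tmul, LinearEquiv.coe_coe,
      TensorProduct.assoc_symm_tmul, LinearMap.mul'_apply, counit_S, Matrix.one_apply, mul_ite,
      ite_mul, mul_one, one_mul, mul_zero, zero_mul, Finset.sum_ite_irrel, Finset.sum_const_zero,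
      Finset.sum_ite_eq', Finset.sum_ite_eq, Finset.mem_univ, if_true]
  have h5 : Matrix.vecMul u (T.map (timesCounit (omega (k := k) (H := H)))) = fun y =>
      zeta k H (c i y.1 ⊗ₜ c y.2.1 y.2.2.1) * (1 : Matrix κ κ k) n y.2.2.2 := by
    funext ⟨y, z, m', n'⟩
    simp only [hc.zeta_apply, u, timesCounit, hx.counit_apply, Matrix.mulVec, Matrix.vecMul, dotProduct, Fintype.sum_prod_type,
      Matrix.map_apply, T, tmulMatrix, antipodeMatrix, LinearMap.comp_apply,
      TensorProduct.map_tmul, LinearMap.lTensor_tmul, LinearMap.rTensor_tmul, LinearEquiv.coe_coe,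
      TensorProduct.assoc_symm_tmul, LinearMap.mul'_apply, counit_S, Matrix.one_apply, mul_ite,
      ite_mul, mul_one, one_mul, mul_zero, zero_mul, Finset.sum_ite_irrel, Finset.sum_const_zero,
      Finset.sum_ite_eq', Finset.sum_ite_eq, Finset.mem_univ, if_true]
  have := congrArg (fun M => dotProduct u (Matrix.mulVec M v)) hw
  simp only [← Matrix.mulVec_mulVec, h1, h2] at this
  rw [Matrix.dotProduct_mulVec, Matrix.dotProduct_mulVec, Matrix.dotProduct_mulVec, h3, h4, h5] at this
  simp only [v, Matrix.mulVec, Matrix.vecMul, dotProduct, Fintype.sum_prod_type,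
      Matrix.map_apply, T, tmulMatrix, antipodeMatrix, LinearMap.comp_apply,
      TensorProduct.map_tmul, LinearMap.lTensor_tmul, LinearMap.rTensor_tmul, LinearEquiv.coe_coe,
      TensorProduct.assoc_symm_tmul, LinearMap.mul'_apply, counit_S, Matrix.one_apply, mul_ite,
      ite_mul, mul_one, one_mul, mul_zero, zero_mul, Finset.sum_ite_irrel, Finset.sum_const_zero,
      Finset.sum_ite_eq', Finset.sum_ite_eq, Finset.mem_univ, if_true] at this
  refine this.trans ?_
  rw [← sum_rotate₃]
  simp only [← mul_assoc, ← Finset.sum_mul, hc.sum_zeta]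
  simp [Matrix.one_apply]

/-- Quasi-associativity at `(b, c, S(c))`, contracted with `β`: the product `b (c S(c))` collapses
to `b`. Vectors are compared through functionals, since the available identity is scalar valued. -/
theorem sum_eta_smul_mul {b : Matrix ι ι H} {c : Matrix l l H} (hb : IsComatrix k b)
    (hc : IsComatrix k c) (p p' : ι) (i j : l) :
    ∑ p'', ∑ i'', ∑ j'', eta k H (b p'' p' ⊗ₜ c i'' j'') •
        ((b p p'' * c i i'') * S (k := k) (c j'' j)) =
      ∑ p'', eta k H (b p p'' ⊗ₜ c i j) • b p'' p' := by
  refine eq_of_forall_dual (k := k) fun φ => ?_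
  have hT := hb.tmul (hc.tmul hc.antipode)
  set T := tmulMatrix (k := k) b (tmulMatrix (k := k) c (antipodeMatrix k c)) with T_def
  have hw := congrArg (fun f => T.map f.ofConv) (quasi_assoc_omegaInv k H φ)
  simp only [hT.map_convMul] at hw
  let v : ι × l × l → k := fun x => (1 : Matrix ι ι k) x.1 p' * beta (c x.2.1 x.2.2)
  have h1 : (T.map (omegaInv (k := k) (H := H))).mulVec v = fun x =>
      eta k H (b x.1 p' ⊗ₜ c x.2.1 x.2.2) := by
    funext ⟨x, y, m⟩
    simp only [hc.eta_apply, v, Matrix.mulVec, Matrix.vecMul, dotProduct, Fintype.sum_prod_type,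
      Matrix.map_apply, T, tmulMatrix, antipodeMatrix, LinearMap.comp_apply,
      TensorProduct.map_tmul, LinearMap.lTensor_tmul, LinearMap.rTensor_tmul, LinearEquiv.coe_coe,
      TensorProduct.assoc_symm_tmul, LinearMap.mul'_apply, counit_S, Matrix.one_apply, mul_ite,
      ite_mul, mul_one, one_mul, mul_zero, zero_mul, Finset.sum_ite_irrel, Finset.sum_const_zero,
      Finset.sum_ite_eq', Finset.sum_ite_eq, Finset.mem_univ, if_true]
  have h2 : (T.map (φ ∘ₗ mulRight₃ k H)).mulVec v = fun x =>
      φ (b x.1 p') * beta (c x.2.1 x.2.2) := by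
    funext ⟨x, y, m⟩
    have := congrArg (fun t => φ (b x p' * t)) (hc.sum_beta_S y m)
    simp only [Finset.mul_sum, map_sum, mul_smul_comm, map_smul, smul_eq_mul, mul_one,
      mul_comm (beta _)] at this
    simp only [v, mulRight₃, this, Matrix.mulVec, Matrix.vecMul, dotProduct, Fintype.sum_prod_type,
      Matrix.map_apply, T, tmulMatrix, antipodeMatrix, LinearMap.comp_apply,
      TensorProduct.map_tmul, LinearMap.lTensor_tmul, LinearMap.rTensor_tmul, LinearEquiv.coe_coe,
      TensorProduct.assoc_symm_tmul, LinearMap.mul'_apply, counit_S, Matrix.one_apply, mul_ite,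
      ite_mul, mul_one, one_mul, mul_zero, zero_mul, Finset.sum_ite_irrel, Finset.sum_const_zero,
      Finset.sum_ite_eq', Finset.sum_ite_eq, Finset.mem_univ, if_true]
  have := congrFun (congrArg (Matrix.mulVec · v) hw) (p, i, j)
  simp only [← Matrix.mulVec_mulVec, h1, h2] at this
  simp only [mulLeft₃, Matrix.mulVec, Matrix.vecMul, dotProduct, Fintype.sum_prod_type,
      Matrix.map_apply, T, tmulMatrix, antipodeMatrix, LinearMap.comp_apply,
      TensorProduct.map_tmul, LinearMap.lTensor_tmul, LinearMap.rTensor_tmul, LinearEquiv.coe_coe,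
      TensorProduct.assoc_symm_tmul, LinearMap.mul'_apply, counit_S, Matrix.one_apply, mul_ite,
      ite_mul, mul_one, one_mul, mul_zero, zero_mul, Finset.sum_ite_irrel, Finset.sum_const_zero,
      Finset.sum_ite_eq', Finset.sum_ite_eq, Finset.mem_univ, if_true] at this
  refine Eq.trans ?_ (this.trans ?_)
  · simp only [map_sum, map_smul, smul_eq_mul, mul_comm (eta k H _)]
  · simp only [map_sum, map_smul, smul_eq_mul, hc.eta_apply, Finset.sum_mul]
    exact Finset.sum_congr rfl fun _ _ => Finset.sum_congr rfl fun _ _ => Finset.sum_congr rfl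
      fun _ _ => by ring

/-- Quasi-associativity at `(S(c), c, x)`, with `α` on the left and `t` on the right. The products
`(S(c) c) x` and `S(c) (c x)` collapse to `x` and `S(c)`. This yields the coaction of the companion
map. -/
theorem sum_chi_smul_mul {c : Matrix ι ι H} {x : Matrix κ κ H} (hc : IsComatrix k c)
    (hx : IsComatrix k x) {t : ι → κ → k}
    (ht : ∀ j m, ∑ j', ∑ m', t j' m' • (c j j' * x m m') = t j m • (1 : H)) (i : ι) (m : κ) :
    ∑ m'', ∑ j', ∑ m', (chi k H (c i j' ⊗ₜ x m'' m') * t j' m') • x m m'' =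
      ∑ i', ∑ j', ∑ m', (chi k H (c i' j' ⊗ₜ x m m') * t j' m') • S (k := k) (c i i') := by
  refine eq_of_forall_dual (k := k) fun φ => ?_
  have hT := hc.antipode.tmul (hc.tmul hx)
  set T := tmulMatrix (k := k) (antipodeMatrix k c) (tmulMatrix (k := k) c x) with T_def
  have hw := congrArg (fun f => T.map f.ofConv) (quasi_assoc_omegaInv k H φ)
  simp only [hT.map_convMul] at hw
  let u : ι × ι × κ → k := fun y => (1 : Matrix κ κ k) m y.2.2 * alpha (c y.1 y.2.1)
  let v : ι × ι × κ → k := fun y => (1 : Matrix ι ι k) i y.1 * t y.2.1 y.2.2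
  have h1 : Matrix.vecMul u (T.map (φ ∘ₗ mulLeft₃ k H)) = fun y =>
      alpha (c y.1 y.2.1) * φ (x m y.2.2) := by
    funext ⟨y, z, n⟩
    have := congrArg (fun t => φ (t * x m n)) (hc.sum_S_alpha y z)
    simp only [Finset.sum_mul, map_sum, smul_mul_assoc, map_smul, smul_eq_mul, one_mul] at this
    simp only [u, mulLeft₃, this, Matrix.mulVec, Matrix.vecMul, dotProduct, Fintype.sum_prod_type,
      Matrix.map_apply, T, tmulMatrix, antipodeMatrix, LinearMap.comp_apply,
      TensorProduct.map_tmul, LinearMap.lTensor_tmul, LinearMap.rTensor_tmul, LinearEquiv.coe_coe,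
      TensorProduct.assoc_symm_tmul, LinearMap.mul'_apply, counit_S, Matrix.one_apply, mul_ite,
      ite_mul, mul_one, one_mul, mul_zero, zero_mul, Finset.sum_ite_irrel, Finset.sum_const_zero,
      Finset.sum_ite_eq', Finset.sum_ite_eq, Finset.mem_univ, if_true]
  have h2 : Matrix.vecMul u (T.map (omegaInv (k := k) (H := H))) = fun y =>
      chi k H (c y.1 y.2.1 ⊗ₜ x m y.2.2) := by
    funext ⟨y, z, n⟩
    simp only [hc.chi_apply, u, Matrix.mulVec, Matrix.vecMul, dotProduct, Fintype.sum_prod_type,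
      Matrix.map_apply, T, tmulMatrix, antipodeMatrix, LinearMap.comp_apply,
      TensorProduct.map_tmul, LinearMap.lTensor_tmul, LinearMap.rTensor_tmul, LinearEquiv.coe_coe,
      TensorProduct.assoc_symm_tmul, LinearMap.mul'_apply, counit_S, Matrix.one_apply, mul_ite,
      ite_mul, mul_one, one_mul, mul_zero, zero_mul, Finset.sum_ite_irrel, Finset.sum_const_zero,
      Finset.sum_ite_eq', Finset.sum_ite_eq, Finset.mem_univ, if_true]
  have h3 : (T.map (φ ∘ₗ mulRight₃ k H)).mulVec v = fun y =>
      φ (S (k := k) (c i y.1)) * t y.2.1 y.2.2 := by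
    funext ⟨y, z, n⟩
    have := congrArg (fun t => φ (S (k := k) (c i y) * t)) (ht z n)
    simp only [Finset.mul_sum, map_sum, mul_smul_comm, map_smul, smul_eq_mul, mul_one,
      mul_comm (t _ _)] at this
    simp only [v, mulRight₃, this, Matrix.mulVec, Matrix.vecMul, dotProduct, Fintype.sum_prod_type,
      Matrix.map_apply, T, tmulMatrix, antipodeMatrix, LinearMap.comp_apply,
      TensorProduct.map_tmul, LinearMap.lTensor_tmul, LinearMap.rTensor_tmul, LinearEquiv.coe_coe,
      TensorProduct.assoc_symm_tmul, LinearMap.mul'_apply, counit_S, Matrix.one_apply, mul_ite,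
      ite_mul, mul_one, one_mul, mul_zero, zero_mul, Finset.sum_ite_irrel, Finset.sum_const_zero,
      Finset.sum_ite_eq', Finset.sum_ite_eq, Finset.mem_univ, if_true]
  have h4 : Matrix.vecMul (fun y => alpha (c y.1 y.2.1) * φ (x m y.2.2) : ι × ι × κ → k)
      (T.map (omegaInv (k := k) (H := H))) = fun y =>
      ∑ n, φ (x m n) * chi k H (c y.1 y.2.1 ⊗ₜ x n y.2.2) := by
    funext ⟨y, z, n⟩
    simp only [hc.chi_apply, Matrix.mulVec, Matrix.vecMul, dotProduct, Fintype.sum_prod_type,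
      Matrix.map_apply, T, tmulMatrix, antipodeMatrix, LinearMap.comp_apply,
      TensorProduct.map_tmul, LinearMap.lTensor_tmul, LinearMap.rTensor_tmul, LinearEquiv.coe_coe,
      TensorProduct.assoc_symm_tmul, LinearMap.mul'_apply, counit_S, Matrix.one_apply, mul_ite,
      ite_mul, mul_one, one_mul, mul_zero, zero_mul, Finset.sum_ite_irrel, Finset.sum_const_zero,
      Finset.sum_ite_eq', Finset.sum_ite_eq, Finset.mem_univ, if_true, Finset.mul_sum]
    rw [← sum_rotate₃]
    exact Finset.sum_congr rfl fun _ _ => Finset.sum_congr rfl fun _ _ => Finset.sum_congr rfl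
      fun _ _ => by ring
  have := congrArg (fun M => dotProduct u (Matrix.mulVec M v)) hw
  simp only [← Matrix.mulVec_mulVec, h3] at this
  rw [Matrix.dotProduct_mulVec, Matrix.dotProduct_mulVec, Matrix.dotProduct_mulVec, h1, h2,
    h4] at this
  simp only [v, Matrix.mulVec, Matrix.vecMul, dotProduct, Fintype.sum_prod_type,
      Matrix.map_apply, T, tmulMatrix, antipodeMatrix, LinearMap.comp_apply,
      TensorProduct.map_tmul, LinearMap.lTensor_tmul, LinearMap.rTensor_tmul, LinearEquiv.coe_coe,
      TensorProduct.assoc_symm_tmul, LinearMap.mul'_apply, counit_S, Matrix.one_apply, mul_ite,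
      ite_mul, mul_one, one_mul, mul_zero, zero_mul, Finset.sum_ite_irrel, Finset.sum_const_zero,
      Finset.sum_ite_eq', Finset.sum_ite_eq, Finset.mem_univ, if_true] at this
  refine Eq.trans ?_ (this.trans ?_)
  · simp only [map_sum, map_smul, smul_eq_mul, Finset.sum_mul]
    rw [sum_rotate₃]
    exact Finset.sum_congr rfl fun _ _ => Finset.sum_congr rfl fun _ _ => Finset.sum_congr rfl
      fun _ _ => by ring
  · simp only [map_sum, map_smul, smul_eq_mul]
    exact Finset.sum_congr rfl fun _ _ => Finset.sum_congr rfl fun _ _ => Finset.sum_congr rfl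
      fun _ _ => by ring

end Identities

/-! ### Products and actions on comodule families -/

section Families

variable {k : Type w} {H : Type u} [Field k] [NonAssocRing H] [Module k H]
  [IsScalarTower k H H] [SMulCommClass k H H] [CoquasiBialgebra k H]
  {A : Type u} [NonAssocRing A] [Module k A] [IsScalarTower k A A] [SMulCommClass k A A]
  [ComoduleAlgebra k H A] {M : Type u} [AddCommGroup M] [Module k M] [RelHopfModule k H A M]
  {ι κ l μ : Type*} [Fintype ι] [DecidableEq ι] [Fintype κ] [DecidableEq κ] [Fintype l]
  [DecidableEq l] [Fintype μ] [DecidableEq μ]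

/-- A comodule algebra is a relative Hopf module over itself. -/
scoped instance regularHopfModule : RelHopfModule k H A A where
  __ := (inferInstance : RightComodule k H A)
  act := LinearMap.mul k A
  act_one := mul_one
  act_act := mul_quasi_assoc
  coact_act a b := by
    refine (coaction_mul (k := k) (H := H) a b).trans ?_
    change coaction k H A a * coaction k H A b = TensorProduct.map _ _
      (TensorProduct.tensorTensorTensorComm k A H A H (coaction k H A a ⊗ₜ coaction k H A b))
    generalize coaction k H A a = s
    generalize coaction k H A b = t
    induction s with
    | zero => simp
    | add x y hx hy => simp only [add_mul, TensorProduct.add_tmul, map_add, hx, hy]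
    | tmul x y =>
      induction t with
      | zero => simp
      | add x y hx hy => simp only [mul_add, TensorProduct.tmul_add, map_add, hx, hy]
      | tmul z w => simp

theorem hopfAct_self (a b : A) : hopfAct (k := k) H a b = a * b := rfl

variable {x : ι → M} {b : Matrix ι ι H} {y : κ → A} {a : Matrix κ κ H} {z : l → A}
  {c : Matrix l l H}

theorem isComoduleFamily_one :
    IsComoduleFamily k (fun _ : Unit => (1 : A)) (fun _ _ : Unit => (1 : H)) :=
  ⟨isComatrix_one, fun _ => by
    simpa using mem_coinvariants.1 (one_mem_coinvariants (k := k) (H := H) (A := A))⟩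

/-- The action is colinear, so products of families are again families and every formula for a
family applies to them. -/
theorem IsComoduleFamily.hopfAct_prod (hx : IsComoduleFamily k x b) (hy : IsComoduleFamily k y a) :
    IsComoduleFamily k (fun p : ι × κ => hopfAct (k := k) H (x p.1) (y p.2)) (mulMatrix b a) where
  isComatrix := hx.isComatrix.mul hy.isComatrix
  coaction_apply p := by
    rw [coaction_hopfAct, hx.coaction_apply, hy.coaction_apply, TensorProduct.sum_tmul, map_sum,
      map_sum, Fintype.sum_prod_type]
    refine Finset.sum_congr rfl fun _ _ => ?_
    rw [TensorProduct.tmul_sum, map_sum, map_sum]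
    rfl

theorem IsComoduleFamily.coaction_hopfAct_apply (hx : IsComoduleFamily k x b)
    (hy : IsComoduleFamily k y a) (p : ι) (q : κ) :
    coaction k H M (hopfAct (k := k) H (x p) (y q)) =
      ∑ p', ∑ q', hopfAct (k := k) H (x p') (y q') ⊗ₜ (b p' p * a q' q) := by
  rw [(hx.hopfAct_prod hy).coaction_apply (p, q), Fintype.sum_prod_type]
  rfl

theorem IsComoduleFamily.hopfAct_hopfAct_apply (hx : IsComoduleFamily k x b)
    (hy : IsComoduleFamily k y a) (hz : IsComoduleFamily k z c) (p : ι) (q : κ) (r : l) :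
    hopfAct (k := k) H (hopfAct (k := k) H (x p) (y q)) (z r) =
      ∑ p', ∑ q', ∑ r', CoquasiBialgebra.omega (k := k) (b p' p ⊗ₜ (a q' q ⊗ₜ c r' r)) •
        hopfAct (k := k) H (x p') (y q' * z r') := by
  rw [hopfAct_hopfAct, hx.coaction_apply, hy.coaction_apply, hz.coaction_apply]
  simp only [TensorProduct.sum_tmul, TensorProduct.tmul_sum, map_sum, omegaTwist_tmul]
  rw [sum_rotate₃, Finset.sum_comm]
  rfl

theorem IsComoduleFamily.mul_mul_apply {x : ι → A} (hx : IsComoduleFamily k x b)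
    (hy : IsComoduleFamily k y a) (hz : IsComoduleFamily k z c) (p : ι) (q : κ) (r : l) :
    (x p * y q) * z r =
      ∑ p', ∑ q', ∑ r', CoquasiBialgebra.omega (k := k) (b p' p ⊗ₜ (a q' q ⊗ₜ c r' r)) •
        (x p' * (y q' * z r')) :=
  hx.hopfAct_hopfAct_apply hy hz p q r

theorem IsComoduleFamily.coaction_mul_apply {x : ι → A} (hx : IsComoduleFamily k x b)
    (hy : IsComoduleFamily k y a) (p : ι) (q : κ) :
    coaction k H A (x p * y q) = ∑ p', ∑ q', (x p' * y q') ⊗ₜ (b p' p * a q' q) :=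
  hx.coaction_hopfAct_apply hy p q

theorem hopfAct_sum {σ : Type*} (s : Finset σ) (m : M) (f : σ → A) :
    hopfAct (k := k) H m (∑ i ∈ s, f i) =
      ∑ i ∈ s, hopfAct (k := k) H m (f i) := map_sum _ _ _

theorem sum_hopfAct {σ : Type*} (s : Finset σ) (f : σ → M) (a : A) :
    hopfAct (k := k) H (∑ i ∈ s, f i) a =
      ∑ i ∈ s, hopfAct (k := k) H (f i) a := by
  rw [CoquasiHopf.hopfAct, map_sum, LinearMap.sum_apply]

theorem hopfAct_smul (m : M) (r : k) (a : A) :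
    hopfAct (k := k) H m (r • a) = r • hopfAct (k := k) H m a :=
  map_smul _ _ _

theorem smul_hopfAct (m : M) (r : k) (a : A) :
    hopfAct (k := k) H (r • m) a = r • hopfAct (k := k) H m a := by
  rw [CoquasiHopf.hopfAct, map_smul, LinearMap.smul_apply]

theorem hopfAct_one (m : M) : hopfAct (k := k) H m (1 : A) = m :=
  RelHopfModule.act_one m

/-- A linear map `γ : H → A` with `ρ(γ(h)) = γ(h₁) ⊗ h₂`. -/
def IsColinear (γ : H →ₗ[k] A) : Prop :=
  ∀ h, coaction k H A (γ h) = LinearMap.rTensor H γ (Coalgebra.comul h)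

/-- A colinear map sends each row of a comatrix to a family. An anticolinear map does so for
columns, with the antipode matrix. -/
theorem IsColinear.isComoduleFamily {γ : H →ₗ[k] A} (hγ : IsColinear γ) (hc : IsComatrix k c)
    (i : l) : IsComoduleFamily k (fun j => γ (c i j)) c where
  isComatrix := hc
  coaction_apply j := by
    rw [hγ, hc.comul_apply, map_sum]
    rfl

end Families

/-! ### Cleaving maps and the projection onto coinvariants -/

section Cleft

open CoquasiBialgebra CoquasiHopfAlgebra

variable {k : Type w} {H : Type u} [Field k] [NonAssocRing H] [Module k H]
  [IsScalarTower k H H] [SMulCommClass k H H] [CoquasiHopfAlgebra k H]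
  {A : Type u} [NonAssocRing A] [Module k A] [IsScalarTower k A A] [SMulCommClass k A A]
  [ComoduleAlgebra k H A] {M : Type u} [AddCommGroup M] [Module k M] [RelHopfModule k H A M]
  {ι κ l μ : Type*} [Fintype ι] [DecidableEq ι] [Fintype κ] [DecidableEq κ] [Fintype l]
  [DecidableEq l] [Fintype μ] [DecidableEq μ]

/-- A linear map `δ : H → A` with `ρ(δ(h)) = δ(h₂) ⊗ S(h₁)`. -/
def IsAnticolinear (δ : H →ₗ[k] A) : Prop :=
  ∀ h, coaction k H A (δ h) =
      TensorProduct.map δ S (TensorProduct.comm k H H (Coalgebra.comul h))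

theorem IsAnticolinear.isComoduleFamily {δ : H →ₗ[k] A} (hδ : IsAnticolinear δ)
    {c : Matrix l l H} (hc : IsComatrix k c) (j : l) :
    IsComoduleFamily k (fun i => δ (c i j)) (antipodeMatrix k c) where
  isComatrix := hc.antipode
  coaction_apply i := by
    rw [hδ, hc.comul_apply, map_sum, map_sum]
    rfl

/-- The maps of a cleft extension. -/
structure IsCleaving (γ δ : H →ₗ[k] A) : Prop where
  colinear : IsColinear γ
  anticolinear : IsAnticolinear δ
  mul_left : ∀ h, LinearMap.mul' k A (TensorProduct.map δ γ (Coalgebra.comul h)) =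
      alpha (k := k) h • (1 : A)
  mul_right : ∀ h, LinearMap.mul' k A
        (TensorProduct.map (γ ∘ₗ hitLeft (beta (k := k) (H := H))) δ (Coalgebra.comul h)) =
      Coalgebra.counit (R := k) h • (1 : A)

theorem isCleft_iff : IsCleft k H A ↔ ∃ γ δ : H →ₗ[k] A, IsCleaving γ δ :=
  ⟨fun ⟨γ, δ, h1, h2, h3, h4⟩ => ⟨γ, δ, h1, h2, h3, h4⟩,
    fun ⟨γ, δ, h⟩ => ⟨γ, δ, h.1, h.2, h.3, h.4⟩⟩

theorem IsComatrix.mul_map {c : Matrix l l H} (hc : IsComatrix k c) (γ δ : H →ₗ[k] A) (i j : l) :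
    LinearMap.mul' k A (TensorProduct.map δ γ (Coalgebra.comul (c i j))) =
      ∑ m, δ (c i m) * γ (c m j) := by
  simp [hc.comul_apply]

theorem IsComatrix.mul_map_hitLeft {c : Matrix l l H} (hc : IsComatrix k c) (γ δ : H →ₗ[k] A)
    (i j : l) :
    LinearMap.mul' k A (TensorProduct.map (γ ∘ₗ hitLeft (beta (k := k) (H := H))) δ
      (Coalgebra.comul (c i j))) =
      ∑ m, ∑ n, beta (k := k) (c m n) • (γ (c i m) * δ (c n j)) := by
  rw [Finset.sum_comm]
  simp [hc.comul_apply, hc.hitLeft_apply, Finset.sum_mul, smul_mul_assoc]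

theorem IsCleaving.sum_mul_left {γ δ : H →ₗ[k] A} (h : IsCleaving γ δ) {c : Matrix l l H}
    (hc : IsComatrix k c) (i j : l) :
    ∑ m, δ (c i m) * γ (c m j) = alpha (k := k) (c i j) • (1 : A) := by
  rw [← h.mul_left, hc.mul_map]

theorem IsCleaving.sum_mul_right {γ δ : H →ₗ[k] A} (h : IsCleaving γ δ) {c : Matrix l l H}
    (hc : IsComatrix k c) (i j : l) :
    ∑ m, ∑ n, beta (k := k) (c m n) • (γ (c i m) * δ (c n j)) = (1 : Matrix l l k) i j • (1 : A) := by
  rw [← hc.counit_apply, ← h.mul_right, hc.mul_map_hitLeft]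

variable (M) in
/-- `m ↦ m₀ β(m₁) δ(m₂)`. -/
def coinvProj (δ : H →ₗ[k] A) : M →ₗ[k] M :=
  TensorProduct.lift (RelHopfModule.act (k := k) (H := H)) ∘ₗ
    LinearMap.lTensor M (δ ∘ₗ hitRight (beta (k := k) (H := H))) ∘ₗ coaction k H M

theorem IsComoduleFamily.coinvProj_apply {x : ι → M} {b : Matrix ι ι H}
    (hx : IsComoduleFamily k x b) (δ : H →ₗ[k] A) (j : ι) :
    coinvProj M δ (x j) =
      ∑ i, ∑ m, beta (k := k) (b i m) • hopfAct (k := k) H (x i) (δ (b m j)) := by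
  simp [coinvProj, hx.coaction_apply, hx.isComatrix.hitRight_apply]

/-- In `ρ(m₀ β(m₁) δ(m₂))` the factor in `H` is `m₁ β(m₂) S(m₃)`, which the antipode axiom reduces
to a multiple of `1`. -/
theorem IsAnticolinear.coinvProj_mem {δ : H →ₗ[k] A} (hδ : IsAnticolinear δ) (m : M) :
    coinvProj M δ m ∈ coinvariants k H M := by
  rw [mem_coinvariants]
  have : coaction k H M ∘ₗ coinvProj M δ =
      (TensorProduct.mk k M H).flip 1 ∘ₗ coinvProj M δ := by
    refine comodule_hom_ext (k := k) (H := H) fun n x b hx j => ?_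
    simp only [LinearMap.comp_apply, hx.coinvProj_apply, map_sum, map_smul,
      hx.coaction_hopfAct_apply (hδ.isComoduleFamily hx.isComatrix j)]
    simp only [Finset.smul_sum, antipodeMatrix_apply]
    rw [sum_rotate₄, sum_rotate₄]
    refine Finset.sum_congr rfl fun p _ => Finset.sum_congr rfl fun q _ => ?_
    simp only [← TensorProduct.tmul_smul, ← TensorProduct.tmul_sum, hx.isComatrix.sum_beta_S]
    simp
  exact LinearMap.congr_fun this m

/-- This is `E(m₀) γ(m₁) = m` for `E = coinvProj M δ`. Reassociating puts `δ` next to `γ`, where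
they contract to `α`. The scalar left over is `ω` contracted with `β`, `S` and `α`, which is the
first normalization axiom. -/
theorem IsCleaving.sum_hopfAct_coinvProj {γ δ : H →ₗ[k] A} (h : IsCleaving γ δ) {x : ι → M}
    {b : Matrix ι ι H} (hx : IsComoduleFamily k x b) (j : ι) :
    ∑ i, hopfAct (k := k) H (coinvProj M δ (x i)) (γ (b i j)) = x j := by
  simp only [hx.coinvProj_apply, sum_hopfAct, smul_hopfAct]
  have e : ∀ i i' m, hopfAct (k := k) H (hopfAct (k := k) H (x i') (δ (b m i))) (γ (b i j))
      = ∑ p, ∑ q, ∑ r, omega (k := k) (b p i' ⊗ₜ (S (k := k) (b m q) ⊗ₜ b r j)) •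
        hopfAct (k := k) H (x p) (δ (b q i) * γ (b i r)) := fun i i' m =>
    hx.hopfAct_hopfAct_apply (h.anticolinear.isComoduleFamily hx.isComatrix i)
      (h.colinear.isComoduleFamily hx.isComatrix i) i' m j
  simp only [e, Finset.smul_sum]
  rw [sum_rotate₃]
  conv_lhs => enter [2, i', 2, m]; rw [sum_rotate₄]
  simp only [← Finset.smul_sum, ← hopfAct_sum, h.sum_mul_left hx.isComatrix, hopfAct_smul,
    hopfAct_one]
  simp only [Finset.smul_sum]
  rw [← sum_rotate₃]
  have e' : ∀ p, ∑ i', ∑ m, ∑ q, ∑ r, beta (k := k) (b i' m) •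
      omega (k := k) (b p i' ⊗ₜ (S (k := k) (b m q) ⊗ₜ b r j)) • alpha (k := k) (b q r) • x p =
        (1 : Matrix ι ι k) p j • x p := by
    intro p
    simp only [← hx.isComatrix.sum_zeta, hx.isComatrix.zeta_apply, Finset.sum_smul,
      Finset.sum_mul]
    exact Finset.sum_congr rfl fun _ _ => Finset.sum_congr rfl fun _ _ => Finset.sum_congr rfl
      fun _ _ => Finset.sum_congr rfl fun _ _ => by
        simp only [smul_smul]
        congr 1
        ring
  simp only [e']
  simp [Matrix.one_apply, ite_smul]

/-- Acting on a coinvariant `m` is colinear in `a`, and `ω` is trivial at `m`, so the projection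
passes through `m`. -/
theorem hopfAct_coinvProj (δ : H →ₗ[k] A) (m : coinvariants k H M) (a : A) :
    coinvProj M δ (hopfAct (k := k) H (m : M) a) = hopfAct (k := k) H (m : M) (coinvProj A δ a) := by
  have : coinvProj M δ ∘ₗ RelHopfModule.act (k := k) (H := H) (m : M) =
      RelHopfModule.act (k := k) (H := H) (m : M) ∘ₗ coinvProj A δ := by
    refine comodule_hom_ext (k := k) (H := H) fun n x b hx j => ?_
    have hm : IsComoduleFamily k (fun i => hopfAct (k := k) H (m : M) (x i)) b :=
      ⟨hx.isComatrix, fun j => by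
        rw [coaction_hopfAct_coe, hx.coaction_apply, map_sum]; rfl⟩
    refine (hm.coinvProj_apply δ j).trans ?_
    simp only [act_act_coinv_left, LinearMap.comp_apply, hx.coinvProj_apply, map_sum, map_smul]
    rfl
  exact LinearMap.congr_fun this a

/-- By colinearity of `γ` the projection of `γ(h)` is `γ(h₁) β(h₂) δ(h₃)`. -/
theorem IsCleaving.coinvProj_colinear {γ δ : H →ₗ[k] A} (h : IsCleaving γ δ) (g : H) :
    coinvProj A δ (γ g) = Coalgebra.counit (R := k) g • (1 : A) := by
  have : coinvProj A δ ∘ₗ γ = (LinearMap.toSpanSingleton k A 1) ∘ₗ Coalgebra.counit := by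
    refine coalgebra_hom_ext (k := k) fun n c hc i j => ?_
    refine ((h.colinear.isComoduleFamily hc i).coinvProj_apply δ j).trans ?_
    refine (h.sum_mul_right hc i j).trans ?_
    simp [hc.counit_apply]
  exact LinearMap.congr_fun this g

end Cleft

/-! ### Normal bases and induced modules -/

section NormalBasis

variable {k : Type w} {H : Type u} [Field k] [NonAssocRing H] [Module k H]
  [IsScalarTower k H H] [SMulCommClass k H H] [CoquasiBialgebra k H]
  {A : Type u} [NonAssocRing A] [Module k A] [IsScalarTower k A A] [SMulCommClass k A A]
  [ComoduleAlgebra k H A]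

/-- `b ⊗ h ↦ b γ(h)`. -/
def coinvMulMap (γ : H →ₗ[k] A) : coinvariants k H A ⊗[k] H →ₗ[k] A :=
  LinearMap.mul' k A ∘ₗ TensorProduct.map (coinvariants k H A).subtype γ

theorem coinvMulMap_tmul (γ : H →ₗ[k] A) (b : coinvariants k H A) (h : H) :
    coinvMulMap γ (b ⊗ₜ h) = (b : A) * γ h := rfl

/-- A colinear map `γ` such that `b ⊗ h ↦ b γ(h)` is bijective. -/
structure IsNormalBasis (γ : H →ₗ[k] A) : Prop where
  colinear : IsColinear γ
  bijective : Function.Bijective (coinvMulMap γ)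

/-- The map is `γ = ν(1 ⊗ -)`, and `B`-linearity recovers `ν` from it. -/
theorem normalBasisProperty_iff :
    NormalBasisProperty k H A ↔ ∃ γ : H →ₗ[k] A, IsNormalBasis γ := by
  constructor
  · rintro ⟨ν, h1, h2⟩
    let γ : H →ₗ[k] A := ν.toLinearMap ∘ₗ TensorProduct.mk k _ H 1
    have e : coinvMulMap γ = ν.toLinearMap := by
      ext b h
      have := h1 b 1 h
      rw [mul_one] at this
      exact this.symm
    refine ⟨γ, fun h => h2 1 h, ?_⟩
    rw [e]
    exact ν.bijective
  · rintro ⟨γ, hγ, hb⟩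
    refine ⟨LinearEquiv.ofBijective (coinvMulMap γ) hb, fun b c h => ?_, fun b h => ?_⟩
    · change coinvMulMap γ ((b * c) ⊗ₜ h) = (b : A) * coinvMulMap γ (c ⊗ₜ h)
      rw [coinvMulMap_tmul, coinvMulMap_tmul, ← mul_mul_coinv_left]
      rfl
    · change coaction k H A ((b : A) * γ h) = _
      rw [coaction_coinv_mul, hγ]
      change LinearMap.rTensor H _ (LinearMap.rTensor H γ _) = LinearMap.rTensor H _ _
      rw [← LinearMap.rTensor_comp_apply]
      rfl

scoped instance algebraIsScalarTower : IsScalarTower k (coinvariants k H A)ᵐᵒᵖ A where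
  smul_assoc r b a := mul_smul_comm r a (b.unop : A)

section Balanced

variable (N : Type u) [AddCommGroup N] [Module k N] [Module (coinvariants k H A)ᵐᵒᵖ N]

/-- `n ⊗ h ↦ n ⊗_B γ(h)`. -/
def balancedBasisMap (γ : H →ₗ[k] A) : N ⊗[k] H →ₗ[k] BalancedTensor k H A N :=
  (balancedRel k H A N).mkQ ∘ₗ LinearMap.lTensor N γ

variable {N}

theorem balancedBasisMap_tmul (γ : H →ₗ[k] A) (n : N) (h : H) :
    balancedBasisMap N γ (n ⊗ₜ h) = btmul k H n (γ h) := rfl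

theorem coaction_balancedBasisMap {γ : H →ₗ[k] A} (hγ : IsColinear γ) (t : N ⊗[k] H) :
    coaction k H (BalancedTensor k H A N) (balancedBasisMap N γ t) =
      LinearMap.rTensor H (balancedBasisMap N γ) ((TensorProduct.assoc k N H H).symm
        (LinearMap.lTensor N Coalgebra.comul t)) := by
  induction t with
  | zero => simp
  | add x y hx hy => simp only [map_add, hx, hy]
  | tmul n h =>
    rw [balancedBasisMap_tmul, coaction_btmul, hγ, LinearMap.lTensor_tmul]
    generalize Coalgebra.comul (R := k) h = s
    induction s with
    | zero => simp
    | add x y hx hy => simp only [TensorProduct.tmul_add, map_add, hx, hy]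
    | tmul x y => rfl

variable [IsScalarTower k (coinvariants k H A)ᵐᵒᵖ N]

variable (N) in
/-- `n ⊗ b ↦ n b`. -/
def coinvAct : N ⊗[k] coinvariants k H A →ₗ[k] N :=
  have := IsScalarTower.to_smulCommClass (R := k) (A := (coinvariants k H A)ᵐᵒᵖ) (M := N)
  TensorProduct.lift (LinearMap.mk₂ k (fun (n : N) (b : coinvariants k H A) =>
      MulOpposite.op b • n)
    (fun _ _ _ => smul_add _ _ _) (fun r n b => (smul_comm r (MulOpposite.op b) n).symm)
    (fun n _ _ => add_smul _ _ n) (fun r n b => smul_assoc r (MulOpposite.op b) n))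

theorem coinvAct_tmul (n : N) (b : coinvariants k H A) :
    coinvAct N (n ⊗ₜ b) = MulOpposite.op b • n := rfl

/-- This is the isomorphism `N ⊗_B A ≅ N ⊗_B (B ⊗ H) ≅ N ⊗ H`. -/
theorem IsNormalBasis.balancedBasisMap_bijective {γ : H →ₗ[k] A} (hγ : IsNormalBasis γ) :
    Function.Bijective (balancedBasisMap N γ) := by
  let e := LinearEquiv.ofBijective (coinvMulMap γ) hγ.bijective
  have he : ∀ (b : coinvariants k H A) (h : H), e.symm ((b : A) * γ h) = b ⊗ₜ h := fun b h =>
    e.symm_apply_apply (b ⊗ₜ h)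
  constructor
  -- The left inverse writes `a` as `∑ b γ(h)` and sends `n ⊗_B a` to `∑ n b ⊗ h`. It respects the
  -- relations because multiplication by `B` acts on the first factor of `B ⊗ H`.
  · let r : BalancedTensor k H A N →ₗ[k] N ⊗[k] H := balancedLift H
      (LinearMap.rTensor H (coinvAct N) ∘ₗ
        (TensorProduct.assoc k N (coinvariants k H A) H).symm.toLinearMap ∘ₗ
        LinearMap.lTensor N e.symm.toLinearMap) <| by
        intro n b a
        obtain ⟨t, rfl⟩ := e.surjective a
        induction t with
        | zero => simp
        | add x y hx hy => simp only [map_add, TensorProduct.tmul_add, mul_add, hx, hy]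
        | tmul c h =>
          have h1 : e (c ⊗ₜ h) = (c : A) * γ h := rfl
          have h2 : (b : A) * ((c : A) * γ h) = ((b * c : coinvariants k H A) : A) * γ h :=
            (mul_mul_coinv_left b (c : A) (γ h)).symm
          simp only [LinearMap.comp_apply, LinearMap.lTensor_tmul, LinearEquiv.coe_coe, h1, h2, he,
            TensorProduct.assoc_symm_tmul, LinearMap.rTensor_tmul, coinvAct_tmul, smul_smul,
            MulOpposite.op_mul]
    have hr : r ∘ₗ balancedBasisMap N γ = LinearMap.id := by
      ext n h
      have h1 : e.symm (γ h) = 1 ⊗ₜ h := by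
        rw [← he]
        exact congrArg _ (one_mul _).symm
      change LinearMap.rTensor H (coinvAct N) ((TensorProduct.assoc k N (coinvariants k H A) H).symm
        (n ⊗ₜ e.symm (γ h))) = n ⊗ₜ h
      rw [h1, TensorProduct.assoc_symm_tmul, LinearMap.rTensor_tmul, coinvAct_tmul,
        MulOpposite.op_one, one_smul]
    exact Function.LeftInverse.injective (g := r) fun x => LinearMap.congr_fun hr x
  · rw [← LinearMap.range_eq_top, eq_top_iff]
    intro t _
    obtain ⟨t, rfl⟩ := Submodule.mkQ_surjective _ t
    induction t with
    | zero => simp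
    | add x y hx hy => rw [map_add]; exact add_mem (hx trivial) (hy trivial)
    | tmul n a =>
      obtain ⟨t, rfl⟩ := e.surjective a
      induction t with
      | zero => simp
      | add x y hx hy => rw [map_add, TensorProduct.tmul_add, map_add]; exact add_mem (hx trivial) (hy trivial)
      | tmul b h => exact ⟨(MulOpposite.op b • n) ⊗ₜ h, btmul_smul k H n b (γ h)⟩

end Balanced

section Counit

variable (M : Type u) [AddCommGroup M] [Module k M] [RelHopfModule k H A M]

/-- `m ⊗ h ↦ m γ(h)` for coinvariant `m`. -/
def coinvActMap (γ : H →ₗ[k] A) : coinvariants k H M ⊗[k] H →ₗ[k] M :=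
  TensorProduct.lift (RelHopfModule.act (k := k) (H := H)) ∘ₗ
    TensorProduct.map (coinvariants k H M).subtype γ

variable {M}

theorem coinvActMap_tmul (γ : H →ₗ[k] A) (m : coinvariants k H M) (h : H) :
    coinvActMap M γ (m ⊗ₜ h) = hopfAct (k := k) H (m : M) (γ h) := rfl

open scoped ModuleCat

/-- The coinvariants of `M`, with the `k`-module structure obtained from the action of `B`. -/
def coinvariantsEquiv (M : RelHopfModuleCat k H A) :
    ((coinvariantsFunctor k H A).obj M) ≃ₗ[k] coinvariants k H M.carrier where
  __ := AddEquiv.refl (coinvariants k H M.carrier)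
  map_smul' r m := @algebraMap_smul k _ (coinvariants k H A)ᵐᵒᵖ _ _ (coinvariants k H M.carrier)
    _ _ _ _ r m

/-- The counit composed with the bijection `M^{coH} ⊗ H ≅ M^{coH} ⊗_B A` is `m ⊗ h ↦ m γ(h)`. This
replaces the tensor product over `B` by one over `k`. -/
theorem IsNormalBasis.counit_bijective_iff {γ : H →ₗ[k] A} (hγ : IsNormalBasis γ)
    (M : RelHopfModuleCat k H A) :
    Function.Bijective (RelHopfModuleCat.lin ((inductionAdjunction k H A).counit.app M)) ↔
      Function.Bijective (coinvActMap M.carrier γ) := by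
  have h1 := hγ.balancedBasisMap_bijective (N := (coinvariantsFunctor k H A).obj M)
  have h2 : coinvActMap M.carrier γ ∘ₗ
      (TensorProduct.congr (coinvariantsEquiv M) (LinearEquiv.refl k H)).toLinearMap =
      RelHopfModuleCat.lin ((inductionAdjunction k H A).counit.app M) ∘ₗ
        balancedBasisMap ((coinvariantsFunctor k H A).obj M) γ := by
    ext m h
    rfl
  refine (Function.Bijective.of_comp_iff _ h1).symm.trans ?_
  refine Iff.trans (iff_of_eq (congrArg Function.Bijective ?_))
    (Function.Bijective.of_comp_iff (coinvActMap M.carrier γ)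
      (TensorProduct.congr (coinvariantsEquiv M) (LinearEquiv.refl k H)).bijective)
  exact funext fun t => (LinearMap.congr_fun h2 t).symm

end Counit

end NormalBasis

/-! ### The structure theorems for cleft extensions -/

section CleftStructure

open CoquasiBialgebra CoquasiHopfAlgebra

variable {k : Type w} {H : Type u} [Field k] [NonAssocRing H] [Module k H]
  [IsScalarTower k H H] [SMulCommClass k H H] [CoquasiHopfAlgebra k H]
  {A : Type u} [NonAssocRing A] [Module k A] [IsScalarTower k A A] [SMulCommClass k A A]
  [ComoduleAlgebra k H A]

/-- The inverse is `m ↦ E(m₀) ⊗ m₁` with `E = coinvProj M δ`. Injectivity follows from `E(m γ(h)) =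
ε(h) m` for coinvariant `m`, surjectivity from `E(m₀) γ(m₁) = m`. -/
theorem IsCleaving.coinvActMap_bijective {γ δ : H →ₗ[k] A} (h : IsCleaving γ δ)
    (M : Type u) [AddCommGroup M] [Module k M] [RelHopfModule k H A M] :
    Function.Bijective (coinvActMap M γ) := by
  constructor
  · let r : M →ₗ[k] coinvariants k H M ⊗[k] H := LinearMap.rTensor H
      ((coinvProj M δ).codRestrict _ h.anticolinear.coinvProj_mem) ∘ₗ coaction k H M
    have hr : r ∘ₗ coinvActMap M γ = LinearMap.id := by
      refine TensorProduct.ext (LinearMap.ext fun m => coalgebra_hom_ext (k := k)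
        fun n c hc i j => ?_)
      have h1 : coaction k H M (coinvActMap M γ (m ⊗ₜ c i j)) =
          ∑ p, hopfAct (k := k) H (m : M) (γ (c i p)) ⊗ₜ c p j := by
        rw [coinvActMap_tmul, coaction_hopfAct_coe, h.colinear, hc.comul_apply, map_sum, map_sum]
        rfl
      have h2 : ∀ p, (coinvProj M δ).codRestrict (coinvariants k H M)
          h.anticolinear.coinvProj_mem (hopfAct (k := k) H (m : M) (γ (c i p))) =
          (1 : Matrix _ _ k) i p • m := by
        intro p
        apply Subtype.ext
        rw [LinearMap.codRestrict_apply, hopfAct_coinvProj, h.coinvProj_colinear, hopfAct_smul,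
          hopfAct_one, hc.counit_apply]
        rfl
      change LinearMap.rTensor H _ (coaction k H M (coinvActMap M γ (m ⊗ₜ c i j))) = m ⊗ₜ c i j
      rw [h1, map_sum]
      simp only [LinearMap.rTensor_tmul, h2]
      simp [Matrix.one_apply, ite_smul, TensorProduct.ite_tmul]
    exact Function.LeftInverse.injective (g := r) fun x => LinearMap.congr_fun hr x
  · rw [← LinearMap.range_eq_top, eq_top_iff]
    intro m _
    refine comodule_induction (k := k) (H := H)
      (p := fun m => m ∈ LinearMap.range (coinvActMap M γ)) (zero_mem _)
      (fun x y => add_mem) (fun r x => Submodule.smul_mem _ r) (fun n x b hx j => ?_) m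
    rw [← h.sum_hopfAct_coinvProj hx j]
    exact sum_mem fun i _ => ⟨⟨_, h.anticolinear.coinvProj_mem (x i)⟩ ⊗ₜ b i j, rfl⟩

theorem IsCleaving.isNormalBasis {γ δ : H →ₗ[k] A} (h : IsCleaving γ δ) : IsNormalBasis γ :=
  ⟨h.colinear, h.coinvActMap_bijective A⟩

theorem IsCleaving.weakStructureTheorem {γ δ : H →ₗ[k] A} (h : IsCleaving γ δ) :
    WeakStructureTheorem k H A := fun M =>
  (h.isNormalBasis.counit_bijective_iff M).2 (h.coinvActMap_bijective M.carrier)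

theorem IsColinear.map_one_mem {γ : H →ₗ[k] A} (h : IsColinear γ) : γ 1 ∈ coinvariants k H A := by
  rw [mem_coinvariants, h, comul_one]
  rfl

/-- The formula `E(m₀) γ(m₁) = m` at `m = 1` makes `E(1)` a left inverse of `γ(1)` in `B`. -/
theorem IsCleaving.coinvProj_one_mul {γ δ : H →ₗ[k] A} (h : IsCleaving γ δ) :
    coinvProj A δ 1 * γ 1 = 1 := by
  have hx := isComoduleFamily_one (k := k) (H := H) (A := A)
  exact (Fintype.sum_unique _).symm.trans (h.sum_hopfAct_coinvProj hx ())

open scoped ModuleCat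

/-- Through `N ⊗ H ≅ N ⊗_B A` the coinvariants are the elements `n ⊗_B γ(1) = n γ(1) ⊗_B 1`, which
gives surjectivity. A left inverse of `γ(1)` in `B` gives injectivity. -/
theorem IsCleaving.unit_bijective {γ δ : H →ₗ[k] A} (h : IsCleaving γ δ)
    (N : ModuleCat.{u} (coinvariants k H A)ᵐᵒᵖ) :
    Function.Bijective ((inductionAdjunction k H A).unit.app N).hom := by
  let g : coinvariants k H A := ⟨γ 1, h.colinear.map_one_mem⟩
  let p : coinvariants k H A := ⟨coinvProj A δ 1, h.anticolinear.coinvProj_mem 1⟩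
  have hpg : p * g = 1 := Subtype.ext h.coinvProj_one_mul
  have hb := h.isNormalBasis.balancedBasisMap_bijective (N := N)
  constructor
  · rw [injective_iff_map_eq_zero]
    intro n hn
    have h1 : btmul k H n (1 : A) = 0 := congrArg Subtype.val hn
    -- If `n ⊗_B 1 = 0`, then `n p ⊗_B γ(1) = n ⊗_B p γ(1) = n ⊗_B 1 = 0`. Hence `n p = 0`, and `n =
    -- (n p) g = 0`.
    have h2 : balancedBasisMap N γ ((MulOpposite.op p • n) ⊗ₜ (1 : H)) = 0 := by
      rw [← h1, balancedBasisMap_tmul, btmul_smul]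
      exact congrArg (btmul k H n) h.coinvProj_one_mul
    have h3 := hb.1 (h2.trans (map_zero _).symm)
    have h4 := congrArg (fun t => idCounit k H N t) h3
    simp only [idCounit, LinearMap.comp_apply, LinearMap.lTensor_tmul, LinearEquiv.coe_coe,
      TensorProduct.rid_tmul, counit_one, one_smul, map_zero] at h4
    rw [← one_smul (coinvariants k H A)ᵐᵒᵖ n, ← MulOpposite.op_one, ← hpg, MulOpposite.op_mul,
      mul_smul, h4, smul_zero]
  · rintro ⟨t, ht⟩
    obtain ⟨s, rfl⟩ := hb.2 t
    have h1 : LinearMap.lTensor N Coalgebra.comul s = TensorProduct.assoc k N H H (s ⊗ₜ 1) := by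
      have this : LinearMap.rTensor H (balancedBasisMap N γ) ((TensorProduct.assoc k N H H).symm
          (LinearMap.lTensor N Coalgebra.comul s)) =
          LinearMap.rTensor H (balancedBasisMap N γ) (s ⊗ₜ (1 : H)) :=
        (coaction_balancedBasisMap h.colinear s).symm.trans ht
      have hinj : Function.Injective (LinearMap.rTensor H (balancedBasisMap N γ)) :=
        Module.Flat.rTensor_preserves_injective_linearMap _ hb.1
      rw [← hinj this, LinearEquiv.apply_symm_apply]
    -- Applying `ε` to the middle factor of `(id ⊗ Δ)(s) = s ⊗ 1` shows that `s` lies in `N ⊗ 1`.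
    have h2 : s = (idCounit k H N s) ⊗ₜ (1 : H) := by
      have := congrArg (LinearMap.lTensor N ((TensorProduct.lid k H).toLinearMap ∘ₗ
        LinearMap.rTensor H (Coalgebra.counit (R := k) (A := H)))) h1
      rw [← LinearMap.lTensor_comp_apply] at this
      have e1 : ((TensorProduct.lid k H).toLinearMap ∘ₗ LinearMap.rTensor H
          (Coalgebra.counit (R := k) (A := H))) ∘ₗ Coalgebra.comul = LinearMap.id := by
        ext h
        simp
      rw [e1, LinearMap.lTensor_id, LinearMap.id_apply] at this
      refine this.trans ?_
      clear this h1 ht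
      induction s with
      | zero => simp
      | add x y hx hy => simp only [TensorProduct.add_tmul, map_add, hx, hy]
      | tmul n h =>
        simp [idCounit, TensorProduct.smul_tmul]
    refine ⟨MulOpposite.op g • idCounit k H N s, Subtype.ext ?_⟩
    refine Eq.trans (b := btmul k H (MulOpposite.op g • idCounit k H N s) (1 : A)) rfl ?_
    rw [btmul_smul]
    exact (congrArg (btmul k H _) (mul_one _)).trans (congrArg (balancedBasisMap N γ) h2).symm

theorem RelHopfModuleCat.isIso_of_bijective {M M' : RelHopfModuleCat k H A} (f : M ⟶ M')
    (hf : Function.Bijective (RelHopfModuleCat.lin f)) : IsIso f := by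
  let e := LinearEquiv.ofBijective (RelHopfModuleCat.lin f) hf
  have he : ∀ m, RelHopfModuleCat.lin f (e.symm m) = m := e.apply_symm_apply
  have hcomp : RelHopfModuleCat.lin f ∘ₗ e.symm.toLinearMap = LinearMap.id :=
    LinearMap.ext he
  refine ⟨⟨⟨e.symm.toLinearMap, fun m => ?_, fun m a => ?_⟩, ?_, ?_⟩⟩
  -- Tensoring with `H` over a field preserves injectivity, so colinearity of the inverse can be
  -- tested after applying `f ⊗ id`.
  · apply Module.Flat.rTensor_preserves_injective_linearMap (M := H) _ hf.1
    have := f.colinear (e.symm m)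
    refine this.symm.trans ?_
    rw [← LinearMap.rTensor_comp_apply, hcomp, LinearMap.rTensor_id, LinearMap.id_apply]
    exact congrArg _ (he m)
  · apply hf.1
    refine (he _).trans ((f.map_act (e.symm m) a).trans ?_).symm
    exact congrArg (fun m => hopfAct (k := k) H m a) (he m)
  · exact RelHopfModuleCat.hom_ext (LinearMap.ext e.symm_apply_apply)
  · exact RelHopfModuleCat.hom_ext (LinearMap.ext he)

theorem IsCleaving.strongStructureTheorem {γ δ : H →ₗ[k] A} (h : IsCleaving γ δ) :
    StrongStructureTheorem k H A := by
  constructor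
  · have : ∀ N, IsIso ((inductionAdjunction k H A).unit.app N) := fun N =>
      (ConcreteCategory.isIso_iff_bijective _).2 (h.unit_bijective N)
    exact NatIso.isIso_of_isIso_app _
  · have : ∀ M, IsIso ((inductionAdjunction k H A).counit.app M) := fun M =>
      RelHopfModuleCat.isIso_of_bijective _ (h.weakStructureTheorem M)
    exact NatIso.isIso_of_isIso_app _

theorem StrongStructureTheorem.equivalence (h : StrongStructureTheorem k H A) :
    Nonempty (ModuleCat.{u} (coinvariants k H A)ᵐᵒᵖ ≌ RelHopfModuleCat k H A) := by
  obtain ⟨h1, h2⟩ := h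
  exact ⟨(inductionAdjunction k H A).toEquivalence⟩

end CleftStructure

/-! ### The Galois map in terms of a normal basis -/

section GaloisMap

open CoquasiBialgebra CoquasiHopfAlgebra

variable {k : Type w} {H : Type u} [Field k] [NonAssocRing H] [Module k H]
  [IsScalarTower k H H] [SMulCommClass k H H] [CoquasiHopfAlgebra k H]
  {A : Type u} [NonAssocRing A] [Module k A] [IsScalarTower k A A] [SMulCommClass k A A]
  [ComoduleAlgebra k H A]
  {ι κ l : Type*} [Fintype ι] [DecidableEq ι] [Fintype κ] [DecidableEq κ] [Fintype l]
  [DecidableEq l]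

theorem comodule_tmul_hom_ext {M : Type u} [AddCommGroup M] [Module k M] [RightComodule k H M]
    {V : Type*} [AddCommGroup V] [Module k V] {f g : M ⊗[k] H →ₗ[k] V}
    (h : ∀ (n : ℕ) (x : Fin n → M) (b : Matrix (Fin n) (Fin n) H), IsComoduleFamily k x b →
      ∀ (m : ℕ) (c : Matrix (Fin m) (Fin m) H), IsComatrix k c →
      ∀ j u v, f (x j ⊗ₜ c u v) = g (x j ⊗ₜ c u v)) : f = g :=
  TensorProduct.ext <| comodule_hom_ext (k := k) (H := H) fun n x b hx j =>
    coalgebra_hom_ext (k := k) fun m c hc u v => h n x b hx m c hc j u v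

theorem IsComatrix.canTwist_apply {c : Matrix l l H} (hc : IsComatrix k c) (h : H) (u v : l) :
    canTwist k H (h ⊗ₜ c u v) = ∑ q, eta k H (h ⊗ₜ c u q) • c q v := by
  simp only [canTwist, eta, LinearMap.comp_apply, LinearMap.lTensor_tmul, hc.comul_apply, map_sum,
    LinearMap.rTensor_tmul, TensorProduct.tmul_sum, LinearEquiv.coe_coe,
    TensorProduct.assoc_symm_tmul, TensorProduct.lid_tmul]

/-- The composite of `a ⊗ h ↦ a ⊗_B γ(h)` and the Galois map. -/
def galoisMap (γ : H →ₗ[k] A) : A ⊗[k] H →ₗ[k] A ⊗[k] H :=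
  can k H A ∘ₗ balancedBasisMap A γ

theorem IsNormalBasis.isGalois_iff {γ : H →ₗ[k] A} (hγ : IsNormalBasis γ) :
    IsGalois k H A ↔ Function.Bijective (galoisMap γ) :=
  (Function.Bijective.of_comp_iff _ (hγ.balancedBasisMap_bijective (N := A))).symm

theorem IsColinear.galoisMap_apply {γ : H →ₗ[k] A} (hγ : IsColinear γ) {x : ι → A}
    {b : Matrix ι ι H} (hx : IsComoduleFamily k x b) {c : Matrix l l H} (hc : IsComatrix k c)
    (j : ι) (u v : l) :
    galoisMap γ (x j ⊗ₜ c u v) =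
      ∑ i, ∑ p, ∑ q, eta k H (b i j ⊗ₜ c p q) • ((x i * γ (c u p)) ⊗ₜ[k] c q v) := by
  change (TensorProduct.map (LinearMap.mul' k A) (canTwist k H) ∘ₗ
      (TensorProduct.tensorTensorTensorComm k A H A H).toLinearMap ∘ₗ
      TensorProduct.map (coaction k H A) (coaction k H A)) (x j ⊗ₜ γ (c u v)) = _
  simp only [LinearMap.comp_apply, TensorProduct.map_tmul, LinearEquiv.coe_coe,
    hx.coaction_apply, (hγ.isComoduleFamily hc u).coaction_apply, TensorProduct.sum_tmul,
    TensorProduct.tmul_sum, map_sum, TensorProduct.tensorTensorTensorComm_tmul,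
    LinearMap.mul'_apply, hc.canTwist_apply, TensorProduct.tmul_smul]
  exact Finset.sum_comm

/-- Since `ω⁻¹` is trivial at `1` in the first slot, `η(1, h) = β(h)`. -/
theorem IsColinear.galoisMap_one_tmul {γ : H →ₗ[k] A} (hγ : IsColinear γ)
    {c : Matrix l l H} (hc : IsComatrix k c) (u v : l) :
    galoisMap γ ((1 : A) ⊗ₜ c u v) =
      ∑ p, ∑ q, beta (k := k) (c p q) • (γ (c u p) ⊗ₜ[k] c q v) := by
  have hx := isComoduleFamily_one (k := k) (H := H) (A := A)
  refine (hγ.galoisMap_apply hx hc () u v).trans ((Fintype.sum_unique _).trans ?_)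
  refine Finset.sum_congr rfl fun p _ => Finset.sum_congr rfl fun q _ => ?_
  rw [one_mul, hc.eta_apply]
  simp [omegaInv_one_left, hc.counit_apply, counit_S, Matrix.one_apply]

/-- `a ⊗ h ↦ a δ(h₁) ⊗ h₂`. -/
def galoisInv (δ : H →ₗ[k] A) : A ⊗[k] H →ₗ[k] A ⊗[k] H :=
  LinearMap.rTensor H (LinearMap.mul' k A ∘ₗ LinearMap.lTensor A δ) ∘ₗ
    (TensorProduct.assoc k A H H).symm.toLinearMap ∘ₗ LinearMap.lTensor A Coalgebra.comul

theorem IsComatrix.galoisInv_apply {c : Matrix l l H} (hc : IsComatrix k c) (δ : H →ₗ[k] A) (a : A)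
    (u v : l) : galoisInv δ (a ⊗ₜ c u v) = ∑ p, (a * δ (c u p)) ⊗ₜ[k] c p v := by
  simp [galoisInv, hc.comul_apply, TensorProduct.tmul_sum]

/-- Reassociating `(a γ) δ` introduces `ω`, which cancels against the `ω⁻¹` inside `η` and leaves
`β`. Then `γβδ = ε` applies. -/
theorem IsCleaving.galoisInv_galoisMap {γ δ : H →ₗ[k] A} (h : IsCleaving γ δ) :
    galoisInv δ ∘ₗ galoisMap γ = LinearMap.id := by
  refine comodule_tmul_hom_ext fun n x b hx m c hc j u v => ?_
  have e : ∀ i p q r, (x i * γ (c u p)) * δ (c q r) = ∑ i', ∑ p', ∑ q',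
      omega (k := k) (b i' i ⊗ₜ (c p' p ⊗ₜ S (k := k) (c q q'))) •
        (x i' * (γ (c u p') * δ (c q' r))) := fun i p q r =>
    hx.mul_mul_apply (h.colinear.isComoduleFamily hc u) (h.anticolinear.isComoduleFamily hc r) i p q
  have key : ∀ r, ∑ i, ∑ p, ∑ q, eta k H (b i j ⊗ₜ c p q) • ((x i * γ (c u p)) * δ (c q r)) =
      (1 : Matrix _ _ k) u r • x j := by
    intro r
    simp only [e, Finset.smul_sum, smul_smul]
    conv_lhs => enter [2, i, 2, p]; rw [sum_rotate₄]
    conv_lhs => enter [2, i]; rw [sum_rotate₄]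
    rw [sum_rotate₄]
    conv_lhs =>
      enter [2, i', 2, p', 2, q']
      simp only [mul_comm (eta k H _), ← Finset.sum_smul]
      rw [sum_omega_mul_eta_antipode hx.isComatrix hc]
    have e' : ∀ i', ∑ p', ∑ q', beta (k := k) (c p' q') • (x i' * (γ (c u p') * δ (c q' r))) =
        (1 : Matrix _ _ k) u r • x i' := by
      intro i'
      have := congrArg (x i' * ·) (h.sum_mul_right hc u r)
      simpa only [Finset.mul_sum, mul_smul_comm, mul_one] using this
    simp only [mul_smul, ← Finset.smul_sum, e']
    simp [Matrix.one_apply, ite_smul]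
  rw [LinearMap.comp_apply, h.colinear.galoisMap_apply hx hc]
  simp only [map_sum, map_smul, hc.galoisInv_apply, Finset.smul_sum]
  conv_lhs => enter [2, i, 2, p]; rw [Finset.sum_comm]
  conv_lhs => enter [2, i]; rw [Finset.sum_comm]
  rw [Finset.sum_comm]
  simp only [TensorProduct.smul_tmul', ← TensorProduct.sum_tmul, key]
  simp [Matrix.one_apply, ite_smul, TensorProduct.ite_tmul]

/-- Reassociating `(a δ) γ` turns `δγ` into `α`. By `sum_omega_mul_eta` with `a = S(c)` the scalar
becomes `ω⁻¹(b, S(c) c, S(c)) η(S(c), c)`. The `α` collapses the middle slot, and `α(h₂) η(S(h₁),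
h₃) = ε(h)` remains. -/
theorem IsCleaving.galoisMap_galoisInv {γ δ : H →ₗ[k] A} (h : IsCleaving γ δ) :
    galoisMap γ ∘ₗ galoisInv δ = LinearMap.id := by
  refine comodule_tmul_hom_ext fun n x b hx m c hc j u v => ?_
  have e : ∀ i m r p, (x i * δ (c m r)) * γ (c r p) = ∑ i', ∑ m', ∑ p',
      omega (k := k) (b i' i ⊗ₜ (antipodeMatrix k c m' m ⊗ₜ c p' p)) •
        (x i' * (δ (c m' r) * γ (c r p'))) := fun i m r p =>
    hx.mul_mul_apply (h.anticolinear.isComoduleFamily hc r) (h.colinear.isComoduleFamily hc r) i m p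
  have key : ∀ q, ∑ r, ∑ i, ∑ m, ∑ p, eta k H ((b i j * antipodeMatrix k c m u) ⊗ₜ c p q) •
      ((x i * δ (c m r)) * γ (c r p)) = (1 : Matrix _ _ k) u q • x j := by
    intro q
    simp only [e, Finset.smul_sum, smul_smul]
    conv_lhs => enter [2, r, 2, i, 2, m]; rw [sum_rotate₄]
    conv_lhs => enter [2, r, 2, i]; rw [sum_rotate₄]
    conv_lhs => enter [2, r]; rw [sum_rotate₄]
    rw [sum_rotate₄]
    conv_lhs =>
      enter [2, i', 2, m', 2, p', 2, r]
      simp only [mul_comm (eta k H _), ← Finset.sum_smul]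
      rw [sum_omega_mul_eta hx.isComatrix hc.antipode hc]
    have e' : ∀ i', ∑ m', ∑ p', ∑ m'', ∑ p'', ∑ q'',
        (omegaInv (k := k) (b i' j ⊗ₜ ((antipodeMatrix k c m' m'' * c p' p'') ⊗ₜ
          S (k := k) (c q'' q))) * eta k H (antipodeMatrix k c m'' u ⊗ₜ c p'' q'')) *
          alpha (k := k) (c m' p') = (1 : Matrix _ _ k) i' j * (1 : Matrix _ _ k) u q := by
      intro i'
      have h1 : ∀ m'' p'' q'', ∑ m', ∑ p', omegaInv (k := k) (b i' j ⊗ₜ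
          ((antipodeMatrix k c m' m'' * c p' p'') ⊗ₜ S (k := k) (c q'' q))) *
          alpha (k := k) (c m' p') =
          (1 : Matrix _ _ k) i' j * (1 : Matrix _ _ k) q'' q * alpha (k := k) (c m'' p'') := by
        intro m'' p'' q''
        have := congrArg (fun t => omegaInv (k := k) (b i' j ⊗ₜ (t ⊗ₜ S (k := k) (c q'' q))))
          (hc.sum_S_alpha m'' p'')
        simp only [TensorProduct.tmul_sum, TensorProduct.sum_tmul, map_sum, TensorProduct.tmul_smul,
          ← TensorProduct.smul_tmul', map_smul, omegaInv_one_middle, hx.isComatrix.counit_apply,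
          hc.counit_apply, counit_S, smul_eq_mul] at this
        simpa only [mul_comm (alpha _), antipodeMatrix_apply] using this
      conv_lhs => enter [2, m']; rw [sum_rotate₄]
      rw [sum_rotate₄]
      conv_lhs =>
        enter [2, m'', 2, p'', 2, q'']
        simp only [mul_right_comm _ (eta k H _), ← Finset.sum_mul]
        rw [h1]
      rw [← hc.sum_eta u q]
      simp [Matrix.one_apply, Finset.mul_sum]
      rfl
    simp only [← Finset.smul_sum, ← Finset.mul_sum, h.sum_mul_left hc, mul_smul_comm, mul_one,
      smul_smul]
    simp only [Finset.sum_mul, ← Finset.sum_smul, e']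
    simp [Matrix.one_apply, ite_smul]
  rw [LinearMap.comp_apply, hc.galoisInv_apply, map_sum]
  have e' : ∀ r, galoisMap γ ((x j * δ (c u r)) ⊗ₜ c r v) = ∑ i, ∑ m, ∑ p, ∑ q,
      eta k H ((b i j * antipodeMatrix k c m u) ⊗ₜ c p q) •
        (((x i * δ (c m r)) * γ (c r p)) ⊗ₜ[k] c q v) := fun r =>
    (h.colinear.galoisMap_apply (hx.hopfAct_prod (h.anticolinear.isComoduleFamily hc r)) hc
      (j, u) r v).trans (Fintype.sum_prod_type _)
  simp only [e']
  conv_lhs => enter [2, r, 2, i]; rw [← sum_rotate₃]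
  conv_lhs => enter [2, r]; rw [Finset.sum_comm]
  rw [Finset.sum_comm]
  simp only [TensorProduct.smul_tmul', ← TensorProduct.sum_tmul, key]
  simp [Matrix.one_apply, ite_smul, TensorProduct.ite_tmul]

theorem IsCleaving.isGalois {γ δ : H →ₗ[k] A} (h : IsCleaving γ δ) : IsGalois k H A :=
  h.isNormalBasis.isGalois_iff.2 ⟨Function.LeftInverse.injective (g := galoisInv δ)
    fun t => LinearMap.congr_fun h.galoisInv_galoisMap t,
    Function.RightInverse.surjective (g := galoisInv δ)
    fun t => LinearMap.congr_fun h.galoisMap_galoisInv t⟩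

variable (k H) in
/-- `h ⊗ (g ⊗ l) ↦ ω⁻¹(h, g, S(l₁)) l₂`. -/
def omegaInvAntipode : H ⊗[k] (H ⊗[k] H) →ₗ[k] H :=
  (TensorProduct.lid k H).toLinearMap ∘ₗ LinearMap.rTensor H (omegaInv (k := k) (H := H)) ∘ₗ
    (TensorProduct.assoc k H (H ⊗[k] H) H).symm.toLinearMap ∘ₗ
    LinearMap.lTensor H ((TensorProduct.assoc k H H H).symm.toLinearMap ∘ₗ
      LinearMap.lTensor H (LinearMap.rTensor H S ∘ₗ Coalgebra.comul))

theorem IsComatrix.omegaInvAntipode_apply {c : Matrix l l H} (hc : IsComatrix k c) (h g : H)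
    (u v : l) : omegaInvAntipode k H (h ⊗ₜ (g ⊗ₜ c u v)) =
      ∑ q, omegaInv (k := k) (h ⊗ₜ (g ⊗ₜ S (k := k) (c u q))) • c q v := by
  simp only [omegaInvAntipode, LinearMap.comp_apply, LinearMap.lTensor_tmul, hc.comul_apply,
    map_sum, LinearMap.rTensor_tmul, TensorProduct.tmul_sum, LinearEquiv.coe_coe,
    TensorProduct.assoc_symm_tmul, TensorProduct.lid_tmul]

variable (k H A) in
/-- `a ⊗ (b ⊗ h) ↦ ω⁻¹(a₁, b₁, S(h₁)) a₀ b₀ ⊗ h₂`. -/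
def twistedMul : A ⊗[k] (A ⊗[k] H) →ₗ[k] A ⊗[k] H :=
  TensorProduct.map (LinearMap.mul' k A) (omegaInvAntipode k H) ∘ₗ
    (TensorProduct.tensorTensorTensorComm k A H A (H ⊗[k] H)).toLinearMap ∘ₗ
    TensorProduct.map (coaction k H A)
      ((TensorProduct.assoc k A H H).toLinearMap ∘ₗ LinearMap.rTensor H (coaction k H A))

theorem IsComoduleFamily.twistedMul_apply {y : ι → A} {b : Matrix ι ι H}
    (hy : IsComoduleFamily k y b) {x : κ → A} {a : Matrix κ κ H} (hx : IsComoduleFamily k x a)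
    {c : Matrix l l H} (hc : IsComatrix k c) (j : ι) (p : κ) (u v : l) :
    twistedMul k H A (y j ⊗ₜ (x p ⊗ₜ c u v)) = ∑ i, ∑ p', ∑ q,
      omegaInv (k := k) (b i j ⊗ₜ (a p' p ⊗ₜ S (k := k) (c u q))) •
        ((y i * x p') ⊗ₜ[k] c q v) := by
  simp only [twistedMul, LinearMap.comp_apply, TensorProduct.map_tmul, LinearMap.rTensor_tmul,
    hx.coaction_apply, hy.coaction_apply, TensorProduct.sum_tmul, TensorProduct.tmul_sum, map_sum,
    LinearEquiv.coe_coe, TensorProduct.assoc_tmul, TensorProduct.tensorTensorTensorComm_tmul,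
    LinearMap.mul'_apply, hc.omegaInvAntipode_apply, TensorProduct.tmul_smul]
  exact Finset.sum_comm

variable (H) in
theorem twistedMul_one_tmul (a : A) (h : H) :
    twistedMul k H A (a ⊗ₜ ((1 : A) ⊗ₜ h)) = a ⊗ₜ h := by
  have : twistedMul k H A ∘ₗ LinearMap.lTensor A (TensorProduct.mk k A H 1) = LinearMap.id := by
    refine comodule_tmul_hom_ext fun n x b hx m c hc j u v => ?_
    have h1 := isComoduleFamily_one (k := k) (H := H) (A := A)
    refine (hx.twistedMul_apply h1 hc j () u v).trans ?_
    simp [omegaInv_one_middle, hx.isComatrix.counit_apply, counit_S, hc.counit_apply,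
      Matrix.one_apply, ite_smul]
  exact LinearMap.congr_fun this (a ⊗ₜ h)

/-- Left `A`-linearity of the Galois map: `A` multiplies the first factor of the source, and acts on
the target by `twistedMul`. After reassociating, the coefficients agree by `sum_omega_mul_eta`. -/
theorem IsColinear.galoisMap_mul {γ : H →ₗ[k] A} (hγ : IsColinear γ) (a : A) (t : A ⊗[k] H) :
    galoisMap γ (LinearMap.rTensor H (LinearMap.mulLeft k a) t) =
      twistedMul k H A (a ⊗ₜ galoisMap γ t) := by
  have : galoisMap γ ∘ₗ LinearMap.rTensor H (LinearMap.mul' k A) ∘ₗ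
      (TensorProduct.assoc k A A H).symm.toLinearMap =
      twistedMul k H A ∘ₗ LinearMap.lTensor A (galoisMap γ) := by
    refine TensorProduct.ext <| comodule_hom_ext (k := k) (H := H) fun n y b hy j =>
      comodule_tmul_hom_ext fun n' x a hx m c hc p u v => ?_
    have e1 : galoisMap γ ((y j * x p) ⊗ₜ c u v) = _ :=
      (hγ.galoisMap_apply (hy.hopfAct_prod hx) hc (j, p) u v).trans (Fintype.sum_prod_type _)
    have e2 : ∀ i p' s, (y i * x p') * γ (c u s) = _ := fun i p' s =>
      hy.mul_mul_apply hx (hγ.isComoduleFamily hc u) i p' s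
    have e3 : ∀ i s t, twistedMul k H A (y j ⊗ₜ ((x i * γ (c u s)) ⊗ₜ c t v)) = _ := fun i s t =>
      (hy.twistedMul_apply (hx.hopfAct_prod (hγ.isComoduleFamily hc u)) hc j (i, s) t v).trans
        (Finset.sum_congr rfl fun _ _ => Fintype.sum_prod_type _)
    refine e1.trans (Eq.trans ?_ (congrArg (fun t => twistedMul k H A (y j ⊗ₜ t))
      (hγ.galoisMap_apply hx hc p u v)).symm)
    simp only [hopfAct_self, e2, TensorProduct.tmul_sum, map_sum, TensorProduct.tmul_smul, map_smul,
      e3, mulMatrix, TensorProduct.sum_tmul, Finset.smul_sum, ← TensorProduct.smul_tmul', smul_smul]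
    conv_lhs => enter [2, i, 2, p, 2, s]; rw [sum_rotate₄]
    rw [sum_comm₃₄]
    conv_rhs => rw [sum_comm₃₄]
    simp only [← Finset.sum_smul, mul_comm (eta k H _), sum_omega_mul_eta hy.isComatrix hx.isComatrix hc]
  have h2 : galoisMap γ ∘ₗ LinearMap.rTensor H (LinearMap.mulLeft k a) =
      twistedMul k H A ∘ₗ TensorProduct.mk k A _ a ∘ₗ galoisMap γ := by
    ext b h
    exact LinearMap.congr_fun this (a ⊗ₜ (b ⊗ₜ h))
  exact LinearMap.congr_fun h2 t

/-- `a ⊗ h ↦ (a₀ ⊗ h) ⊗ a₁`. -/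
def coactLeft (k : Type w) (H A : Type u) [Field k] [NonAssocRing H] [Module k H]
    [IsScalarTower k H H] [SMulCommClass k H H] [CoquasiBialgebra k H] [AddCommGroup A] [Module k A]
    [RightComodule k H A] : A ⊗[k] H →ₗ[k] (A ⊗[k] H) ⊗[k] H :=
  (TensorProduct.rightComm k A H H).toLinearMap ∘ₗ LinearMap.rTensor H (coaction k H A)

variable (k H A) in
/-- `a ⊗ h ↦ (a₀ ⊗ h₂) ⊗ a₁ S(h₁)`. -/
def coactAntipode : A ⊗[k] H →ₗ[k] (A ⊗[k] H) ⊗[k] H :=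
  LinearMap.lTensor (A ⊗[k] H) (LinearMap.mul' k H) ∘ₗ
    (TensorProduct.tensorTensorTensorComm k A H H H).toLinearMap ∘ₗ
    TensorProduct.map (coaction k H A)
      (LinearMap.lTensor H S ∘ₗ (TensorProduct.comm k H H).toLinearMap ∘ₗ Coalgebra.comul)

theorem IsComoduleFamily.coactLeft_apply {x : ι → A} {b : Matrix ι ι H}
    (hx : IsComoduleFamily k x b) (j : ι) (h : H) :
    coactLeft k H A (x j ⊗ₜ h) = ∑ i, (x i ⊗ₜ[k] h) ⊗ₜ[k] b i j := by
  simp [coactLeft, hx.coaction_apply, TensorProduct.sum_tmul]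

theorem IsComoduleFamily.coactAntipode_apply {x : ι → A} {b : Matrix ι ι H}
    (hx : IsComoduleFamily k x b) {c : Matrix l l H} (hc : IsComatrix k c) (j : ι) (u v : l) :
    coactAntipode k H A (x j ⊗ₜ c u v) =
      ∑ i, ∑ q, (x i ⊗ₜ[k] c q v) ⊗ₜ[k] (b i j * S (k := k) (c u q)) := by
  rw [Finset.sum_comm]
  simp [coactAntipode, hx.coaction_apply, hc.comul_apply, TensorProduct.sum_tmul,
    TensorProduct.tmul_sum]

/-- The coaction on the first factor of the source corresponds to `a ⊗ h ↦ (a₀ ⊗ h₂) ⊗ a₁ S(h₁)` on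
the target. This will fix the coaction of the companion map. -/
theorem IsColinear.coactAntipode_galoisMap {γ : H →ₗ[k] A} (hγ : IsColinear γ) :
    coactAntipode k H A ∘ₗ galoisMap γ = LinearMap.rTensor H (galoisMap γ) ∘ₗ coactLeft k H A := by
  refine comodule_tmul_hom_ext fun n x b hx m c hc j u v => ?_
  have e : ∀ i p q, coactAntipode k H A ((x i * γ (c u p)) ⊗ₜ c q v) = _ := fun i p q =>
    ((hx.hopfAct_prod (hγ.isComoduleFamily hc u)).coactAntipode_apply hc (i, p) q v).trans
      (Fintype.sum_prod_type _)
  simp only [LinearMap.comp_apply, hγ.galoisMap_apply hx hc, hx.coactLeft_apply, map_sum, map_smul,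
    e, LinearMap.rTensor_tmul, TensorProduct.sum_tmul, Finset.smul_sum, mulMatrix, hopfAct_self,
    ← TensorProduct.smul_tmul']
  conv_lhs => enter [2, i, 2, p]; rw [sum_rotate₄]
  conv_lhs => enter [2, i]; rw [sum_rotate₄]
  rw [sum_rotate₄]
  conv_rhs => rw [sum_rotate₄]
  simp only [← TensorProduct.tmul_smul, ← TensorProduct.tmul_sum, sum_eta_smul_mul hx.isComatrix hc]

/-- Colinearity for the comultiplication of the last factor, which will fix the shape of the
inverse. -/
theorem IsColinear.rTensor_galoisMap_comul {γ : H →ₗ[k] A} (hγ : IsColinear γ) :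
    LinearMap.rTensor H (galoisMap γ) ∘ₗ (TensorProduct.assoc k A H H).symm.toLinearMap ∘ₗ
      LinearMap.lTensor A Coalgebra.comul =
    (TensorProduct.assoc k A H H).symm.toLinearMap ∘ₗ LinearMap.lTensor A Coalgebra.comul ∘ₗ
      galoisMap γ := by
  refine comodule_tmul_hom_ext fun n x b hx m c hc j u v => ?_
  simp only [LinearMap.comp_apply, hγ.galoisMap_apply hx hc, LinearMap.lTensor_tmul, map_sum,
    hc.comul_apply, TensorProduct.tmul_sum, LinearEquiv.coe_coe, TensorProduct.assoc_symm_tmul,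
    LinearMap.rTensor_tmul, TensorProduct.sum_tmul, map_smul, TensorProduct.smul_tmul',
    Finset.smul_sum]
  rw [sum_rotate₄]

/-- The map `h ↦ (id ⊗ ε)(Θ⁻¹(1 ⊗ h))`, for an automorphism `Θ` of `A ⊗ H`. -/
def galoisCompanion (Ψ : A ⊗[k] H →ₗ[k] A ⊗[k] H) : H →ₗ[k] A :=
  idCounit k H A ∘ₗ Ψ ∘ₗ TensorProduct.mk k A H 1

theorem rTensor_idCounit_coactLeft {M : Type u} [AddCommGroup M] [Module k M] [RightComodule k H M]
    (t : M ⊗[k] H) :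
    LinearMap.rTensor H (idCounit k H M) (coactLeft k H M t) =
      coaction k H M (idCounit k H M t) := by
  induction t with
  | zero => simp
  | add x y hx hy => simp only [map_add, hx, hy]
  | tmul m h =>
    simp only [coactLeft, idCounit, LinearMap.comp_apply, LinearMap.rTensor_tmul,
      LinearMap.lTensor_tmul, LinearEquiv.coe_coe, TensorProduct.rid_tmul, map_smul]
    generalize coaction k H M m = s
    induction s with
    | zero => simp
    | add x y hx hy => simp only [TensorProduct.add_tmul, map_add, smul_add, hx, hy]
    | tmul x y => simp [TensorProduct.smul_tmul']

theorem rTensor_idCounit_comul {V : Type u} [AddCommGroup V] [Module k V] (t : V ⊗[k] H) :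
    LinearMap.rTensor H (idCounit k H V) ((TensorProduct.assoc k V H H).symm
      (LinearMap.lTensor V Coalgebra.comul t)) = t := by
  have : LinearMap.rTensor H (idCounit k H V) ∘ₗ (TensorProduct.assoc k V H H).symm.toLinearMap ∘ₗ
      LinearMap.lTensor V Coalgebra.comul = LinearMap.id :=
    TensorProduct.ext <| LinearMap.ext fun m => coalgebra_hom_ext (k := k) fun n c hc u v => by
      simp [hc.comul_apply, hc.counit_apply, TensorProduct.tmul_sum, idCounit, Matrix.one_apply,
        ite_smul, TensorProduct.ite_tmul]
  exact LinearMap.congr_fun this t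

/-! ### The companion map obtained from an inverse of the Galois map -/

section Inverse

variable {γ : H →ₗ[k] A} {Ψ : A ⊗[k] H →ₗ[k] A ⊗[k] H} {c : Matrix l l H}

/-- The Galois map sends the right-hand side to the twisted product of `a` with `1 ⊗ h`, which is `a
⊗ h`. -/
theorem IsColinear.inverse_tmul (hγ : IsColinear γ) (h1 : ∀ t, Ψ (galoisMap γ t) = t)
    (h2 : ∀ t, galoisMap γ (Ψ t) = t) (a : A) (h : H) :
    Ψ (a ⊗ₜ h) = LinearMap.rTensor H (LinearMap.mulLeft k a) (Ψ ((1 : A) ⊗ₜ h)) := by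
  rw [← h1 (LinearMap.rTensor H (LinearMap.mulLeft k a) (Ψ ((1 : A) ⊗ₜ h))), hγ.galoisMap_mul, h2,
    twistedMul_one_tmul]

/-- The inverse is colinear in the last factor, and a colinear map into `A ⊗ H` is determined by its
composite with `id ⊗ ε`. -/
theorem IsColinear.inverse_one_tmul (hγ : IsColinear γ) (h1 : ∀ t, Ψ (galoisMap γ t) = t)
    (h2 : ∀ t, galoisMap γ (Ψ t) = t) (hc : IsComatrix k c) (u v : l) :
    Ψ ((1 : A) ⊗ₜ c u v) = ∑ p, galoisCompanion Ψ (c u p) ⊗ₜ[k] c p v := by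
  have hΨ : Ψ ∘ₗ galoisMap γ = LinearMap.id := LinearMap.ext h1
  have e := LinearMap.congr_fun hγ.rTensor_galoisMap_comul (Ψ ((1 : A) ⊗ₜ c u v))
  replace e := congrArg (LinearMap.rTensor H Ψ) e
  simp only [LinearMap.comp_apply, h2] at e
  rw [← LinearMap.rTensor_comp_apply, hΨ, LinearMap.rTensor_id, LinearMap.id_apply] at e
  replace e := congrArg (LinearMap.rTensor H (idCounit k H A)) e
  rw [LinearEquiv.coe_coe, rTensor_idCounit_comul] at e
  rw [e]
  simp [hc.comul_apply, TensorProduct.tmul_sum, galoisCompanion]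

theorem IsColinear.inverse_apply (hγ : IsColinear γ) (h1 : ∀ t, Ψ (galoisMap γ t) = t)
    (h2 : ∀ t, galoisMap γ (Ψ t) = t) (hc : IsComatrix k c) (a : A) (u v : l) :
    Ψ (a ⊗ₜ c u v) = ∑ p, (a * galoisCompanion Ψ (c u p)) ⊗ₜ[k] c p v := by
  rw [hγ.inverse_tmul h1 h2, hγ.inverse_one_tmul h1 h2 hc, map_sum]
  rfl

/-- The inverse transports `coactAntipode` to `coactLeft`. At `1 ⊗ h` the former is `(1 ⊗ h₂) ⊗
S(h₁)`, and applying `id ⊗ ε` gives the claim. -/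
theorem IsColinear.galoisCompanion_anticolinear (hγ : IsColinear γ)
    (h1 : ∀ t, Ψ (galoisMap γ t) = t) (h2 : ∀ t, galoisMap γ (Ψ t) = t) :
    IsAnticolinear (galoisCompanion Ψ) := by
  have hΨ : Ψ ∘ₗ galoisMap γ = LinearMap.id := LinearMap.ext h1
  have e1 : ∀ t, coactLeft k H A (Ψ t) = LinearMap.rTensor H Ψ (coactAntipode k H A t) := by
    intro t
    have e := congrArg (LinearMap.rTensor H Ψ)
      (LinearMap.congr_fun hγ.coactAntipode_galoisMap (Ψ t))
    simp only [LinearMap.comp_apply, h2] at e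
    rw [← LinearMap.rTensor_comp_apply, hΨ, LinearMap.rTensor_id, LinearMap.id_apply] at e
    exact e.symm
  have e2 : coaction k H A ∘ₗ galoisCompanion Ψ = TensorProduct.map (galoisCompanion Ψ) S ∘ₗ
      (TensorProduct.comm k H H).toLinearMap ∘ₗ Coalgebra.comul := by
    refine coalgebra_hom_ext (k := k) fun n c hc u v => ?_
    have hx := isComoduleFamily_one (k := k) (H := H) (A := A)
    have e3 := (hx.coactAntipode_apply hc () u v).trans (Fintype.sum_unique _)
    simp only [LinearMap.comp_apply, hc.comul_apply, map_sum, LinearEquiv.coe_coe,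
      TensorProduct.comm_tmul, TensorProduct.map_tmul]
    refine (rTensor_idCounit_coactLeft (Ψ ((1 : A) ⊗ₜ c u v))).symm.trans ?_
    rw [e1, e3, map_sum, map_sum]
    simp only [one_mul]
    rfl
  exact LinearMap.congr_fun e2

theorem IsColinear.mul_galoisCompanion (hγ : IsColinear γ)
    (h1 : ∀ t, Ψ (galoisMap γ t) = t) (h2 : ∀ t, galoisMap γ (Ψ t) = t) (hc : IsComatrix k c)
    (u v : l) :
    ∑ p, ∑ q, beta (k := k) (c p q) • (γ (c u p) * galoisCompanion Ψ (c q v)) =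
      (1 : Matrix l l k) u v • (1 : A) := by
  have e := congrArg (idCounit k H A) (h1 ((1 : A) ⊗ₜ c u v))
  simp only [hγ.galoisMap_one_tmul hc, map_sum, map_smul, hγ.inverse_apply h1 h2 hc] at e
  simpa [idCounit, hc.counit_apply, Matrix.one_apply, ite_smul] using e

/-- This is `id ⊗ ε` applied to `Θ(Ψ(1 ⊗ h)) = 1 ⊗ h`, where `Θ = galoisMap γ`. The products `δγ`
still carry the weight `η`. -/
theorem IsColinear.sum_eta_galoisCompanion_mul (hγ : IsColinear γ)
    (h1 : ∀ t, Ψ (galoisMap γ t) = t) (h2 : ∀ t, galoisMap γ (Ψ t) = t) (hc : IsComatrix k c)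
    (u v : l) :
    ∑ m, ∑ p, eta k H (S (k := k) (c u m) ⊗ₜ c p v) •
      ∑ r, galoisCompanion Ψ (c m r) * γ (c r p) = (1 : Matrix l l k) u v • (1 : A) := by
  have hδ := hγ.galoisCompanion_anticolinear h1 h2
  have e := congrArg (idCounit k H A) (h2 ((1 : A) ⊗ₜ c u v))
  have e' : ∀ r, galoisMap γ (galoisCompanion Ψ (c u r) ⊗ₜ c r v) = _ := fun r =>
    hγ.galoisMap_apply (hδ.isComoduleFamily hc r) hc u r v
  simp only [hγ.inverse_one_tmul h1 h2 hc, map_sum, e', map_smul] at e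
  simp only [Finset.smul_sum]
  rw [← sum_rotate₃]
  simpa [idCounit, hc.counit_apply, Matrix.one_apply, ite_smul, antipodeMatrix_apply] using e

/-- The weight `η` in the previous identity is removed by `ζ`. Since the coaction of the products `X
= δγ` is known, pairing it with `ζ` and applying `sum_zeta_mul_eta` isolates a single `X u v`. -/
theorem IsColinear.galoisCompanion_mul (hγ : IsColinear γ)
    (h1 : ∀ t, Ψ (galoisMap γ t) = t) (h2 : ∀ t, galoisMap γ (Ψ t) = t) (hc : IsComatrix k c)
    (u v : l) :
    ∑ m, galoisCompanion Ψ (c u m) * γ (c m v) = alpha (k := k) (c u v) • (1 : A) := by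
  have hδ := hγ.galoisCompanion_anticolinear h1 h2
  set X : l → l → A := fun u v => ∑ m, galoisCompanion Ψ (c u m) * γ (c m v) with hX
  have hco : ∀ u v, coaction k H A (X u v) =
      ∑ m, ∑ p, X m p ⊗ₜ[k] (S (k := k) (c u m) * c p v) := by
    intro u v
    have e : ∀ r, coaction k H A (galoisCompanion Ψ (c u r) * γ (c r v)) = _ := fun r =>
      (hδ.isComoduleFamily hc r).coaction_mul_apply (hγ.isComoduleFamily hc r) u v
    simp only [hX, map_sum, e, TensorProduct.sum_tmul]
    rw [sum_rotate₃]
    rfl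
  have hE : ∀ u v, ∑ m, ∑ p, eta k H (S (k := k) (c u m) ⊗ₜ c p v) • X m p =
      (1 : Matrix l l k) u v • (1 : A) := hγ.sum_eta_galoisCompanion_mul h1 h2 hc
  -- The map `F q` is `a ↦ a₀ ζ(a₁, c q v)`. On the right-hand side of `hE` it produces `ζ(1, h) =
  -- α(h)`.
  let F : l → A →ₗ[k] A := fun q => (TensorProduct.rid k A).toLinearMap ∘ₗ
    LinearMap.lTensor A (zeta k H ∘ₗ (TensorProduct.mk k H H).flip (c q v)) ∘ₗ coaction k H A
  have hF : ∀ q m p, F q (X m p) =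
      ∑ m', ∑ p', zeta k H ((S (k := k) (c m m') * c p' p) ⊗ₜ c q v) • X m' p' := by
    intro q m p
    simp [F, hco]
  have hF1 : ∀ q, F q 1 = zeta k H ((1 : H) ⊗ₜ c q v) • (1 : A) := by
    intro q
    simp [F, mem_coinvariants.1 (one_mem_coinvariants (k := k) (H := H) (A := A))]
  have hL : ∑ q, ∑ m, ∑ p, ∑ m', ∑ p', (zeta k H ((antipodeMatrix k c m' m * c p' p) ⊗ₜ c q v) *
      eta k H (antipodeMatrix k c m u ⊗ₜ c p q)) • X m' p' = alpha (k := k) (c u v) • (1 : A) := by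
    have := Finset.sum_congr rfl fun q (_ : q ∈ Finset.univ) => congrArg (F q) (hE u q)
    simp only [map_sum, map_smul, hF, hF1, Finset.smul_sum, smul_smul, mul_comm (eta k H _)] at this
    refine this.trans ?_
    simp [Matrix.one_apply, ite_smul, hc.zeta_apply, omega_one_left, hc.counit_apply, counit_S]
  have hR : ∀ m' p', ∑ m, ∑ p, ∑ q, zeta k H ((antipodeMatrix k c m' m * c p' p) ⊗ₜ c q v) *
      eta k H (antipodeMatrix k c m u ⊗ₜ c p q) = (1 : Matrix l l k) m' u * (1 : Matrix l l k) p' v :=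
    fun m' p' => sum_zeta_mul_eta hc.antipode hc m' u p' v
  rw [← hL, sum_rotate₅]
  conv_rhs => enter [2, m]; rw [sum_rotate₃]
  rw [sum_rotate₃]
  simp only [← Finset.sum_smul, hR]
  simp [Matrix.one_apply, ite_smul, hX]

theorem IsNormalBasis.isCleft_of_isGalois (hγ : IsNormalBasis γ) (h : IsGalois k H A) :
    IsCleft k H A := by
  let e := LinearEquiv.ofBijective (galoisMap γ) (hγ.isGalois_iff.1 h)
  have h1 : ∀ t, e.symm.toLinearMap (galoisMap γ t) = t := e.symm_apply_apply
  have h2 : ∀ t, galoisMap γ (e.symm.toLinearMap t) = t := e.apply_symm_apply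
  refine isCleft_iff.2 ⟨γ, galoisCompanion e.symm.toLinearMap, hγ.colinear,
    hγ.colinear.galoisCompanion_anticolinear h1 h2, LinearMap.congr_fun
      (f := LinearMap.mul' k A ∘ₗ TensorProduct.map _ γ ∘ₗ Coalgebra.comul)
      (g := LinearMap.toSpanSingleton k A 1 ∘ₗ alpha) ?_, LinearMap.congr_fun
      (f := LinearMap.mul' k A ∘ₗ TensorProduct.map (γ ∘ₗ hitLeft beta) _ ∘ₗ Coalgebra.comul)
      (g := LinearMap.toSpanSingleton k A 1 ∘ₗ Coalgebra.counit) ?_⟩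
  · refine coalgebra_hom_ext (k := k) fun n c hc i j => (hc.mul_map _ _ i j).trans ?_
    exact hγ.colinear.galoisCompanion_mul h1 h2 hc i j
  · refine coalgebra_hom_ext (k := k) fun n c hc i j => (hc.mul_map_hitLeft _ _ i j).trans ?_
    rw [hγ.colinear.mul_galoisCompanion h1 h2 hc, ← hc.counit_apply]
    rfl

end Inverse

end GaloisMap

/-! ### The relative Hopf module `H ⊗ A` -/

section Cofree

open CoquasiBialgebra

variable {k : Type w} {H : Type u} [Field k] [NonAssocRing H] [Module k H]
  [IsScalarTower k H H] [SMulCommClass k H H] [CoquasiBialgebra k H]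
  {A : Type u} [NonAssocRing A] [Module k A] [IsScalarTower k A A] [SMulCommClass k A A]
  [ComoduleAlgebra k H A]
  {ι κ l μ : Type*} [Fintype ι] [DecidableEq ι] [Fintype κ] [DecidableEq κ] [Fintype l]
  [DecidableEq l] [Fintype μ] [DecidableEq μ]

theorem tmul_comodule_hom_ext {V : Type*} [AddCommGroup V] [Module k V] {f g : H ⊗[k] A →ₗ[k] V}
    (h : ∀ (n : ℕ) (c : Matrix (Fin n) (Fin n) H), IsComatrix k c →
      ∀ (m : ℕ) (x : Fin m → A) (a : Matrix (Fin m) (Fin m) H), IsComoduleFamily k x a →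
      ∀ i j p, f (c i j ⊗ₜ x p) = g (c i j ⊗ₜ x p)) : f = g :=
  TensorProduct.ext <| coalgebra_hom_ext (k := k) fun n c hc i j =>
    comodule_hom_ext (k := k) (H := H) fun m x a hx p => h n c hc m x a hx i j p

variable (k H A) in
/-- `h ⊗ a ↦ h₁ ⊗ a₀ ⊗ h₂ a₁`. -/
def cofreeCoact : H ⊗[k] A →ₗ[k] (H ⊗[k] A) ⊗[k] H :=
  LinearMap.lTensor (H ⊗[k] A) (LinearMap.mul' k H) ∘ₗ
    (TensorProduct.tensorTensorTensorComm k H H A H).toLinearMap ∘ₗ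
    TensorProduct.map Coalgebra.comul (coaction k H A)

variable (k H A) in
/-- `(h ⊗ a) b = h₁ ⊗ a₀ b₀ ω(h₂, a₁, b₁)`. -/
def cofreeAct : H ⊗[k] A →ₗ[k] A →ₗ[k] H ⊗[k] A :=
  TensorProduct.curry (omegaTwist (LinearMap.lTensor H (LinearMap.mul' k A)) ∘ₗ
    TensorProduct.map Coalgebra.comul (TensorProduct.map (coaction k H A) (coaction k H A)) ∘ₗ
    (TensorProduct.assoc k H A A).toLinearMap)

variable {b : Matrix ι ι H} {x : κ → A} {a : Matrix κ κ H} {y : l → A} {c : Matrix l l H}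
  {z : μ → A} {d : Matrix μ μ H}

theorem IsComatrix.cofreeCoact_apply (hb : IsComatrix k b) (hx : IsComoduleFamily k x a) (i j : ι)
    (p : κ) : cofreeCoact k H A (b i j ⊗ₜ x p) =
      ∑ j', ∑ p', (b i j' ⊗ₜ[k] x p') ⊗ₜ[k] (b j' j * a p' p) := by
  rw [Finset.sum_comm]
  simp [cofreeCoact, hb.comul_apply, hx.coaction_apply, TensorProduct.sum_tmul,
    TensorProduct.tmul_sum]

theorem IsComatrix.cofreeAct_apply (hb : IsComatrix k b) (hx : IsComoduleFamily k x a)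
    (hy : IsComoduleFamily k y c) (i j : ι) (p : κ) (q : l) :
    cofreeAct k H A (b i j ⊗ₜ x p) (y q) = ∑ j', ∑ p', ∑ q',
      omega (k := k) (b j' j ⊗ₜ (a p' p ⊗ₜ c q' q)) • (b i j' ⊗ₜ[k] (x p' * y q')) := by
  simp only [cofreeAct, TensorProduct.curry_apply, LinearMap.comp_apply, LinearEquiv.coe_coe,
    TensorProduct.assoc_tmul, TensorProduct.map_tmul, hb.comul_apply, hx.coaction_apply,
    hy.coaction_apply, TensorProduct.sum_tmul, TensorProduct.tmul_sum, map_sum, omegaTwist_tmul,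
    LinearMap.lTensor_tmul, LinearMap.mul'_apply]
  rw [sum_rotate₃, Finset.sum_comm]

/-- Quasi-associativity of `H` is what makes the action on `H ⊗ A` colinear. -/
theorem IsComatrix.sum_quasi_assoc (hb : IsComatrix k b) (ha : IsComatrix k a)
    (hc : IsComatrix k c) (i j : ι) (p p' : κ) (q q' : l) :
    ∑ i'', ∑ p'', ∑ q'', omega (k := k) (b i'' j ⊗ₜ (a p'' p' ⊗ₜ c q'' q')) •
        (b i i'' * (a p p'' * c q q'')) =
      ∑ i'', ∑ p'', ∑ q'', omega (k := k) (b i i'' ⊗ₜ (a p p'' ⊗ₜ c q q'')) •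
        ((b i'' j * a p'' p') * c q'' q') := by
  have h := LinearMap.congr_fun (CoquasiBialgebra.quasi_assoc (k := k) (H := H))
    (tmulMatrix (k := k) b (tmulMatrix (k := k) a c) (i, p, q) (j, p', q'))
  simp only [LinearMap.comp_apply, (hb.tmul (ha.tmul hc)).comul_apply, map_sum,
    Fintype.sum_prod_type] at h
  simpa [mulRight₃, mulLeft₃, tmulMatrix] using h

/-- The cocycle condition is what makes the action on `H ⊗ A` quasi-associative. -/
theorem IsComatrix.sum_cocycle (hb : IsComatrix k b) (ha : IsComatrix k a)
    (hc : IsComatrix k c) (hd : IsComatrix k d) (i j : ι) (p p' : κ) (q q' : l) (r r' : μ) :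
    ∑ p'', ∑ q'', ∑ r'', ∑ i₁, ∑ p₁, ∑ q₁, omega (k := k) (b i₁ j ⊗ₜ (a p₁ p' ⊗ₜ c q₁ q')) *
        (omega (k := k) (b i i₁ ⊗ₜ ((a p'' p₁ * c q'' q₁) ⊗ₜ d r'' r')) *
          omega (k := k) (a p p'' ⊗ₜ (c q q'' ⊗ₜ d r r''))) =
      ∑ i'', ∑ p'', ∑ q'', ∑ r'', omega (k := k) ((b i'' j * a p'' p') ⊗ₜ (c q'' q' ⊗ₜ d r'' r')) *
        omega (k := k) (b i i'' ⊗ₜ (a p p'' ⊗ₜ (c q q'' * d r r''))) := by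
  have hT := hb.tmul (ha.tmul (hc.tmul hd))
  have h := congrArg (fun f => (tmulMatrix (k := k) b (tmulMatrix (k := k) a
    (tmulMatrix (k := k) c d))).map f.ofConv) (CoquasiBialgebra.cocycle (k := k) (H := H))
  rw [mul_assoc] at h
  simp only [hT.map_convMul] at h
  replace h := congrFun (congrFun h (i, p, q, r)) (j, p', q', r')
  simp only [Matrix.mul_apply, Fintype.sum_prod_type, Matrix.map_apply, tmulMatrix, mulLast,
    mulFirst, mulMiddle, counitTimes, timesCounit, LinearMap.comp_apply, LinearMap.lTensor_tmul,
    LinearMap.rTensor_tmul, LinearEquiv.coe_coe, TensorProduct.assoc_symm_tmul,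
    TensorProduct.map_tmul, LinearMap.mul'_apply, hb.counit_apply, hd.counit_apply,
    Matrix.one_apply, mul_ite, ite_mul, mul_one, one_mul, mul_zero, zero_mul,
    Finset.sum_ite_irrel, Finset.sum_const_zero, Finset.sum_ite_eq', Finset.sum_ite_eq,
    Finset.mem_univ, if_true, Finset.mul_sum] at h
  refine Eq.trans ?_ (h.symm.trans ?_)
  · exact Finset.sum_congr rfl fun _ _ => Finset.sum_congr rfl fun _ _ => Finset.sum_congr rfl
      fun _ _ => Finset.sum_congr rfl fun _ _ => Finset.sum_congr rfl fun _ _ =>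
      Finset.sum_congr rfl fun _ _ => by ring
  · exact Finset.sum_congr rfl fun _ _ => Finset.sum_congr rfl fun _ _ => Finset.sum_congr rfl
      fun _ _ => Finset.sum_congr rfl fun _ _ => mul_comm _ _

theorem cofreeCoact_coassoc :
    (TensorProduct.assoc k (H ⊗[k] A) H H).toLinearMap ∘ₗ
      LinearMap.rTensor H (cofreeCoact k H A) ∘ₗ cofreeCoact k H A =
    LinearMap.lTensor (H ⊗[k] A) Coalgebra.comul ∘ₗ cofreeCoact k H A := by
  refine tmul_comodule_hom_ext fun n b hb m x a hx i j p => ?_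
  have h : ∀ j' p', Coalgebra.comul (R := k) (b j' j * a p' p) = _ := fun j' p' =>
    ((hb.mul hx.isComatrix).comul_apply (j', p') (j, p)).trans (Fintype.sum_prod_type _)
  simp only [LinearMap.comp_apply, hb.cofreeCoact_apply hx, map_sum, LinearMap.rTensor_tmul,
    LinearMap.lTensor_tmul, TensorProduct.sum_tmul, TensorProduct.tmul_sum, LinearEquiv.coe_coe,
    TensorProduct.assoc_tmul, h, mulMatrix]
  conv_lhs => enter [2, j']; rw [sum_rotate₃]
  conv_lhs => rw [sum_rotate₃]

theorem cofreeCoact_counit :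
    (TensorProduct.rid k (H ⊗[k] A)).toLinearMap ∘ₗ
      LinearMap.lTensor (H ⊗[k] A) Coalgebra.counit ∘ₗ cofreeCoact k H A = LinearMap.id := by
  refine tmul_comodule_hom_ext fun n b hb m x a hx i j p => ?_
  simp [hb.cofreeCoact_apply hx, counit_mul, hb.counit_apply, hx.isComatrix.counit_apply,
    Matrix.one_apply, ite_smul]

theorem cofreeCoact_cofreeAct (t : H ⊗[k] A) (e : A) :
    cofreeCoact k H A (cofreeAct k H A t e) =
      TensorProduct.map (TensorProduct.lift (cofreeAct k H A)) (LinearMap.mul' k H)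
        (TensorProduct.tensorTensorTensorComm k (H ⊗[k] A) H A H
          (cofreeCoact k H A t ⊗ₜ coaction k H A e)) := by
  have h : (cofreeAct k H A).compr₂ (cofreeCoact k H A) =
      TensorProduct.curry (TensorProduct.map (TensorProduct.lift (cofreeAct k H A)) (LinearMap.mul' k H) ∘ₗ
        (TensorProduct.tensorTensorTensorComm k (H ⊗[k] A) H A H).toLinearMap ∘ₗ
        TensorProduct.map (cofreeCoact k H A) (coaction k H A)) := by
    refine tmul_comodule_hom_ext fun n b hb m x a hx i j p =>
      comodule_hom_ext (k := k) (H := H) fun m' y c hy q => ?_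
    have e1 : ∀ j' p' q', cofreeCoact k H A (b i j' ⊗ₜ (x p' * y q')) = _ := fun j' p' q' =>
      (hb.cofreeCoact_apply (hx.hopfAct_prod hy) i j' (p', q')).trans
        (Finset.sum_congr rfl fun _ _ => Fintype.sum_prod_type _)
    simp only [LinearMap.compr₂_apply, hb.cofreeAct_apply hx hy, map_sum, map_smul, e1,
      TensorProduct.curry_apply, LinearMap.comp_apply, TensorProduct.map_tmul,
      hb.cofreeCoact_apply hx, hy.coaction_apply, LinearEquiv.coe_coe, TensorProduct.sum_tmul,
      TensorProduct.tmul_sum, TensorProduct.tensorTensorTensorComm_tmul, TensorProduct.lift.tmul,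
      LinearMap.mul'_apply, mulMatrix, hopfAct_self, Finset.smul_sum,
      ← TensorProduct.smul_tmul']
    conv_lhs => rw [sum_comm₃₃]
    conv_rhs => rw [sum_rotate₃, sum_comm₃₃]
    simp only [← TensorProduct.tmul_smul, ← TensorProduct.tmul_sum,
      hb.sum_quasi_assoc hx.isComatrix hy.isComatrix]
  exact LinearMap.congr_fun (LinearMap.congr_fun h t) e

theorem cofreeAct_one (t : H ⊗[k] A) : cofreeAct k H A t 1 = t := by
  have h1 := isComoduleFamily_one (k := k) (H := H) (A := A)
  have h : (cofreeAct k H A).flip 1 = LinearMap.id := by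
    refine tmul_comodule_hom_ext fun n b hb m x a hx i j p => ?_
    refine (hb.cofreeAct_apply hx h1 i j p ()).trans ?_
    simp [omega_one_right, hb.counit_apply, hx.isComatrix.counit_apply, Matrix.one_apply, ite_smul]
  exact LinearMap.congr_fun h t

set_option maxHeartbeats 400000 in
theorem cofreeAct_cofreeAct (t : H ⊗[k] A) (e f : A) :
    cofreeAct k H A (cofreeAct k H A t e) f =
      omegaTwist (TensorProduct.lift (cofreeAct k H A) ∘ₗ
        LinearMap.lTensor (H ⊗[k] A) (LinearMap.mul' k A))
        (cofreeCoact k H A t ⊗ₜ (coaction k H A e ⊗ₜ coaction k H A f)) := by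
  have h : TensorProduct.curry (TensorProduct.curry (TensorProduct.lift (cofreeAct k H A) ∘ₗ
        LinearMap.rTensor A (TensorProduct.lift (cofreeAct k H A)))) =
      TensorProduct.curry (TensorProduct.curry (omegaTwist (TensorProduct.lift (cofreeAct k H A) ∘ₗ
        LinearMap.lTensor (H ⊗[k] A) (LinearMap.mul' k A)) ∘ₗ
        TensorProduct.map (cofreeCoact k H A)
          (TensorProduct.map (coaction k H A) (coaction k H A)) ∘ₗ
        (TensorProduct.assoc k (H ⊗[k] A) A A).toLinearMap)) := by
    refine tmul_comodule_hom_ext fun n b hb m x a hx i j p =>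
      comodule_hom_ext (k := k) (H := H) fun m' y c hy q => 
      comodule_hom_ext (k := k) (H := H) fun m'' z d hz r => ?_
    have e1 : ∀ j' p' q', cofreeAct k H A (b i j' ⊗ₜ (x p' * y q')) (z r) = _ := fun j' p' q' =>
      (hb.cofreeAct_apply (hx.hopfAct_prod hy) hz i j' (p', q') r).trans
        (Finset.sum_congr rfl fun _ _ => Fintype.sum_prod_type _)
    have e2 : ∀ j' p' q' r', cofreeAct k H A (b i j' ⊗ₜ x p') (y q' * z r') = _ :=
      fun j' p' q' r' =>
      (hb.cofreeAct_apply hx (hy.hopfAct_prod hz) i j' p' (q', r')).trans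
        (Finset.sum_congr rfl fun _ _ => Finset.sum_congr rfl fun _ _ => Fintype.sum_prod_type _)
    have e3 : ∀ p' q' r', (x p' * y q') * z r' = _ := fun p' q' r' =>
      hx.mul_mul_apply hy hz p' q' r'
    simp only [TensorProduct.curry_apply, LinearMap.compr₂_apply, TensorProduct.mk_apply,
      LinearMap.comp_apply, LinearMap.rTensor_tmul, TensorProduct.lift.tmul,
      hb.cofreeAct_apply hx hy, map_sum, map_smul, LinearMap.sum_apply, LinearMap.smul_apply, e1,
      LinearEquiv.coe_coe, TensorProduct.assoc_tmul, TensorProduct.map_tmul,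
      hb.cofreeCoact_apply hx, hy.coaction_apply, hz.coaction_apply, TensorProduct.sum_tmul,
      TensorProduct.tmul_sum, omegaTwist_tmul, LinearMap.lTensor_tmul, LinearMap.mul'_apply, e2,
      hopfAct_self, mulMatrix, e3, TensorProduct.tmul_smul, Finset.smul_sum, smul_smul]
    conv_rhs => enter [2, s]; rw [sum_rotate₃]
    conv_rhs => rw [sum_rotate₄, sum_comm₄₄]
    conv_lhs => rw [sum_comm₃₄]
    conv_lhs => enter [2, j₀, 2, p₁, 2, q₁, 2, r₁]; rw [sum_comm₃₃]
    conv_lhs => enter [2, j₀]; rw [sum_comm₃₃]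
    simp only [← Finset.sum_smul, hb.sum_cocycle hx.isComatrix hy.isComatrix hz.isComatrix]
  exact LinearMap.congr_fun (LinearMap.congr_fun (LinearMap.congr_fun h t) e) f

/-- The relative Hopf module `H ⊗ A`. -/
scoped instance cofreeHopfModule : RelHopfModule k H A (H ⊗[k] A) where
  coact := cofreeCoact k H A
  coassoc := cofreeCoact_coassoc
  coact_counit := cofreeCoact_counit
  act := cofreeAct k H A
  act_one := cofreeAct_one
  act_act := cofreeAct_cofreeAct
  coact_act := cofreeCoact_cofreeAct

end Cofree

/-! ### From the Weak Structure Theorem to a companion map -/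

section Translation

open CoquasiBialgebra CoquasiHopfAlgebra

variable {k : Type w} {H : Type u} [Field k] [NonAssocRing H] [Module k H]
  [IsScalarTower k H H] [SMulCommClass k H H]

theorem tensor_ext_dual {V W : Type*} [AddCommGroup V] [Module k V] [AddCommGroup W] [Module k W]
    {s t : V ⊗[k] W} (h : ∀ f : V →ₗ[k] k, TensorProduct.lid k W (LinearMap.rTensor W f s) =
      TensorProduct.lid k W (LinearMap.rTensor W f t)) : s = t := by
  classical
  let b := Module.Basis.ofVectorSpace k V
  refine (TensorProduct.equivFinsuppOfBasisLeft b).injective (Finsupp.ext fun i => ?_)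
  rw [TensorProduct.equivFinsuppOfBasisLeft_apply, TensorProduct.equivFinsuppOfBasisLeft_apply, h]

variable [CoquasiHopfAlgebra k H]
  {A : Type u} [NonAssocRing A] [Module k A] [IsScalarTower k A A] [SMulCommClass k A A]
  [ComoduleAlgebra k H A]
  {ι κ l μ : Type*} [Fintype ι] [DecidableEq ι] [Fintype κ] [DecidableEq κ] [Fintype l]
  [DecidableEq l] [Fintype μ] [DecidableEq μ]

theorem coaction_coinvActMap {M : Type u} [AddCommGroup M] [Module k M] [RelHopfModule k H A M]
    {γ : H →ₗ[k] A} (hγ : IsColinear γ) (t : coinvariants k H M ⊗[k] H) :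
    coaction k H M (coinvActMap M γ t) =
      LinearMap.rTensor H (coinvActMap M γ) ((TensorProduct.assoc k (coinvariants k H M) H H).symm
        (LinearMap.lTensor (coinvariants k H M) Coalgebra.comul t)) := by
  induction t with
  | zero => simp
  | add x y hx hy => simp only [map_add, hx, hy]
  | tmul m h =>
    rw [coinvActMap_tmul, coaction_hopfAct_coe, hγ, LinearMap.lTensor_tmul]
    generalize Coalgebra.comul (R := k) h = s
    induction s with
    | zero => simp
    | add x y hx hy => simp only [TensorProduct.tmul_add, map_add, hx, hy]
    | tmul x y => rfl

variable (k H A) in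
/-- `h ⊗ a ↦ ε(h) a`. -/
def counitLeft : H ⊗[k] A →ₗ[k] A :=
  (TensorProduct.lid k A).toLinearMap ∘ₗ LinearMap.rTensor A Coalgebra.counit

theorem counitLeft_tmul (h : H) (a : A) :
    counitLeft k H A (h ⊗ₜ a) = Coalgebra.counit (R := k) h • a := rfl

theorem counitLeft_rTensor (f : H →ₗ[k] H) (t : H ⊗[k] A) :
    counitLeft k H A (LinearMap.rTensor A f t) =
      TensorProduct.lid k A (LinearMap.rTensor A (Coalgebra.counit ∘ₗ f) t) := by
  rw [LinearMap.rTensor_comp_apply]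
  rfl

theorem idCounit_rTensor {V W : Type u} [AddCommGroup V] [Module k V] [AddCommGroup W] [Module k W]
    (f : V →ₗ[k] W) (t : V ⊗[k] H) :
    idCounit k H W (LinearMap.rTensor H f t) = f (idCounit k H V t) := by
  induction t with
  | zero => simp
  | add x y hx hy => simp only [map_add, hx, hy]
  | tmul x y => simp [idCounit]

theorem counit_hitRight (f : H →ₗ[k] k) :
    (Coalgebra.counit (R := k) (A := H)) ∘ₗ hitRight f = f := by
  refine coalgebra_hom_ext (k := k) fun n c hc i j => ?_
  simp [hc.hitRight_apply, hc.counit_apply, Matrix.one_apply]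

/-- The maps `h ↦ f(h₁) h₂` commute with the right comultiplication, so they induce colinear
endomorphisms of `H ⊗ A`. They also respect the action, hence commute with everything natural in
relative Hopf modules. -/
theorem cofreeCoact_hitRight (f : H →ₗ[k] k) (t : H ⊗[k] A) :
    coaction k H (H ⊗[k] A) (LinearMap.rTensor A (hitRight f) t) =
      LinearMap.rTensor H (LinearMap.rTensor A (hitRight f)) (coaction k H (H ⊗[k] A) t) := by
  have : cofreeCoact k H A ∘ₗ LinearMap.rTensor A (hitRight f) =
      LinearMap.rTensor H (LinearMap.rTensor A (hitRight f)) ∘ₗ cofreeCoact k H A := by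
    refine tmul_comodule_hom_ext fun n b hb m x a hx i j p => ?_
    simp only [LinearMap.comp_apply, LinearMap.rTensor_tmul, hb.hitRight_apply,
      TensorProduct.sum_tmul, map_sum, ← TensorProduct.smul_tmul', map_smul, hb.cofreeCoact_apply hx,
      Finset.smul_sum]
    rw [sum_rotate₃]
  exact LinearMap.congr_fun this t

theorem cofreeAct_hitRight (f : H →ₗ[k] k) (t : H ⊗[k] A) (e : A) :
    LinearMap.rTensor A (hitRight f) (hopfAct (k := k) H t e) =
      hopfAct (k := k) H (LinearMap.rTensor A (hitRight f) t) e := by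
  have : (cofreeAct k H A).compr₂ (LinearMap.rTensor A (hitRight f)) =
      cofreeAct k H A ∘ₗ LinearMap.rTensor A (hitRight f) := by
    refine tmul_comodule_hom_ext fun n b hb m x a hx i j p =>
      comodule_hom_ext (k := k) (H := H) fun m' y c hy q => ?_
    simp only [LinearMap.compr₂_apply, hb.cofreeAct_apply hx hy, map_sum, map_smul,
      LinearMap.comp_apply, LinearMap.rTensor_tmul, hb.hitRight_apply, TensorProduct.sum_tmul,
      ← TensorProduct.smul_tmul', LinearMap.sum_apply, LinearMap.smul_apply, Finset.smul_sum,
      smul_comm (f _)]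
    rw [← sum_rotate₄]
  exact LinearMap.congr_fun (LinearMap.congr_fun this t) e

/-- The preimage of `h ⊗ 1` is `D(h₁) ⊗ h₂` by right colinearity. The endomorphisms `h ↦ f(h₁) h₂`
make `D` left colinear, so `D(h) = h₁ ⊗ d(h₂)` with `d = (ε ⊗ id) D`. -/
theorem IsColinear.exists_translation {γ : H →ₗ[k] A} (hγ : IsColinear γ)
    (hb : Function.Bijective (coinvActMap (H ⊗[k] A) γ)) : ∃ d : H →ₗ[k] A,
      ∀ (n : ℕ) (c : Matrix (Fin n) (Fin n) H), IsComatrix k c →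
        (∀ i j, ∑ m, c i m ⊗ₜ[k] d (c m j) ∈ coinvariants k H (H ⊗[k] A)) ∧
        ∀ i j, ∑ m, hopfAct (k := k) H (∑ n, c i n ⊗ₜ[k] d (c n m)) (γ (c m j)) =
          c i j ⊗ₜ[k] (1 : A) := by
  let e := LinearEquiv.ofBijective (coinvActMap (H ⊗[k] A) γ) hb
  let C := coinvariants k H (H ⊗[k] A)
  let D : H →ₗ[k] C := idCounit k H C ∘ₗ e.symm.toLinearMap ∘ₗ (TensorProduct.mk k H A).flip 1
  have hθ : ∀ t, coinvActMap (H ⊗[k] A) γ (e.symm t) = t := e.apply_symm_apply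
  have h1 : ∀ (n : ℕ) (c : Matrix (Fin n) (Fin n) H), IsComatrix k c → ∀ i j,
      e.symm (c i j ⊗ₜ (1 : A)) = ∑ m, D (c i m) ⊗ₜ[k] c m j := by
    intro n c hc i j
    have hx := isComoduleFamily_one (k := k) (H := H) (A := A)
    have e1 : coaction k H (H ⊗[k] A) (c i j ⊗ₜ (1 : A)) =
        ∑ m, (c i m ⊗ₜ[k] (1 : A)) ⊗ₜ[k] (c m j * 1) := (hc.cofreeCoact_apply hx i j ()).trans
      (Finset.sum_congr rfl fun _ _ => Fintype.sum_unique _)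
    have e2 := coaction_coinvActMap hγ (e.symm (c i j ⊗ₜ (1 : A)))
    have e3 : ∀ s, LinearMap.rTensor H e.symm.toLinearMap
        (LinearMap.rTensor H (coinvActMap (H ⊗[k] A) γ) s) = s := fun s => by
      rw [← LinearMap.rTensor_comp_apply, show e.symm.toLinearMap ∘ₗ coinvActMap (H ⊗[k] A) γ =
        LinearMap.id from LinearMap.ext e.symm_apply_apply, LinearMap.rTensor_id, LinearMap.id_apply]
    rw [hθ, e1] at e2
    replace e2 := congrArg (LinearMap.rTensor H (idCounit k H C))
      (congrArg (LinearMap.rTensor H e.symm.toLinearMap) e2)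
    rw [e3, rTensor_idCounit_comul] at e2
    rw [← e2, map_sum, map_sum]
    simp only [mul_one]
    rfl
  have h2 : ∀ (f : H →ₗ[k] k) (v : H),
      LinearMap.rTensor A (hitRight f) (D v : H ⊗[k] A) = (D (hitRight f v) : H ⊗[k] A) := by
    intro f v
    let g : C →ₗ[k] C := (LinearMap.rTensor A (hitRight f)).restrict fun m hm => by
      rw [mem_coinvariants, cofreeCoact_hitRight, mem_coinvariants.1 hm]
      rfl
    have e1 : coinvActMap (H ⊗[k] A) γ ∘ₗ LinearMap.rTensor H g =
        LinearMap.rTensor A (hitRight f) ∘ₗ coinvActMap (H ⊗[k] A) γ :=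
      TensorProduct.ext <| LinearMap.ext fun m => LinearMap.ext fun h =>
        (cofreeAct_hitRight f (m : H ⊗[k] A) (γ h)).symm
    have e2 : e.symm (hitRight f v ⊗ₜ (1 : A)) = LinearMap.rTensor H g (e.symm (v ⊗ₜ (1 : A))) := by
      rw [LinearEquiv.symm_apply_eq]
      have := LinearMap.congr_fun e1 (e.symm (v ⊗ₜ (1 : A)))
      rw [LinearMap.comp_apply, LinearMap.comp_apply, hθ] at this
      exact this.symm
    have e3 : D (hitRight f v) = g (D v) :=
      (congrArg (idCounit k H C) e2).trans (idCounit_rTensor g _)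
    rw [e3]
    rfl
  -- Two tensors agree if every functional `f` on `H` gives the same value. Since `f = ε ∘ hitRight
  -- f`, commutation of `D` with `hitRight f` rewrites that value through `(ε ⊗ id) D`.
  have h3 : ∀ (n : ℕ) (c : Matrix (Fin n) (Fin n) H), IsComatrix k c → ∀ i j,
      (D (c i j) : H ⊗[k] A) = ∑ m, c i m ⊗ₜ[k] counitLeft k H A (D (c m j)) := by
    intro n c hc i j
    refine tensor_ext_dual fun f => ?_
    have h4 : TensorProduct.lid k A (LinearMap.rTensor A f (D (c i j) : H ⊗[k] A)) =
        counitLeft k H A (D (hitRight f (c i j))) := by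
      rw [← h2, counitLeft_rTensor, counit_hitRight]
    rw [h4, hc.hitRight_apply]
    simp
  refine ⟨counitLeft k H A ∘ₗ C.subtype ∘ₗ D, fun n c hc => ⟨fun i j => ?_, fun i j => ?_⟩⟩
  · have := (D (c i j)).2
    rwa [h3 n c hc i j] at this
  · have := hθ (c i j ⊗ₜ (1 : A))
    rw [h1 n c hc, map_sum] at this
    refine Eq.trans (Finset.sum_congr rfl fun m _ => ?_) this
    exact congrArg (fun t => hopfAct (k := k) H t (γ (c m j))) (h3 n c hc i m).symm

/-- Coefficients of a translation map with respect to a comatrix and a comodule family. -/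
structure IsTranslationFamily (γ d : H →ₗ[k] A) (c : Matrix l l H) (x : κ → A) (a : Matrix κ κ H)
    (t : l → l → κ → k) : Prop where
  isComatrix : IsComatrix k c
  isComoduleFamily : IsComoduleFamily k x a
  map_apply : ∀ i j, d (c i j) = ∑ s, t i j s • x s
  sum_smul_mul : ∀ j i s', ∑ m, ∑ s, t m j s • (c i m * a s' s) = t i j s' • (1 : H)
  sum_mul : ∀ i j, ∑ m, ∑ n, ∑ s, ∑ s', ∑ r, (omega (k := k) (c i n ⊗ₜ (a s' s ⊗ₜ c r j)) *
    t n m s) • (x s' * γ (c m r)) = (1 : Matrix l l k) i j • (1 : A)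

/-- The finitely many elements `d(c i j)` lie in the span of one independent family. Applying `ε` to
the factor `H` of `H ⊗ A` turns coinvariance and the preimage equation into the two scalar
conditions. -/
theorem IsColinear.exists_isTranslationFamily {γ d : H →ₗ[k] A} (hγ : IsColinear γ) {n : ℕ}
    {c : Matrix (Fin n) (Fin n) H} (hc : IsComatrix k c)
    (h1 : ∀ i j, ∑ m, c i m ⊗ₜ[k] d (c m j) ∈ coinvariants k H (H ⊗[k] A))
    (h2 : ∀ i j, ∑ m, hopfAct (k := k) H (∑ n, c i n ⊗ₜ[k] d (c n m)) (γ (c m j)) =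
          c i j ⊗ₜ[k] (1 : A)) :
    ∃ (N : ℕ) (x : Fin N → A) (a : Matrix (Fin N) (Fin N) H) (t : Fin n → Fin n → Fin N → k),
      IsTranslationFamily γ d c x a t := by
  obtain ⟨N, x, a, hx, hf, hs⟩ := exists_isComoduleFamily (k := k) (H := H)
    fun p : Fin n × Fin n => d (c p.1 p.2)
  have ht : ∀ i j, ∃ t : Fin N → k, ∑ s, t s • x s = d (c i j) := fun i j =>
    (Submodule.mem_span_range_iff_exists_fun k).1 (hs (i, j))
  choose t ht using ht
  refine ⟨N, x, a, t, hc, hf, fun i j => (ht i j).symm, fun j i s' => ?_, fun i j => ?_⟩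
  · have e := congrArg (LinearMap.rTensor H (counitLeft k H A)) (mem_coinvariants.1 (h1 i j))
    have e1 : ∀ m s, coaction k H (H ⊗[k] A) (c i m ⊗ₜ x s) = _ := fun m s =>
      hc.cofreeCoact_apply hf i m s
    simp only [← ht, TensorProduct.tmul_sum, TensorProduct.tmul_smul, map_sum, map_smul, e1,
      LinearMap.rTensor_tmul, counitLeft_tmul, hc.counit_apply, TensorProduct.sum_tmul,
      ← TensorProduct.smul_tmul', Finset.smul_sum] at e
    simp only [Matrix.one_apply, ite_smul, one_smul, zero_smul, smul_ite, smul_zero,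
      Finset.sum_ite_irrel, Finset.sum_const_zero, Finset.sum_ite_eq, Finset.mem_univ, if_true,
      ← TensorProduct.tmul_smul] at e
    rw [← sum_rotate₃] at e
    simp only [← TensorProduct.tmul_sum] at e
    exact congrFun (sum_tmul_left_injective hx e) s'
  · have e := congrArg (counitLeft k H A) (h2 i j)
    have e1 : ∀ n s m, hopfAct (k := k) H (c i n ⊗ₜ[k] x s) (γ (c m j)) = _ := fun n s m =>
      hc.cofreeAct_apply hf (hγ.isComoduleFamily hc m) i n s j
    simp only [← ht, TensorProduct.tmul_sum, TensorProduct.tmul_smul, map_sum, map_smul,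
      sum_hopfAct, smul_hopfAct, e1, counitLeft_tmul, hc.counit_apply, Finset.smul_sum] at e
    simpa only [Matrix.one_apply, ite_smul, one_smul, zero_smul, smul_ite, smul_zero,
      Finset.sum_ite_irrel, Finset.sum_const_zero, Finset.sum_ite_eq, Finset.mem_univ, if_true,
      smul_smul, mul_comm (t _ _ _)] using e

/-! ### Properties of the companion map -/

section TranslationFamily

variable {γ d : H →ₗ[k] A} {c : Matrix l l H} {x : κ → A} {a : Matrix κ κ H} {t : l → l → κ → k}

theorem IsTranslationFamily.sum_mul_mem (h : IsTranslationFamily γ d c x a t) (hγ : IsColinear γ)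
    (i j : l) : ∑ m, γ (c i m) * d (c m j) ∈ coinvariants k H A := by
  have e : ∀ m s, coaction k H A (γ (c i m) * x s) = _ := fun m s =>
    (hγ.isComoduleFamily h.isComatrix i).coaction_mul_apply h.isComoduleFamily m s
  rw [mem_coinvariants]
  simp only [h.map_apply, Finset.mul_sum, mul_smul_comm, map_sum, map_smul, e, Finset.smul_sum]
  rw [sum_rotate₄, sum_rotate₄]
  simp only [← TensorProduct.tmul_smul, ← TensorProduct.tmul_sum, h.sum_smul_mul,
    TensorProduct.sum_tmul]
  simp [TensorProduct.smul_tmul']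

/-- Reassociating the triple product reproduces the preimage equation for `c ⊗ 1`, multiplied on the
left by `γ`. -/
theorem IsTranslationFamily.sum_mul_mul (h : IsTranslationFamily γ d c x a t) (hγ : IsColinear γ)
    (i q : l) : ∑ j, (∑ m, γ (c i m) * d (c m j)) * γ (c j q) = γ (c i q) := by
  have e : ∀ j m s, (γ (c i m) * x s) * γ (c j q) = _ := fun j m s =>
    (hγ.isComoduleFamily h.isComatrix i).mul_mul_apply h.isComoduleFamily
      (hγ.isComoduleFamily h.isComatrix j) m s q
  simp only [h.map_apply, Finset.mul_sum, Finset.sum_mul, mul_smul_comm, smul_mul_assoc, e,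
    Finset.smul_sum, smul_smul]
  have e' : ∀ m', ∑ j, ∑ m, ∑ s, ∑ s', ∑ r, (t m j s * omega (k := k) (c m' m ⊗ₜ (a s' s ⊗ₜ c r q))) •
      (γ (c i m') * (x s' * γ (c j r))) = (1 : Matrix l l k) m' q • γ (c i m') := by
    intro m'
    have := congrArg (γ (c i m') * ·) (h.sum_mul m' q)
    simpa only [Finset.mul_sum, mul_smul_comm, mul_one, mul_comm (omega _)] using this
  conv_lhs => enter [2, j]; rw [← sum_rotate₃]
  rw [Finset.sum_comm]
  simp only [e']
  simp [Matrix.one_apply, ite_smul]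

variable (k) in
/-- The coefficients of the companion map attached to a translation map. -/
def companionCoeff (c : Matrix l l H) (a : Matrix κ κ H) (t : l → l → κ → k) (j i : l) (s' : κ) :
    k :=
  ∑ m, ∑ s, chi k H (c i m ⊗ₜ a s' s) * t m j s

variable (H) in
/-- `h ↦ d(h₂)₀ χ(h₁, d(h₂)₁)`. -/
def companion (d : H →ₗ[k] A) : H →ₗ[k] A :=
  (TensorProduct.rid k A).toLinearMap ∘ₗ LinearMap.lTensor A (chi k H) ∘ₗ
    (TensorProduct.leftComm k H A H).toLinearMap ∘ₗ LinearMap.lTensor H (coaction k H A ∘ₗ d) ∘ₗ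
    Coalgebra.comul

theorem IsTranslationFamily.companion_apply (h : IsTranslationFamily γ d c x a t) (i j : l) :
    companion H d (c i j) = ∑ s', companionCoeff k c a t j i s' • x s' := by
  simp only [companion, LinearMap.comp_apply, h.isComatrix.comul_apply, map_sum,
    LinearMap.lTensor_tmul, h.map_apply, map_smul, h.isComoduleFamily.coaction_apply,
    TensorProduct.tmul_sum, TensorProduct.tmul_smul, LinearEquiv.coe_coe,
    TensorProduct.leftComm_tmul, TensorProduct.rid_tmul, Finset.smul_sum, smul_smul,
    companionCoeff, Finset.sum_smul, mul_comm (t _ _ _)]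
  rw [← sum_rotate₃]

theorem IsTranslationFamily.coaction_companion (h : IsTranslationFamily γ d c x a t) (i j : l) :
    coaction k H A (companion H d (c i j)) =
      ∑ i', companion H d (c i' j) ⊗ₜ[k] S (k := k) (c i i') := by
  have e := fun m => sum_chi_smul_mul h.isComatrix h.isComoduleFamily.isComatrix
    (t := fun m s => t m j s) (h.sum_smul_mul j) i m
  simp only [h.companion_apply, map_sum, map_smul, h.isComoduleFamily.coaction_apply,
    Finset.smul_sum, TensorProduct.sum_tmul, ← TensorProduct.smul_tmul', ← TensorProduct.tmul_smul]
  rw [Finset.sum_comm]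
  conv_rhs => rw [Finset.sum_comm]
  simp only [← TensorProduct.tmul_sum, companionCoeff, Finset.sum_smul, e]

/-- The companion is a refinement of `d`: its convolution with `β` on the left is `d`. The
coefficients are those of `sum_chi_mul_beta`. -/
theorem IsTranslationFamily.sum_beta_companion (h : IsTranslationFamily γ d c x a t) (i q : l) :
    ∑ j, beta (k := k) (c i j) • companion H d (c j q) = d (c i q) := by
  have e := sum_chi_mul_beta h.isComatrix h.isComoduleFamily.isComatrix
    (t := fun m s => t m q s) (h.sum_smul_mul q) i
  simp only [h.companion_apply, h.map_apply, Finset.smul_sum, smul_smul]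
  rw [Finset.sum_comm]
  simp only [← Finset.sum_smul, ← e, companionCoeff, Finset.mul_sum]
  simp only [mul_left_comm (beta _)]

/-- Pairing the coaction of the preimage equation with `χ` yields `δγ` on one side, by
`sum_chi_mul_omega`, and `χ(h, 1) = α(h)` on the other. -/
theorem IsTranslationFamily.sum_companion_mul (h : IsTranslationFamily γ d c x a t)
    (hγ : IsColinear γ) (i q : l) :
    ∑ j, companion H d (c i j) * γ (c j q) = alpha (k := k) (c i q) • (1 : A) := by
  have e := fun j s' n => sum_chi_mul_omega h.isComatrix h.isComoduleFamily.isComatrix h.isComatrix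
    (t := fun m s => t m j s) (h.sum_smul_mul j) i s' n q
  -- The map `G j'` is `a ↦ a₀ χ(c i j', a₁)`.
  let G : l → A →ₗ[k] A := fun j' => (TensorProduct.rid k A).toLinearMap ∘ₗ
    LinearMap.lTensor A (chi k H ∘ₗ TensorProduct.mk k H H (c i j')) ∘ₗ coaction k H A
  have hG : ∀ j' m s' r, G j' (x s' * γ (c m r)) =
      ∑ s'', ∑ r'', chi k H (c i j' ⊗ₜ (a s'' s' * c r'' r)) • (x s'' * γ (c m r'')) := by
    intro j' m s' r
    have e1 : coaction k H A (x s' * γ (c m r)) = _ :=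
      h.isComoduleFamily.coaction_mul_apply (hγ.isComoduleFamily h.isComatrix m) s' r
    simp [G, e1]
  have hG1 : ∀ j', G j' 1 = alpha (k := k) (c i j') • (1 : A) := by
    intro j'
    simp [G, mem_coinvariants.1 (one_mem_coinvariants (k := k) (H := H) (A := A)),
      h.isComatrix.chi_apply, omegaInv_one_right, counit_S, h.isComatrix.counit_apply,
      Matrix.one_apply]
  have h1 : ∑ j', G j' (∑ m, ∑ n, ∑ s, ∑ s', ∑ r, (omega (k := k) (c j' n ⊗ₜ
      (a s' s ⊗ₜ c r q)) * t n m s) • (x s' * γ (c m r))) = alpha (k := k) (c i q) • (1 : A) := by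
    simp only [h.sum_mul, map_smul, hG1]
    simp [Matrix.one_apply, ite_smul]
  have h2 : ∀ j, companion H d (c i j) * γ (c j q) =
      ∑ s', ∑ n, (∑ j', ∑ m', chi k H (c i j' ⊗ₜ a s' m') *
        (t j' j m' * (1 : Matrix l l k) n q)) • (x s' * γ (c j n)) := by
    intro j
    rw [h.companion_apply, Finset.sum_mul]
    refine Finset.sum_congr rfl fun s' _ => ?_
    simp only [← mul_assoc, ← Finset.sum_mul, smul_mul_assoc]
    simp [Matrix.one_apply, ite_smul, companionCoeff]
  rw [← h1]
  simp only [h2, e, map_sum, map_smul, hG, Finset.smul_sum, Finset.mul_sum, Finset.sum_smul,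
    smul_smul]
  conv_lhs => enter [2, j, 2, s]; rw [sum_rotate₆]
  conv_lhs => enter [2, j]; rw [sum_rotate₆]
  rw [Finset.sum_comm]
  conv_rhs => enter [2, j', 2, m]; rw [sum_rotate₄, sum_rotate₄]
  simp only [mul_comm (chi k H _)]

/-- The elements `z j = ∑ γ(c i m) d(c m j)` are coinvariant, and `∑ z j γ(c j q) = γ(c i q)`.
Uniqueness of coordinates in the normal basis gives `∑ z j ⊗ c j q = 1 ⊗ c i q`, and `id ⊗ ε`
extracts `z q`. -/
theorem IsTranslationFamily.sum_mul_eq (h : IsTranslationFamily γ d c x a t)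
    (hγ : IsNormalBasis γ) (i q : l) :
    ∑ m, γ (c i m) * d (c m q) = (1 : Matrix l l k) i q • (1 : A) := by
  let z : l → coinvariants k H A := fun j =>
    ⟨∑ m, γ (c i m) * d (c m j), h.sum_mul_mem hγ.colinear i j⟩
  have e : ∀ q, coinvMulMap γ (∑ j, z j ⊗ₜ[k] c j q) = coinvMulMap γ (1 ⊗ₜ c i q) := by
    intro q
    rw [map_sum, coinvMulMap_tmul]
    refine (h.sum_mul_mul hγ.colinear i q).trans ?_
    exact (one_mul _).symm
  have e1 := congrArg (fun t => (idCounit k H (coinvariants k H A) t : A)) (hγ.bijective.1 (e q))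
  simpa [idCounit, h.isComatrix.counit_apply, Matrix.one_apply, ite_smul, z, apply_ite, coe_coinv_one] using e1

theorem IsTranslationFamily.sum_mul_companion (h : IsTranslationFamily γ d c x a t)
    (hγ : IsNormalBasis γ) (i q : l) :
    ∑ m, ∑ n, beta (k := k) (c m n) • (γ (c i m) * companion H d (c n q)) =
      (1 : Matrix l l k) i q • (1 : A) := by
  simp only [← mul_smul_comm, ← Finset.mul_sum, h.sum_beta_companion, h.sum_mul_eq hγ]

end TranslationFamily

theorem IsNormalBasis.isCleft_of_bijective {γ : H →ₗ[k] A} (hγ : IsNormalBasis γ)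
    (hb : Function.Bijective (coinvActMap (H ⊗[k] A) γ)) : IsCleft k H A := by
  obtain ⟨d, hd⟩ := hγ.colinear.exists_translation hb
  have hfam := fun (n : ℕ) (c : Matrix (Fin n) (Fin n) H) (hc : IsComatrix k c) =>
    hγ.colinear.exists_isTranslationFamily hc (hd n c hc).1 (hd n c hc).2
  -- The coefficients `t` depend on the comatrix, while `companion H d` is one linear map on all of
  -- `H`. Each axiom is therefore an equation between linear maps, checked on one comatrix at a
  -- time.
  refine isCleft_iff.2 ⟨γ, companion H d, hγ.colinear, LinearMap.congr_fun
    (f := coaction k H A ∘ₗ companion H d) (g := TensorProduct.map (companion H d) S ∘ₗ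
      (TensorProduct.comm k H H).toLinearMap ∘ₗ Coalgebra.comul) ?_, LinearMap.congr_fun
    (f := LinearMap.mul' k A ∘ₗ TensorProduct.map (companion H d) γ ∘ₗ Coalgebra.comul)
    (g := LinearMap.toSpanSingleton k A 1 ∘ₗ alpha) ?_, LinearMap.congr_fun
    (f := LinearMap.mul' k A ∘ₗ TensorProduct.map (γ ∘ₗ hitLeft beta) (companion H d) ∘ₗ
      Coalgebra.comul)
    (g := LinearMap.toSpanSingleton k A 1 ∘ₗ Coalgebra.counit) ?_⟩ <;>
  refine coalgebra_hom_ext (k := k) fun n c hc i j => ?_ <;>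
  obtain ⟨N, x, a, t, h⟩ := hfam n c hc
  · refine (h.coaction_companion i j).trans ?_
    simp [hc.comul_apply]
  · exact (hc.mul_map _ _ i j).trans (h.sum_companion_mul hγ.colinear i j)
  · refine (hc.mul_map_hitLeft _ _ i j).trans ?_
    rw [h.sum_mul_companion hγ, ← hc.counit_apply]
    rfl

/-- Bijectivity of the counit at the single object `H ⊗ A` suffices. -/
theorem IsNormalBasis.isCleft_of_weakStructureTheorem {γ : H →ₗ[k] A} (hγ : IsNormalBasis γ)
    (h : WeakStructureTheorem k H A) : IsCleft k H A :=
  hγ.isCleft_of_bijective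
    ((hγ.counit_bijective_iff (RelHopfModuleCat.mk (H ⊗[k] A))).1 (h (.mk (H ⊗[k] A))))

end Translation

end CoquasiHopf

end

/-! ### The main theorem -/

theorem mainTheorem1 (k : Type w) (H : Type u) [Field k] [NonAssocRing H] [Module k H]
    [IsScalarTower k H H] [SMulCommClass k H H] [CoquasiHopf.CoquasiHopfAlgebra k H]
    (hS : Function.Bijective (CoquasiHopf.CoquasiHopfAlgebra.S (k := k) (H := H)))
    (A : Type u) [NonAssocRing A] [Module k A] [IsScalarTower k A A] [SMulCommClass k A A]
    [CoquasiHopf.ComoduleAlgebra k H A] :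
    List.TFAE [
      CoquasiHopf.IsCleft k H A,
      CoquasiHopf.WeakStructureTheorem k H A ∧ CoquasiHopf.NormalBasisProperty k H A,
      CoquasiHopf.IsGalois k H A ∧ CoquasiHopf.NormalBasisProperty k H A] ∧
    (CoquasiHopf.IsCleft k H A →
      Nonempty (CategoryTheory.Equivalence
        (ModuleCat.{u} (CoquasiHopf.coinvariants k H A)ᵐᵒᵖ)
        (CoquasiHopf.RelHopfModuleCat k H A)) ∧
      CoquasiHopf.StrongStructureTheorem k H A) := by
  refine ⟨?_, fun h => ?_⟩
  · tfae_have 1 → 2 := fun h => by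
      obtain ⟨γ, δ, h⟩ := CoquasiHopf.isCleft_iff.1 h
      exact ⟨h.weakStructureTheorem, CoquasiHopf.normalBasisProperty_iff.2 ⟨γ, h.isNormalBasis⟩⟩
    tfae_have 2 → 1 := fun ⟨h, hγ⟩ => by
      obtain ⟨γ, hγ⟩ := CoquasiHopf.normalBasisProperty_iff.1 hγ
      exact hγ.isCleft_of_weakStructureTheorem h
    tfae_have 1 → 3 := fun h => by
      obtain ⟨γ, δ, h⟩ := CoquasiHopf.isCleft_iff.1 h
      exact ⟨h.isGalois, CoquasiHopf.normalBasisProperty_iff.2 ⟨γ, h.isNormalBasis⟩⟩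
    tfae_have 3 → 1 := fun ⟨h, hγ⟩ => by
      obtain ⟨γ, hγ⟩ := CoquasiHopf.normalBasisProperty_iff.1 hγ
      exact hγ.isCleft_of_isGalois h
    tfae_finish
  · obtain ⟨γ, δ, h⟩ := CoquasiHopf.isCleft_iff.1 h
    exact ⟨h.strongStructureTheorem.equivalence, h.strongStructureTheorem⟩
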